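/- All $\omega$-categories are strict and globular, and all their elements have finite dimension; $s_m,t_m,*_m$ denote the $m$-source, the $m$-target and the composition along $m$-cells. Let $\mathcal C$ be a non-contracting $\omega$-category, i.e. $s_1x$ and $t_1x$ are $1$-dimensional for every $x$ of dimension at least $1$. Its path $\omega$-category $\mathbb P\mathcal C$ consists of the elements of dimension at least $1$, with $s_{m+1},t_{m+1},*_{m+1}$ as $m$-source, $m$-target and $m$-composition. Let $\mathbb U$ be the forgetful functor from $\omega$-categories to globular sets, $\mathbb F$ its left adjoint, and let $\mathcal R^-$ be the equivalence relation on $\mathbb P\mathcal C$ generated by $x\sim x*_0y$ whenever $x,y,x*_0y\in\mathbb P\mathcal C$. The negative semi-path $\omega$-category $\mathbb P^-\mathcal C$ is the pushout of $\mathbb F(\mathbb U\mathbb P\mathcal C)\to\mathbb F(\mathbb U\mathbb P\mathcal C/\mathcal R^-)$ along the counit $\mathbb F(\mathbb U\mathbb P\mathcal C)\to\mathbb P\mathcal C$; write $h^-:\mathbb P\mathcal C\to\mathbb P^-\mathcal C$ for the canonical $\omega$-functor. The $0$-source $s_0$ of $\mathcal C$ induces a grading of $\mathbb P^-\mathcal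 C$ by the set of $0$-dimensional elements of $\mathcal C$; for such an element $\alpha$, $\mathbb P^-_\alpha\mathcal C$ denotes the fibre over $\alpha$. Let $I^m$ be the $\omega$-category of the $m$-cube, whose faces are the words of length $m$ in the letters $-,0,+$, and let $\Delta^m$ be the $\omega$-category of the $m$-simplex (Street's oriental), whose faces are the non-empty subsets $\sigma$ of $\{0,\dots,m\}$; write $R(x)$ for the element given by a face $x$. Here the codimension-one source (resp. target) faces of a face of $I^m$ are obtained by replacing the $i$-th zero by $(-)^i$ (resp. $(-)^{i+1}$), and those of a face of $\Delta^m$ by removing an element in odd (resp. even) position, positions being counted from $1$. For a face $\sigma$ of $\Delta^n$ let $\phi_n^-(\sigma)=k_1\dots k_{n+1}$ be the face of $I^{n+1}$ with $k_{j+1}=0$ if $j\in\sigma$ and $k_{j+1}=-$ otherwise. The cubes $I^m$ are non-contracting. Theorem: for every $n\ge 0$ there is exactly one isomorphism of $\omega$-categories $$\Delta^n\;\cong\;\mathbb P^-_{R(-\cdots-)}(I^{n+1})$$ which sends $R(\sigma)$ to $h^-(R(\phi_n^-(\sigma)))$ for every face $\sigma$ of $\Delta^n$. -/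

import Mathlib

open CategoryTheory

universe u

/-! ## Strict globular ω-categories

Signs `α ∈ {-, +}` are elements of `ℤˣ = {-1, 1}`; `d (-1) n` is the `n`-source `s_n` and `d 1 n` is
the `n`-target `t_n`. -/

/-- A (strict, globular) ω-category in the one-sorted presentation: a set with source and target maps
and with partially defined compositions `x *_n y` for `t_n x = s_n y`; all elements have finite
dimension. -/
structure OmegaCat where
  carrier : Type u
  d : ℤˣ → ℕ → carrier → carrier
  comp : ∀ (n : ℕ) (x y : carrier), d 1 n x = d (-1) n y → carrier
  d_d_lt : ∀ (β α : ℤˣ) (m n : ℕ) (x : carrier), m < n → d β m (d α n x) = d β m x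
  d_d_le : ∀ (β α : ℤˣ) (m n : ℕ) (x : carrier), n ≤ m → d β m (d α n x) = d α n x
  src_unit : ∀ (n : ℕ) (x : carrier) (h : d 1 n (d (-1) n x) = d (-1) n x),
    comp n (d (-1) n x) x h = x
  tgt_unit : ∀ (n : ℕ) (x : carrier) (h : d 1 n x = d (-1) n (d 1 n x)),
    comp n x (d 1 n x) h = x
  src_comp : ∀ (n : ℕ) (x y : carrier) (h : d 1 n x = d (-1) n y),
    d (-1) n (comp n x y h) = d (-1) n x
  tgt_comp : ∀ (n : ℕ) (x y : carrier) (h : d 1 n x = d (-1) n y),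
    d 1 n (comp n x y h) = d 1 n y
  d_comp : ∀ (α : ℤˣ) (m n : ℕ) (x y : carrier) (h : d 1 n x = d (-1) n y), m ≠ n →
    ∃ h' : d 1 n (d α m x) = d (-1) n (d α m y),
      d α m (comp n x y h) = comp n (d α m x) (d α m y) h'
  assoc : ∀ (n : ℕ) (x y z : carrier) (h₁ : d 1 n x = d (-1) n y)
    (h₂ : d 1 n (comp n x y h₁) = d (-1) n z) (h₃ : d 1 n y = d (-1) n z)
    (h₄ : d 1 n x = d (-1) n (comp n y z h₃)),
    comp n (comp n x y h₁) z h₂ = comp n x (comp n y z h₃) h₄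
  interchange : ∀ (m n : ℕ) (x y z w : carrier), m ≠ n →
    ∀ (h₁ : d 1 n x = d (-1) n y) (h₂ : d 1 n z = d (-1) n w)
      (h₃ : d 1 m (comp n x y h₁) = d (-1) m (comp n z w h₂))
      (h₄ : d 1 m x = d (-1) m z) (h₅ : d 1 m y = d (-1) m w)
      (h₆ : d 1 n (comp m x z h₄) = d (-1) n (comp m y w h₅)),
    comp m (comp n x y h₁) (comp n z w h₂) h₃ = comp n (comp m x z h₄) (comp m y w h₅) h₆
  finite_dim : ∀ x : carrier, ∃ n : ℕ, d (-1) n x = x ∧ d 1 n x = x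

/-- An ω-functor. -/
@[ext]
structure OmegaFunctor (C D : OmegaCat.{u}) where
  toFun : C.carrier → D.carrier
  map_d : ∀ (α : ℤˣ) (n : ℕ) (x : C.carrier), toFun (C.d α n x) = D.d α n (toFun x)
  map_comp : ∀ (n : ℕ) (x y : C.carrier) (h : C.d 1 n x = C.d (-1) n y)
    (h' : D.d 1 n (toFun x) = D.d (-1) n (toFun y)),
    toFun (C.comp n x y h) = D.comp n (toFun x) (toFun y) h'

/-- The category of ω-categories. -/
instance OmegaCat.category : Category OmegaCat.{u} where
  Hom C D := OmegaFunctor C D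
  id C := ⟨fun x => x, fun _ _ _ => rfl, fun _ _ _ _ _ => rfl⟩
  comp {C D E} F G :=
    { toFun := fun x => G.toFun (F.toFun x)
      map_d := fun α n x => by rw [F.map_d, G.map_d]
      map_comp := fun n x y h h' => by
        have h₁ : D.d 1 n (F.toFun x) = D.d (-1) n (F.toFun y) := by
          rw [← F.map_d, ← F.map_d, h]
        rw [F.map_comp n x y h h₁, G.map_comp n _ _ h₁ h'] }

namespace OmegaCat

/-- The underlying map of a morphism of ω-categories. -/
def app {C D : OmegaCat.{u}} (F : C ⟶ D) (x : C.carrier) : D.carrier := OmegaFunctor.toFun F x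

theorem hom_ext {C D : OmegaCat.{u}} {F G : C ⟶ D} (h : ∀ x, app F x = app G x) : F = G :=
  OmegaFunctor.ext (funext h)

theorem app_d {C D : OmegaCat.{u}} (F : C ⟶ D) (α : ℤˣ) (n : ℕ) (x : C.carrier) :
    app F (C.d α n x) = D.d α n (app F x) := OmegaFunctor.map_d F α n x

theorem app_comp {C D : OmegaCat.{u}} (F : C ⟶ D) (n : ℕ) (x y : C.carrier)
    (h : C.d 1 n x = C.d (-1) n y) (h' : D.d 1 n (app F x) = D.d (-1) n (app F y)) :
    app F (C.comp n x y h) = D.comp n (app F x) (app F y) h' := OmegaFunctor.map_comp F n x y h h'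

theorem comp_congr (C : OmegaCat.{u}) {n : ℕ} {x x' y y' : C.carrier}
    (h : C.d 1 n x = C.d (-1) n y) (hx : x = x') (hy : y = y') :
    C.comp n x y h = C.comp n x' y' (by rw [← hx, ← hy, h]) := by
  subst hx; subst hy; rfl

/-- The dimension of an element. -/
noncomputable def dim (C : OmegaCat.{u}) (x : C.carrier) : ℕ :=
  sInf {n : ℕ | C.d (-1) n x = x ∧ C.d 1 n x = x}

theorem dim_spec (C : OmegaCat.{u}) (x : C.carrier) (α : ℤˣ) : C.d α (C.dim x) x = x := by
  have h : C.dim x ∈ {n : ℕ | C.d (-1) n x = x ∧ C.d 1 n x = x} := Nat.sInf_mem (C.finite_dim x)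
  rcases Int.units_eq_one_or α with rfl | rfl
  · exact h.2
  · exact h.1

theorem d_of_dim_le (C : OmegaCat.{u}) {x : C.carrier} {n : ℕ} (h : C.dim x ≤ n) (α : ℤˣ) :
    C.d α n x = x := by
  conv_lhs => rw [← C.dim_spec x 1]
  rw [C.d_d_le _ _ _ _ _ h, C.dim_spec]

theorem dim_le_iff (C : OmegaCat.{u}) (x : C.carrier) (n : ℕ) (α : ℤˣ) :
    C.dim x ≤ n ↔ C.d α n x = x := by
  refine ⟨fun h => C.d_of_dim_le h α, fun h => Nat.sInf_le ⟨?_, ?_⟩⟩ <;>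
  · conv_lhs => rw [← h]
    rw [C.d_d_le _ _ _ _ _ le_rfl, h]

theorem one_le_dim_iff (C : OmegaCat.{u}) (x : C.carrier) (α : ℤˣ) :
    1 ≤ C.dim x ↔ C.d α 0 x ≠ x := by
  have := C.dim_le_iff x 0 α
  rw [ne_eq, ← this]; omega

/-- An ω-category is non-contracting if `s_1 x` and `t_1 x` are `1`-dimensional for every `x` of
dimension at least `1`. -/
def NonContracting (C : OmegaCat.{u}) : Prop :=
  ∀ x : C.carrier, 1 ≤ C.dim x → C.dim (C.d (-1) 1 x) = 1 ∧ C.dim (C.d 1 1 x) = 1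

theorem NonContracting.d_succ {C : OmegaCat.{u}} (hC : C.NonContracting) {x : C.carrier}
    (hx : 1 ≤ C.dim x) (α : ℤˣ) (n : ℕ) : 1 ≤ C.dim (C.d α (n + 1) x) := by
  by_contra hlt
  have h₀ : C.dim (C.d α (n + 1) x) ≤ 1 := by omega
  have h₁ : C.dim (C.d α 1 x) = 1 := by
    rcases Int.units_eq_one_or α with rfl | rfl
    · exact (hC x hx).2
    · exact (hC x hx).1
  have h₂ : C.d α 1 (C.d α (n + 1) x) = C.d α 1 x := by
    rcases Nat.eq_zero_or_pos n with rfl | hn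
    · rw [C.d_d_le _ _ _ _ _ le_rfl]
    · exact C.d_d_lt _ _ _ _ _ (by omega)
  rw [C.d_of_dim_le h₀] at h₂
  rw [h₂] at hlt
  omega

/-- The sub-ω-category on a set of elements which is closed under all operations. -/
def sub (C : OmegaCat.{u}) (S : Set C.carrier) (hd : ∀ α n x, x ∈ S → C.d α n x ∈ S)
    (hc : ∀ n x y h, x ∈ S → y ∈ S → C.comp n x y h ∈ S) : OmegaCat.{u} where
  carrier := {x : C.carrier // x ∈ S}
  d α n x := ⟨C.d α n x.1, hd α n x.1 x.2⟩
  comp n x y h := ⟨C.comp n x.1 y.1 (congrArg Subtype.val h), hc n _ _ _ x.2 y.2⟩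
  d_d_lt β α m n x h := Subtype.ext (C.d_d_lt β α m n x.1 h)
  d_d_le β α m n x h := Subtype.ext (C.d_d_le β α m n x.1 h)
  src_unit n x h := Subtype.ext (C.src_unit n x.1 _)
  tgt_unit n x h := Subtype.ext (C.tgt_unit n x.1 _)
  src_comp n x y h := Subtype.ext (C.src_comp n x.1 y.1 _)
  tgt_comp n x y h := Subtype.ext (C.tgt_comp n x.1 y.1 _)
  d_comp α m n x y h hmn := by
    obtain ⟨h', e⟩ := C.d_comp α m n x.1 y.1 (congrArg Subtype.val h) hmn
    exact ⟨Subtype.ext h', Subtype.ext e⟩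
  assoc n x y z h₁ h₂ h₃ h₄ := Subtype.ext (C.assoc n x.1 y.1 z.1 _ _ _ _)
  interchange m n x y z w hmn h₁ h₂ h₃ h₄ h₅ h₆ :=
    Subtype.ext (C.interchange m n x.1 y.1 z.1 w.1 hmn _ _ _ _ _ _)
  finite_dim x := by
    obtain ⟨n, h₁, h₂⟩ := C.finite_dim x.1
    exact ⟨n, Subtype.ext h₁, Subtype.ext h₂⟩

/-- Membership in the sub-ω-category generated by a set of elements. -/
inductive Generated (C : OmegaCat.{u}) (S : Set C.carrier) : C.carrier → Prop
  | of (x : C.carrier) : x ∈ S → Generated C S x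
  | d (α : ℤˣ) (n : ℕ) (x : C.carrier) : Generated C S x → Generated C S (C.d α n x)
  | comp (n : ℕ) (x y : C.carrier) (h : C.d 1 n x = C.d (-1) n y) :
      Generated C S x → Generated C S y → Generated C S (C.comp n x y h)

/-- The sub-ω-category generated by a set of elements. -/
def generate (C : OmegaCat.{u}) (S : Set C.carrier) : OmegaCat.{u} :=
  C.sub {x | Generated C S x} (fun α n x hx => .d α n x hx) (fun n x y h hx hy => .comp n x y h hx hy)

/-- The discrete ω-category on a set: all elements are `0`-dimensional. -/
def disc (S : Type u) : OmegaCat.{u} where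
  carrier := S
  d _ _ x := x
  comp _ x _ _ := x
  d_d_lt _ _ _ _ _ _ := rfl
  d_d_le _ _ _ _ _ _ := rfl
  src_unit _ _ _ := rfl
  tgt_unit _ _ _ := rfl
  src_comp _ _ _ _ := rfl
  tgt_comp _ _ _ h := h
  d_comp _ _ _ _ _ h _ := ⟨h, rfl⟩
  assoc _ _ _ _ _ _ _ _ := rfl
  interchange _ _ _ _ _ _ _ _ _ _ _ _ _ := rfl
  finite_dim _ := ⟨0, rfl, rfl⟩

/-- The fibre over `a` of an ω-functor to a discrete ω-category, as a sub-ω-category. -/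
def fibre {C : OmegaCat.{u}} {S : Type u} (F : C ⟶ disc S) (a : S) : OmegaCat.{u} :=
  C.sub {x | app F x = a}
    (fun α n x (hx : app F x = a) => show app F (C.d α n x) = a by rw [app_d]; exact hx)
    (fun n x y h (hx : app F x = a) _ => by
      have h' : (disc S).d 1 n (app F x) = (disc S).d (-1) n (app F y) := by
        rw [← app_d, ← app_d, h]
      show app F (C.comp n x y h) = a
      rw [app_comp F n x y h h']; exact hx)

/-! ## The path ω-category -/

/-- The path ω-category `ℙC` of a non-contracting ω-category: its elements are those of dimension at
least `1`, and all operations are shifted by one. -/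
def path (C : OmegaCat.{u}) (hC : C.NonContracting) : OmegaCat.{u} where
  carrier := {x : C.carrier // 1 ≤ C.dim x}
  d α n x := ⟨C.d α (n + 1) x.1, hC.d_succ x.2 α n⟩
  comp n x y h := ⟨C.comp (n + 1) x.1 y.1 (congrArg Subtype.val h), by
    by_contra hlt
    have h₀ : C.dim (C.comp (n + 1) x.1 y.1 (congrArg Subtype.val h)) ≤ n + 1 := by omega
    have h₁ := C.d_of_dim_le h₀ (-1)
    rw [C.src_comp] at h₁
    have h₂ := hC.d_succ x.2 (-1) n
    rw [h₁] at h₂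
    exact hlt h₂⟩
  d_d_lt β α m n x h := Subtype.ext (C.d_d_lt β α _ _ x.1 (by omega))
  d_d_le β α m n x h := Subtype.ext (C.d_d_le β α _ _ x.1 (by omega))
  src_unit n x h := Subtype.ext (C.src_unit _ x.1 _)
  tgt_unit n x h := Subtype.ext (C.tgt_unit _ x.1 _)
  src_comp n x y h := Subtype.ext (C.src_comp _ x.1 y.1 _)
  tgt_comp n x y h := Subtype.ext (C.tgt_comp _ x.1 y.1 _)
  d_comp α m n x y h hmn := by
    obtain ⟨h', e⟩ := C.d_comp α (m + 1) (n + 1) x.1 y.1 (congrArg Subtype.val h) (by omega)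
    exact ⟨Subtype.ext h', Subtype.ext e⟩
  assoc n x y z h₁ h₂ h₃ h₄ := Subtype.ext (C.assoc _ x.1 y.1 z.1 _ _ _ _)
  interchange m n x y z w hmn h₁ h₂ h₃ h₄ h₅ h₆ :=
    Subtype.ext (C.interchange _ _ x.1 y.1 z.1 w.1 (by omega) _ _ _ _ _ _)
  finite_dim x := ⟨C.dim x.1, Subtype.ext (C.d_of_dim_le (Nat.le_succ _) _),
    Subtype.ext (C.d_of_dim_le (Nat.le_succ _) _)⟩

/-- The generating relation: `x` is related to `x *_0 y` whenever `x`, `y` and `x *_0 y` all belong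
to the path ω-category. -/
def germStep (C : OmegaCat.{u}) (hC : C.NonContracting) (x z : (C.path hC).carrier) : Prop :=
  ∃ (y : (C.path hC).carrier) (h : C.d 1 0 x.1 = C.d (-1) 0 y.1), z.1 = C.comp 0 x.1 y.1 h

/-- The equivalence relation `R⁻` on the path ω-category: the reflexive, symmetric and transitive
closure of the pairs `(x, x *_0 y)`. -/
def germRel (C : OmegaCat.{u}) (hC : C.NonContracting) :
    (C.path hC).carrier → (C.path hC).carrier → Prop :=
  Relation.EqvGen (C.germStep hC)

theorem germRel_d (C : OmegaCat.{u}) (hC : C.NonContracting) (α : ℤˣ) (n : ℕ)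
    {x z : (C.path hC).carrier} (h : C.germRel hC x z) :
    C.germRel hC ((C.path hC).d α n x) ((C.path hC).d α n z) := by
  induction h with
  | rel x z h =>
    obtain ⟨y, h, e⟩ := h
    refine .rel _ _ ⟨(C.path hC).d α n y, ?_, ?_⟩
    · exact (C.d_comp α (n + 1) 0 x.1 y.1 h (by omega)).1
    · show C.d α (n + 1) z.1 = _
      rw [e]
      exact (C.d_comp α (n + 1) 0 x.1 y.1 h (by omega)).2
  | refl x => exact .refl _
  | symm x y _ ih => exact .symm _ _ ih
  | trans x y z _ _ ih₁ ih₂ => exact .trans _ _ _ ih₁ ih₂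

end OmegaCat

/-! ## Globular sets -/

/-- A globular set; `face (-1)` is the source map and `face 1` the target map. -/
structure GlobSet where
  cells : ℕ → Type u
  face : ℤˣ → ∀ n : ℕ, cells (n + 1) → cells n
  globular : ∀ (β : ℤˣ) (n : ℕ) (x : cells (n + 2)),
    face β n (face (-1) (n + 1) x) = face β n (face 1 (n + 1) x)

/-- A morphism of globular sets. -/
@[ext]
structure GlobMap (G H : GlobSet.{u}) where
  toFun : ∀ n, G.cells n → H.cells n
  map_face : ∀ (α : ℤˣ) (n : ℕ) (x : G.cells (n + 1)),
    toFun n (G.face α n x) = H.face α n (toFun (n + 1) x)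

/-- The category of globular sets. -/
instance GlobSet.category : Category GlobSet.{u} where
  Hom G H := GlobMap G H
  id G := ⟨fun _ x => x, fun _ _ _ => rfl⟩
  comp F G := ⟨fun n x => G.toFun n (F.toFun n x), fun α n x => by rw [F.map_face, G.map_face]⟩

/-- The quotient of a globular set by relations which are compatible with the face maps. -/
def GlobSet.quot (G : GlobSet.{u}) (r : ∀ n, G.cells n → G.cells n → Prop)
    (hr : ∀ (α : ℤˣ) (n : ℕ) (x y : G.cells (n + 1)),
      r (n + 1) x y → r n (G.face α n x) (G.face α n y)) : GlobSet.{u} where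
  cells n := Quot (r n)
  face α n := Quot.map (G.face α n) (hr α n)
  globular β n x := by
    induction x using Quot.ind
    exact congrArg (Quot.mk _) (G.globular β n _)

/-- The canonical morphism to the quotient of a globular set. -/
def GlobSet.quotMk (G : GlobSet.{u}) (r : ∀ n, G.cells n → G.cells n → Prop)
    (hr : ∀ (α : ℤˣ) (n : ℕ) (x y : G.cells (n + 1)),
      r (n + 1) x y → r n (G.face α n x) (G.face α n y)) : G ⟶ G.quot r hr :=
  GlobMap.mk (fun n => Quot.mk (r n)) (fun _ _ _ => rfl)

/-- The forgetful functor from ω-categories to globular sets: the `n`-cells of an ω-category are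
its elements of dimension at most `n`. -/
def forgetGlob : OmegaCat.{u} ⥤ GlobSet.{u} where
  obj C :=
    { cells := fun n => {x : C.carrier // C.dim x ≤ n}
      face := fun α n x => ⟨C.d α n x.1, by
        rw [C.dim_le_iff _ _ 1, C.d_d_le _ _ _ _ _ le_rfl]⟩
      globular := fun β n x => Subtype.ext (by
        show C.d β n (C.d (-1) (n + 1) x.1) = C.d β n (C.d 1 (n + 1) x.1)
        rw [C.d_d_lt _ _ _ _ _ (Nat.lt_succ_self n), C.d_d_lt _ _ _ _ _ (Nat.lt_succ_self n)]) }
  map {C D} F := GlobMap.mk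
    (fun n x => ⟨OmegaCat.app F x.1, by
      have h := x.2
      rw [C.dim_le_iff _ _ 1] at h
      rw [D.dim_le_iff _ _ 1, ← OmegaCat.app_d, h]⟩)
    (fun α n x => Subtype.ext (OmegaCat.app_d F α n x.1))

/-! ## ω-categories presented by generators and relations -/

namespace OmegaCat

/-- Formal expressions in the operations of ω-categories. -/
inductive Term (X : Type u) : Type u
  | gen : X → Term X
  | d : ℤˣ → ℕ → Term X → Term X
  | comp : ℕ → Term X → Term X → Term X

/-- A presentation of an ω-category by generators and equations. -/
structure Presentation where
  Gen : Type u
  Eqn : Term Gen → Term Gen → Prop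
  finite_dim : ∀ x : Gen, ∃ n : ℕ, ∀ α : ℤˣ, Eqn (.d α n (.gen x)) (.gen x)

/-- `Rel a b`: the expressions `a` and `b` are both defined and their equality is derivable.
In particular `Rel a a` says that `a` is defined. -/
inductive Presentation.Rel (P : Presentation.{u}) : Term P.Gen → Term P.Gen → Prop
  | symm {a b} : Rel P a b → Rel P b a
  | trans {a b c} : Rel P a b → Rel P b c → Rel P a c
  | gen (x) : Rel P (.gen x) (.gen x)
  | eqn {a b} : P.Eqn a b → Rel P a a → Rel P b b → Rel P a b
  | d_congr {a b} (α n) : Rel P a b → Rel P (.d α n a) (.d α n b)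
  | comp_congr {a a' b b'} (n) : Rel P a a' → Rel P b b' → Rel P (.d 1 n a) (.d (-1) n b) →
      Rel P (.comp n a b) (.comp n a' b')
  | d_d_lt {a} (β α m n) : Rel P a a → m < n → Rel P (.d β m (.d α n a)) (.d β m a)
  | d_d_le {a} (β α m n) : Rel P a a → n ≤ m → Rel P (.d β m (.d α n a)) (.d α n a)
  | src_unit {a} (n) : Rel P a a → Rel P (.comp n (.d (-1) n a) a) a
  | tgt_unit {a} (n) : Rel P a a → Rel P (.comp n a (.d 1 n a)) a
  | src_comp {a b} (n) : Rel P (.comp n a b) (.comp n a b) →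
      Rel P (.d (-1) n (.comp n a b)) (.d (-1) n a)
  | tgt_comp {a b} (n) : Rel P (.comp n a b) (.comp n a b) →
      Rel P (.d 1 n (.comp n a b)) (.d 1 n b)
  | d_comp {a b} (α m n) : m ≠ n → Rel P (.comp n a b) (.comp n a b) →
      Rel P (.d α m (.comp n a b)) (.comp n (.d α m a) (.d α m b))
  | assoc {a b c} (n) : Rel P (.comp n (.comp n a b) c) (.comp n (.comp n a b) c) →
      Rel P (.comp n a (.comp n b c)) (.comp n a (.comp n b c)) →
      Rel P (.comp n (.comp n a b) c) (.comp n a (.comp n b c))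
  | interchange {a b c e} (m n) : m ≠ n →
      Rel P (.comp m (.comp n a b) (.comp n c e)) (.comp m (.comp n a b) (.comp n c e)) →
      Rel P (.comp n (.comp m a c) (.comp m b e)) (.comp n (.comp m a c) (.comp m b e)) →
      Rel P (.comp m (.comp n a b) (.comp n c e)) (.comp n (.comp m a c) (.comp m b e))

namespace Presentation

variable (P : Presentation.{u})

theorem Rel.left {P : Presentation.{u}} {a b : Term P.Gen} (h : P.Rel a b) : P.Rel a a :=
  h.trans h.symm

theorem Rel.right {P : Presentation.{u}} {a b : Term P.Gen} (h : P.Rel a b) : P.Rel b b :=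
  h.symm.trans h

/-- Finite-dimensionality of an expression. -/
def FinDim (a : Term P.Gen) : Prop := ∃ N : ℕ, ∀ k, N ≤ k → ∀ β : ℤˣ, P.Rel (.d β k a) a

theorem FinDim.of_rel {P : Presentation.{u}} {a b : Term P.Gen} (h : P.Rel a b)
    (ha : P.FinDim a) : P.FinDim b := by
  obtain ⟨N, hN⟩ := ha
  exact ⟨N, fun k hk β => ((h.d_congr β k).symm.trans (hN k hk β)).trans h⟩

theorem FinDim.of_d {P : Presentation.{u}} {a : Term P.Gen} (α : ℤˣ) (n : ℕ) (h : P.Rel a a) :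
    P.FinDim (.d α n a) := ⟨n, fun k hk β => .d_d_le β α k n h hk⟩

theorem finDim_of_rel {a b : Term P.Gen} (h : P.Rel a b) : P.FinDim a ∧ P.FinDim b := by
  have key : P.FinDim a → P.FinDim a ∧ P.FinDim b := fun ha => ⟨ha, ha.of_rel h⟩
  induction h with
  | symm h ih => exact (ih (fun ha => ⟨ha, ha.of_rel h⟩)).symm
  | trans h₁ h₂ ih₁ _ => exact key (ih₁ (fun ha => ⟨ha, ha.of_rel h₁⟩)).1
  | gen x =>
    refine key ?_
    obtain ⟨n, hn⟩ := P.finite_dim x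
    have h₁ : ∀ α, P.Rel (.d α n (.gen x)) (.gen x) := fun α =>
      .eqn (hn α) (.d_congr α n (.gen x)) (.gen x)
    exact ⟨n, fun k hk β => (((h₁ β).d_congr β k).symm.trans
      (.d_d_le β β k n (.gen x) hk)).trans (h₁ β)⟩
  | eqn h h₁ h₂ ih₁ _ => exact key (ih₁ (fun ha => ⟨ha, ha⟩)).1
  | d_congr α n h _ => exact key (.of_d α n h.left)
  | @comp_congr a a' b b' n h₁ h₂ h₃ ih₁ ih₂ _ =>
    refine key ?_
    obtain ⟨N₁, hN₁⟩ := (ih₁ (fun ha => ⟨ha, ha.of_rel h₁⟩)).1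
    obtain ⟨N₂, hN₂⟩ := (ih₂ (fun ha => ⟨ha, ha.of_rel h₂⟩)).1
    refine ⟨N₁ + N₂ + n + 1, fun k hk β => ?_⟩
    have e := hN₁ k (by omega) β
    have e' := hN₂ k (by omega) β
    have hc : P.Rel (.comp n a b) (.comp n a b) := .comp_congr n h₁.left h₂.left h₃
    refine (Rel.d_comp β k n (by omega) hc).trans (.comp_congr n e e' ?_)
    exact ((e.d_congr 1 n).trans h₃).trans (e'.d_congr (-1) n).symm
  | d_d_lt β α m n h _ _ => exact key (.of_d β m (.d_congr α n h))
  | d_d_le β α m n h _ _ => exact key (.of_d β m (.d_congr α n h))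
  | src_unit n h ih =>
    exact (key ((ih (fun ha => ⟨ha, ha⟩)).1.of_rel (Rel.src_unit n h).symm))
  | tgt_unit n h ih =>
    exact (key ((ih (fun ha => ⟨ha, ha⟩)).1.of_rel (Rel.tgt_unit n h).symm))
  | src_comp n h _ => exact key (.of_d _ _ h)
  | tgt_comp n h _ => exact key (.of_d _ _ h)
  | d_comp α m n _ h _ => exact key (.of_d _ _ h)
  | assoc n h₁ h₂ ih₁ _ => exact key (ih₁ (fun ha => ⟨ha, ha⟩)).1
  | interchange m n hmn h₁ h₂ ih₁ _ => exact key (ih₁ (fun ha => ⟨ha, ha⟩)).1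

/-- Derivable equality of defined expressions. -/
def setoid : Setoid {a : Term P.Gen // P.Rel a a} where
  r a b := P.Rel a.1 b.1
  iseqv := ⟨fun a => a.2, fun h => h.symm, fun h₁ h₂ => h₁.trans h₂⟩

/-- The elements of the presented ω-category: defined expressions up to derivable equality. -/
def Cell : Type u := Quotient P.setoid

/-- The element represented by a defined expression. -/
def cls (a : Term P.Gen) (ha : P.Rel a a) : P.Cell := Quotient.mk P.setoid ⟨a, ha⟩

theorem cls_eq {a b : Term P.Gen} (ha : P.Rel a a) (hb : P.Rel b b) :
    P.cls a ha = P.cls b hb ↔ P.Rel a b :=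
  ⟨fun h => Quotient.exact h, fun h => Quotient.sound h⟩

theorem ind {p : P.Cell → Prop} (h : ∀ a ha, p (P.cls a ha)) (x : P.Cell) : p x :=
  Quotient.ind (fun a => h a.1 a.2) x

/-- A representative. -/
noncomputable def rep (x : P.Cell) : Term P.Gen := (Quotient.out x).1

theorem rep_def (x : P.Cell) : P.Rel (P.rep x) (P.rep x) := (Quotient.out x).2

theorem cls_rep (x : P.Cell) : P.cls (P.rep x) (P.rep_def x) = x := Quotient.out_eq x

theorem rep_cls (a : Term P.Gen) (ha : P.Rel a a) : P.Rel (P.rep (P.cls a ha)) a :=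
  (P.cls_eq (P.rep_def _) ha).1 (P.cls_rep _)

/-- Sources and targets in the presented ω-category. -/
def cellD (α : ℤˣ) (n : ℕ) : P.Cell → P.Cell :=
  Quotient.map' (fun a => ⟨.d α n a.1, a.2.d_congr α n⟩) (fun _ _ h => Rel.d_congr α n h)

theorem cellD_cls (α : ℤˣ) (n : ℕ) (a : Term P.Gen) (ha : P.Rel a a) :
    P.cellD α n (P.cls a ha) = P.cls (.d α n a) (ha.d_congr α n) := rfl

theorem rel_of_composable {n : ℕ} {x y : P.Cell} (h : P.cellD 1 n x = P.cellD (-1) n y) :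
    P.Rel (.d 1 n (P.rep x)) (.d (-1) n (P.rep y)) := by
  rw [← P.cls_rep x, ← P.cls_rep y, cellD_cls, cellD_cls, cls_eq] at h
  exact h

/-- Composition in the presented ω-category. -/
noncomputable def cellComp (n : ℕ) (x y : P.Cell) (h : P.cellD 1 n x = P.cellD (-1) n y) :
    P.Cell :=
  P.cls (.comp n (P.rep x) (P.rep y))
    (.comp_congr n (P.rep_def x) (P.rep_def y) (P.rel_of_composable h))

theorem rel_of_cellD {n : ℕ} {a b : Term P.Gen} {ha : P.Rel a a} {hb : P.Rel b b}
    (h : P.cellD 1 n (P.cls a ha) = P.cellD (-1) n (P.cls b hb)) :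
    P.Rel (.d 1 n a) (.d (-1) n b) := by
  rwa [cellD_cls, cellD_cls, cls_eq] at h

theorem cellComp_cls (n : ℕ) (a b : Term P.Gen) (ha : P.Rel a a) (hb : P.Rel b b)
    (h : P.cellD 1 n (P.cls a ha) = P.cellD (-1) n (P.cls b hb)) :
    P.cellComp n (P.cls a ha) (P.cls b hb) h =
      P.cls (.comp n a b) (.comp_congr n ha hb (P.rel_of_cellD h)) := by
  refine (P.cls_eq _ _).2 (.comp_congr n (P.rep_cls a ha) (P.rep_cls b hb) ?_)
  exact P.rel_of_composable h

/-- The ω-category defined by a presentation. -/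
noncomputable def omegaCat : OmegaCat.{u} where
  carrier := P.Cell
  d := P.cellD
  comp := P.cellComp
  d_d_lt β α m n x h := by
    induction x using P.ind with | h a ha => exact (P.cls_eq _ _).2 (.d_d_lt β α m n ha h)
  d_d_le β α m n x h := by
    induction x using P.ind with | h a ha => exact (P.cls_eq _ _).2 (.d_d_le β α m n ha h)
  src_unit n x h := by
    induction x using P.ind with | h a ha =>
    simp only [cellD_cls] at h ⊢
    rw [cellComp_cls]
    exact (P.cls_eq _ _).2 (.src_unit n ha)
  tgt_unit n x h := by
    induction x using P.ind with | h a ha =>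
    simp only [cellD_cls] at h ⊢
    rw [cellComp_cls]
    exact (P.cls_eq _ _).2 (.tgt_unit n ha)
  src_comp n x y h := by
    induction x using P.ind with | h a ha =>
    induction y using P.ind with | h b hb =>
    rw [cellComp_cls]
    exact (P.cls_eq _ _).2 (.src_comp n (.comp_congr n ha hb (P.rel_of_cellD h)))
  tgt_comp n x y h := by
    induction x using P.ind with | h a ha =>
    induction y using P.ind with | h b hb =>
    rw [cellComp_cls]
    exact (P.cls_eq _ _).2 (.tgt_comp n (.comp_congr n ha hb (P.rel_of_cellD h)))
  d_comp α m n x y h hmn := by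
    induction x using P.ind with | h a ha =>
    induction y using P.ind with | h b hb =>
    have h₀ := P.rel_of_cellD h
    have h' : P.cellD 1 n (P.cellD α m (P.cls a ha)) =
        P.cellD (-1) n (P.cellD α m (P.cls b hb)) := by
      simp only [cellD_cls, cls_eq]
      rcases lt_or_gt_of_ne hmn with hlt | hlt
      · refine (Rel.d_d_le 1 α n m ha hlt.le).trans
          (((Rel.d_d_lt α 1 m n ha hlt).symm.trans (h₀.d_congr α m)).trans
          ((Rel.d_d_lt α (-1) m n hb hlt).trans (Rel.d_d_le (-1) α n m hb hlt.le).symm))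
      · exact ((Rel.d_d_lt 1 α n m ha hlt).trans h₀).trans (Rel.d_d_lt (-1) α n m hb hlt).symm
    refine ⟨h', ?_⟩
    simp only [cellD_cls, cellComp_cls] at h' ⊢
    exact (P.cls_eq _ _).2 (.d_comp α m n hmn (.comp_congr n ha hb h₀))
  assoc n x y z h₁ h₂ h₃ h₄ := by
    induction x using P.ind with | h a ha =>
    induction y using P.ind with | h b hb =>
    induction z using P.ind with | h c hc =>
    simp only [cellComp_cls] at h₂ h₄ ⊢
    exact (P.cls_eq _ _).2 (.assoc n
      (.comp_congr n (.comp_congr n ha hb (P.rel_of_cellD h₁)) hc (P.rel_of_cellD h₂))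
      (.comp_congr n ha (.comp_congr n hb hc (P.rel_of_cellD h₃)) (P.rel_of_cellD h₄)))
  interchange m n x y z w hmn h₁ h₂ h₃ h₄ h₅ h₆ := by
    induction x using P.ind with | h a ha =>
    induction y using P.ind with | h b hb =>
    induction z using P.ind with | h c hc =>
    induction w using P.ind with | h e he =>
    simp only [cellComp_cls] at h₃ h₆ ⊢
    exact (P.cls_eq _ _).2 (.interchange m n hmn
      (.comp_congr m (.comp_congr n ha hb (P.rel_of_cellD h₁))
        (.comp_congr n hc he (P.rel_of_cellD h₂)) (P.rel_of_cellD h₃))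
      (.comp_congr n (.comp_congr m ha hc (P.rel_of_cellD h₄))
        (.comp_congr m hb he (P.rel_of_cellD h₅)) (P.rel_of_cellD h₆)))
  finite_dim x := by
    induction x using P.ind with | h a ha =>
    obtain ⟨N, hN⟩ := (P.finDim_of_rel ha).1
    exact ⟨N, (P.cls_eq _ _).2 (hN N le_rfl _), (P.cls_eq _ _).2 (hN N le_rfl _)⟩

/-- The element given by a generator. -/
noncomputable def ofGen (x : P.Gen) : P.omegaCat.carrier := P.cls (.gen x) (.gen x)

end Presentation

/-- `Ev D f a v`: the expression `a` is defined in `D` and has the value `v` there when the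
generators are interpreted by `f`. -/
def Ev (D : OmegaCat.{u}) {X : Type u} (f : X → D.carrier) : Term X → D.carrier → Prop
  | .gen x, v => v = f x
  | .d α n a, v => ∃ w, Ev D f a w ∧ v = D.d α n w
  | .comp n a b, v => ∃ x y, ∃ h : D.d 1 n x = D.d (-1) n y,
      Ev D f a x ∧ Ev D f b y ∧ v = D.comp n x y h

theorem Ev.unique {D : OmegaCat.{u}} {X : Type u} {f : X → D.carrier} {a : Term X}
    {v w : D.carrier} (hv : Ev D f a v) (hw : Ev D f a w) : v = w := by
  induction a generalizing v w with
  | gen x => exact Eq.trans hv (Eq.symm hw)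
  | d α n a ih =>
    obtain ⟨v', h₁, rfl⟩ := hv
    obtain ⟨w', h₂, rfl⟩ := hw
    rw [ih h₁ h₂]
  | comp n a b iha ihb =>
    obtain ⟨x, y, h, h₁, h₂, rfl⟩ := hv
    obtain ⟨x', y', h', h₁', h₂', rfl⟩ := hw
    exact D.comp_congr h (iha h₁ h₁') (ihb h₂ h₂')

theorem Ev.sound (P : Presentation.{u}) {D : OmegaCat.{u}} {f : P.Gen → D.carrier}
    (hf : ∀ a b v w, P.Eqn a b → Ev D f a v → Ev D f b w → v = w) {a b : Term P.Gen}
    (h : P.Rel a b) : ∃ v, Ev D f a v ∧ Ev D f b v := by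
  induction h with
  | symm _ ih => obtain ⟨v, h₁, h₂⟩ := ih; exact ⟨v, h₂, h₁⟩
  | trans _ _ ih₁ ih₂ =>
    obtain ⟨v, h₁, h₂⟩ := ih₁
    obtain ⟨w, h₃, h₄⟩ := ih₂
    obtain rfl := h₂.unique h₃
    exact ⟨v, h₁, h₄⟩
  | gen x => exact ⟨f x, rfl, rfl⟩
  | eqn h _ _ ih₁ ih₂ =>
    obtain ⟨v, h₁, _⟩ := ih₁
    obtain ⟨w, h₂, _⟩ := ih₂
    obtain rfl := hf _ _ _ _ h h₁ h₂
    exact ⟨v, h₁, h₂⟩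
  | d_congr α n _ ih =>
    obtain ⟨v, h₁, h₂⟩ := ih
    exact ⟨D.d α n v, ⟨v, h₁, rfl⟩, ⟨v, h₂, rfl⟩⟩
  | comp_congr n _ _ _ ih₁ ih₂ ih₃ =>
    obtain ⟨v, h₁, h₂⟩ := ih₁
    obtain ⟨w, h₃, h₄⟩ := ih₂
    obtain ⟨_, ⟨v', h₅, rfl⟩, ⟨w', h₆, e⟩⟩ := ih₃
    obtain rfl := h₁.unique h₅
    obtain rfl := h₃.unique h₆
    exact ⟨D.comp n v w e, ⟨v, w, e, h₁, h₃, rfl⟩, ⟨v, w, e, h₂, h₄, rfl⟩⟩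
  | d_d_lt β α m n _ hmn ih =>
    obtain ⟨v, h, _⟩ := ih
    exact ⟨D.d β m v, ⟨_, ⟨v, h, rfl⟩, (D.d_d_lt β α m n v hmn).symm⟩, ⟨v, h, rfl⟩⟩
  | d_d_le β α m n _ hmn ih =>
    obtain ⟨v, h, _⟩ := ih
    exact ⟨D.d α n v, ⟨_, ⟨v, h, rfl⟩, (D.d_d_le β α m n v hmn).symm⟩, ⟨v, h, rfl⟩⟩
  | src_unit n _ ih =>
    obtain ⟨v, h, _⟩ := ih
    exact ⟨v, ⟨_, v, D.d_d_le _ _ _ _ _ le_rfl, ⟨v, h, rfl⟩, h, (D.src_unit n v _).symm⟩, h⟩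
  | tgt_unit n _ ih =>
    obtain ⟨v, h, _⟩ := ih
    exact ⟨v, ⟨v, _, (D.d_d_le _ _ _ _ _ le_rfl).symm, h, ⟨v, h, rfl⟩,
      (D.tgt_unit n v _).symm⟩, h⟩
  | src_comp n _ ih =>
    obtain ⟨_, ⟨x, y, h, h₁, h₂, rfl⟩, _⟩ := ih
    exact ⟨D.d (-1) n x, ⟨_, ⟨x, y, h, h₁, h₂, rfl⟩, (D.src_comp n x y h).symm⟩, ⟨x, h₁, rfl⟩⟩
  | tgt_comp n _ ih =>
    obtain ⟨_, ⟨x, y, h, h₁, h₂, rfl⟩, _⟩ := ih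
    exact ⟨D.d 1 n y, ⟨_, ⟨x, y, h, h₁, h₂, rfl⟩, (D.tgt_comp n x y h).symm⟩, ⟨y, h₂, rfl⟩⟩
  | d_comp α m n hmn _ ih =>
    obtain ⟨_, ⟨x, y, h, h₁, h₂, rfl⟩, _⟩ := ih
    obtain ⟨h', e⟩ := D.d_comp α m n x y h hmn
    exact ⟨_, ⟨_, ⟨x, y, h, h₁, h₂, rfl⟩, rfl⟩, ⟨_, _, h', ⟨x, h₁, rfl⟩, ⟨y, h₂, rfl⟩, e⟩⟩
  | assoc n _ _ ih₁ ih₂ =>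
    obtain ⟨v, hv, _⟩ := ih₁
    obtain ⟨w, hw, _⟩ := ih₂
    refine ⟨v, hv, ?_⟩
    suffices v = w by rw [this]; exact hw
    obtain ⟨_, z, h₂, ⟨x, y, h₁, hx, hy, rfl⟩, hz, rfl⟩ := hv
    obtain ⟨x', _, h₄, hx', ⟨y', z', h₃, hy', hz', rfl⟩, rfl⟩ := hw
    obtain rfl := hx.unique hx'
    obtain rfl := hy.unique hy'
    obtain rfl := hz.unique hz'
    exact D.assoc n x y z h₁ h₂ h₃ h₄
  | interchange m n hmn _ _ ih₁ ih₂ =>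
    obtain ⟨v, hv, _⟩ := ih₁
    obtain ⟨w, hw, _⟩ := ih₂
    refine ⟨v, hv, ?_⟩
    suffices v = w by rw [this]; exact hw
    obtain ⟨_, _, h₃, ⟨x, y, h₁, hx, hy, rfl⟩, ⟨z, t, h₂, hz, ht, rfl⟩, rfl⟩ := hv
    obtain ⟨_, _, h₆, ⟨x', z', h₄, hx', hz', rfl⟩, ⟨y', t', h₅, hy', ht', rfl⟩, rfl⟩ := hw
    obtain rfl := hx.unique hx'
    obtain rfl := hy.unique hy'
    obtain rfl := hz.unique hz'
    obtain rfl := ht.unique ht'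
    exact D.interchange m n x y z t hmn h₁ h₂ h₃ h₄ h₅ h₆

namespace Presentation

variable (P : Presentation.{u})

/-- An interpretation of the generators satisfying the equations. -/
def Valid (D : OmegaCat.{u}) (f : P.Gen → D.carrier) : Prop :=
  ∀ a b v w, P.Eqn a b → Ev D f a v → Ev D f b w → v = w

theorem ev_cls {a : Term P.Gen} {v : P.omegaCat.carrier} (h : Ev P.omegaCat P.ofGen a v) :
    ∃ ha : P.Rel a a, v = P.cls a ha := by
  induction a generalizing v with
  | gen x => exact ⟨.gen x, h⟩
  | d α n a ih =>
    obtain ⟨w, h₁, rfl⟩ := h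
    obtain ⟨ha, rfl⟩ := ih h₁
    exact ⟨ha.d_congr α n, rfl⟩
  | comp n a b iha ihb =>
    obtain ⟨x, y, h, h₁, h₂, rfl⟩ := h
    obtain ⟨ha, rfl⟩ := iha h₁
    obtain ⟨hb, rfl⟩ := ihb h₂
    exact ⟨.comp_congr n ha hb (P.rel_of_cellD h), P.cellComp_cls n a b ha hb h⟩

theorem valid_ofGen : P.Valid P.omegaCat P.ofGen := by
  intro a b v w h ha hb
  obtain ⟨ha', rfl⟩ := P.ev_cls ha
  obtain ⟨hb', rfl⟩ := P.ev_cls hb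
  exact (P.cls_eq _ _).2 (.eqn h ha' hb')

theorem ev_self {a : Term P.Gen} (ha : P.Rel a a) : Ev P.omegaCat P.ofGen a (P.cls a ha) := by
  obtain ⟨v, h, _⟩ := Ev.sound P P.valid_ofGen ha
  obtain ⟨_, rfl⟩ := P.ev_cls h
  exact h

theorem ev_app {D : OmegaCat.{u}} (F : P.omegaCat ⟶ D) {a : Term P.Gen}
    {v : P.omegaCat.carrier} (h : Ev P.omegaCat P.ofGen a v) :
    Ev D (fun x => app F (P.ofGen x)) a (app F v) := by
  induction a generalizing v with
  | gen x => exact congrArg (app F) h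
  | d α n a ih =>
    obtain ⟨w, h₁, rfl⟩ := h
    exact ⟨_, ih h₁, app_d F α n w⟩
  | comp n a b iha ihb =>
    obtain ⟨x, y, h, h₁, h₂, rfl⟩ := h
    have h' : D.d 1 n (app F x) = D.d (-1) n (app F y) := by rw [← app_d, ← app_d, h]
    exact ⟨_, _, h', iha h₁, ihb h₂, app_comp F n x y h h'⟩

theorem hom_ext_gen {D : OmegaCat.{u}} {F G : P.omegaCat ⟶ D}
    (h : ∀ x, app F (P.ofGen x) = app G (P.ofGen x)) : F = G := by
  refine hom_ext (fun v => ?_)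
  induction v using P.ind with | h a ha =>
  have h₁ := P.ev_app F (P.ev_self ha)
  have h₂ := P.ev_app G (P.ev_self ha)
  rw [← funext h] at h₂
  exact h₁.unique h₂

/-- The ω-functor out of a presented ω-category defined by values of the generators. -/
noncomputable def lift {D : OmegaCat.{u}} (f : P.Gen → D.carrier) (hf : P.Valid D f) :
    P.omegaCat ⟶ D :=
  have key : ∀ x : P.Cell, ∃ v, Ev D f (P.rep x) v := fun x =>
    (Ev.sound P hf (P.rep_def x)).imp fun _ h => h.1
  have key' : ∀ (a : Term P.Gen) (ha : P.Rel a a), Ev D f a (key (P.cls a ha)).choose := by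
    intro a ha
    obtain ⟨v, h₁, h₂⟩ := Ev.sound P hf (P.rep_cls a ha)
    have h₃ := (key (P.cls a ha)).choose_spec
    rw [h₃.unique h₁]
    exact h₂
  OmegaFunctor.mk (C := P.omegaCat) (D := D) (fun x => (key x).choose)
    (fun α n x => by
      induction x using P.ind with | h a ha =>
      exact (key' _ (ha.d_congr α n)).unique ⟨_, key' a ha, rfl⟩)
    (fun n x y h h' => by
      induction x using P.ind with | h a ha =>
      induction y using P.ind with | h b hb =>
      have e : P.omegaCat.comp n (P.cls a ha) (P.cls b hb) h = _ := P.cellComp_cls n a b ha hb h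
      rw [e]
      exact (key' _ _).unique ⟨_, _, h', key' a ha, key' b hb, rfl⟩)

theorem lift_ofGen {D : OmegaCat.{u}} (f : P.Gen → D.carrier) (hf : P.Valid D f) (x : P.Gen) :
    app (P.lift f hf) (P.ofGen x) = f x := by
  have h := (Exists.choose_spec ((Ev.sound P hf (P.rep_def (P.ofGen x))).imp fun _ h => h.1))
  obtain ⟨v, h₁, h₂⟩ := Ev.sound P hf (P.rep_cls (.gen x) (.gen x))
  exact (h.unique h₁).trans h₂

end Presentation

/-! ## The free ω-category on a globular set -/

/-- The equations of the free ω-category on a globular set: sources and targets of the generators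
are prescribed, and an `n`-cell is a generator of dimension at most `n`. -/
inductive FreeEqn (G : GlobSet.{u}) :
    Term (Σ n : ℕ, G.cells n) → Term (Σ n : ℕ, G.cells n) → Prop
  | face (α : ℤˣ) (n : ℕ) (x : G.cells (n + 1)) :
      FreeEqn G (.d α n (.gen ⟨n + 1, x⟩)) (.gen ⟨n, G.face α n x⟩)
  | self (α : ℤˣ) (n : ℕ) (x : G.cells n) : FreeEqn G (.d α n (.gen ⟨n, x⟩)) (.gen ⟨n, x⟩)

/-- The presentation of the free ω-category on a globular set. -/
def freePres (G : GlobSet.{u}) : Presentation.{u} where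
  Gen := Σ n : ℕ, G.cells n
  Eqn := FreeEqn G
  finite_dim x := ⟨x.1, fun α => .self α x.1 x.2⟩

theorem freePres_face (G : GlobSet.{u}) (α : ℤˣ) (n : ℕ) (x : G.cells (n + 1)) :
    (freePres G).omegaCat.d α n ((freePres G).ofGen ⟨n + 1, x⟩) =
      (freePres G).ofGen ⟨n, G.face α n x⟩ :=
  ((freePres G).cls_eq _ _).2 (.eqn (.face α n x) (.d_congr _ _ (.gen _)) (.gen _))

theorem freePres_self (G : GlobSet.{u}) (α : ℤˣ) (n : ℕ) (x : G.cells n) :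
    (freePres G).omegaCat.d α n ((freePres G).ofGen ⟨n, x⟩) = (freePres G).ofGen ⟨n, x⟩ :=
  ((freePres G).cls_eq _ _).2 (.eqn (.self α n x) (.d_congr _ _ (.gen _)) (.gen _))

theorem freePres_valid (G : GlobSet.{u}) (D : OmegaCat.{u}) (g : G ⟶ forgetGlob.obj D) :
    (freePres G).Valid D (fun x => (GlobMap.toFun g x.1 x.2).1) := by
  rintro _ _ v w (⟨α, n, x⟩ | ⟨α, n, x⟩) ⟨v', h₁, rfl⟩ h₂
  · have h₁ : v' = _ := h₁
    have h₂ : w = _ := h₂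
    rw [h₁, h₂]
    exact (congrArg Subtype.val (GlobMap.map_face g α n x)).symm
  · have h₁ : v' = _ := h₁
    have h₂ : w = _ := h₂
    rw [h₁, h₂]
    exact D.d_of_dim_le (GlobMap.toFun g n x).2 α

/-- The universal property of the free ω-category on a globular set. -/
noncomputable def freeHomEquiv (G : GlobSet.{u}) (D : OmegaCat.{u}) :
    ((freePres G).omegaCat ⟶ D) ≃ (G ⟶ forgetGlob.obj D) where
  toFun F := GlobMap.mk (G := G) (H := forgetGlob.obj D)
    (fun n x => ⟨app F ((freePres G).ofGen ⟨n, x⟩), by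
      rw [D.dim_le_iff _ _ 1, ← app_d, freePres_self]⟩)
    (fun α n x => Subtype.ext (by
      show app F _ = D.d α n (app F _)
      rw [← app_d, freePres_face]))
  invFun g := (freePres G).lift _ (freePres_valid G D g)
  left_inv F := (freePres G).hom_ext_gen fun x => (freePres G).lift_ofGen _ (freePres_valid G D _) x
  right_inv g := GlobMap.ext (funext fun n => funext fun x =>
    Subtype.ext ((freePres G).lift_ofGen _ (freePres_valid G D g) ⟨n, x⟩))

theorem freeHomEquiv_naturality (G : GlobSet.{u}) (D E : OmegaCat.{u}) (g : D ⟶ E)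
    (h : (freePres G).omegaCat ⟶ D) :
    freeHomEquiv G E (h ≫ g) = freeHomEquiv G D h ≫ forgetGlob.map g := rfl

/-- The free ω-category functor from globular sets to ω-categories. -/
noncomputable def freeFunctor : GlobSet.{u} ⥤ OmegaCat.{u} :=
  Adjunction.leftAdjointOfEquiv (G := forgetGlob) (F_obj := fun G => (freePres G).omegaCat)
    freeHomEquiv freeHomEquiv_naturality

/-- The free functor is left adjoint to the forgetful functor. -/
noncomputable def freeAdj : freeFunctor.{u} ⊣ forgetGlob.{u} :=
  Adjunction.adjunctionOfEquivLeft freeHomEquiv freeHomEquiv_naturality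

/-! ## Pushouts of ω-categories -/

/-- The equations of a pushout. -/
inductive PushoutEqn {A C D : OmegaCat.{u}} (f : A ⟶ C) (g : A ⟶ D) :
    Term (C.carrier ⊕ D.carrier) → Term (C.carrier ⊕ D.carrier) → Prop
  | d_inl (α n) (x : C.carrier) :
      PushoutEqn f g (.d α n (.gen (.inl x))) (.gen (.inl (C.d α n x)))
  | d_inr (α n) (x : D.carrier) :
      PushoutEqn f g (.d α n (.gen (.inr x))) (.gen (.inr (D.d α n x)))
  | comp_inl (n) (x y : C.carrier) (h) :
      PushoutEqn f g (.comp n (.gen (.inl x)) (.gen (.inl y))) (.gen (.inl (C.comp n x y h)))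
  | comp_inr (n) (x y : D.carrier) (h) :
      PushoutEqn f g (.comp n (.gen (.inr x)) (.gen (.inr y))) (.gen (.inr (D.comp n x y h)))
  | glue (a : A.carrier) : PushoutEqn f g (.gen (.inl (app f a))) (.gen (.inr (app g a)))

/-- The presentation of a pushout. -/
def pushoutPres {A C D : OmegaCat.{u}} (f : A ⟶ C) (g : A ⟶ D) : Presentation.{u} where
  Gen := C.carrier ⊕ D.carrier
  Eqn := PushoutEqn f g
  finite_dim x := by
    rcases x with x | x
    · refine ⟨C.dim x, fun α => ?_⟩
      have h := PushoutEqn.d_inl (f := f) (g := g) α (C.dim x) x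
      rwa [C.dim_spec] at h
    · refine ⟨D.dim x, fun α => ?_⟩
      have h := PushoutEqn.d_inr (f := f) (g := g) α (D.dim x) x
      rwa [D.dim_spec] at h

/-- The first leg of the pushout. -/
noncomputable def pushoutInl {A C D : OmegaCat.{u}} (f : A ⟶ C) (g : A ⟶ D) :
    C ⟶ (pushoutPres f g).omegaCat :=
  have hd : ∀ α n x, (pushoutPres f g).Rel (.d α n (.gen (.inl x))) (.gen (.inl (C.d α n x))) :=
    fun α n x => .eqn (.d_inl α n x) (.d_congr _ _ (.gen _)) (.gen _)
  OmegaFunctor.mk (D := (pushoutPres f g).omegaCat) (fun x => (pushoutPres f g).ofGen (.inl x))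
    (fun α n x => ((pushoutPres f g).cls_eq _ _).2 (hd α n x).symm)
    (fun n x y h h' => by
      refine Eq.trans ?_ ((pushoutPres f g).cellComp_cls n _ _ _ _ h').symm
      exact ((pushoutPres f g).cls_eq _ _).2 (.symm (.eqn (.comp_inl n x y h)
        (.comp_congr n (.gen _) (.gen _) ((pushoutPres f g).rel_of_cellD h')) (.gen _))))

/-- The second leg of the pushout. -/
noncomputable def pushoutInr {A C D : OmegaCat.{u}} (f : A ⟶ C) (g : A ⟶ D) :
    D ⟶ (pushoutPres f g).omegaCat :=
  have hd : ∀ α n x, (pushoutPres f g).Rel (.d α n (.gen (.inr x))) (.gen (.inr (D.d α n x))) :=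
    fun α n x => .eqn (.d_inr α n x) (.d_congr _ _ (.gen _)) (.gen _)
  OmegaFunctor.mk (D := (pushoutPres f g).omegaCat) (fun x => (pushoutPres f g).ofGen (.inr x))
    (fun α n x => ((pushoutPres f g).cls_eq _ _).2 (hd α n x).symm)
    (fun n x y h h' => by
      refine Eq.trans ?_ ((pushoutPres f g).cellComp_cls n _ _ _ _ h').symm
      exact ((pushoutPres f g).cls_eq _ _).2 (.symm (.eqn (.comp_inr n x y h)
        (.comp_congr n (.gen _) (.gen _) ((pushoutPres f g).rel_of_cellD h')) (.gen _))))

theorem pushoutPres_valid {A C D E : OmegaCat.{u}} (f : A ⟶ C) (g : A ⟶ D) (F : C ⟶ E)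
    (G : D ⟶ E) (hFG : f ≫ F = g ≫ G) :
    (pushoutPres f g).Valid E (Sum.elim (app F) (app G)) := by
  rintro _ _ v w (⟨α, n, x⟩ | ⟨α, n, x⟩ | ⟨n, x, y, h⟩ | ⟨n, x, y, h⟩ | a) h₁ h₂
  · obtain ⟨_, rfl, rfl⟩ := h₁
    obtain rfl : w = _ := h₂
    exact (app_d F α n x).symm
  · obtain ⟨_, rfl, rfl⟩ := h₁
    obtain rfl : w = _ := h₂
    exact (app_d G α n x).symm
  · obtain ⟨_, _, h', rfl, rfl, rfl⟩ := h₁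
    obtain rfl : w = _ := h₂
    exact (app_comp F n x y h h').symm
  · obtain ⟨_, _, h', rfl, rfl, rfl⟩ := h₁
    obtain rfl : w = _ := h₂
    exact (app_comp G n x y h h').symm
  · obtain rfl : v = _ := h₁
    obtain rfl : w = _ := h₂
    exact congrArg (fun F => app F a) hFG

theorem pushout_isPushout {A C D : OmegaCat.{u}} (f : A ⟶ C) (g : A ⟶ D) :
    IsPushout f g (pushoutInl f g) (pushoutInr f g) := by
  refine ⟨⟨hom_ext fun a => ?_⟩, ⟨Limits.PushoutCocone.IsColimit.mk _
    (fun s => (pushoutPres f g).lift _ (pushoutPres_valid f g s.inl s.inr s.condition)) ?_ ?_ ?_⟩⟩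
  · exact ((pushoutPres f g).cls_eq _ _).2 (.eqn (.glue a) (.gen _) (.gen _))
  · exact fun s => hom_ext fun x => (pushoutPres f g).lift_ofGen _
      (pushoutPres_valid f g s.inl s.inr s.condition) (.inl x)
  · exact fun s => hom_ext fun x => (pushoutPres f g).lift_ofGen _
      (pushoutPres_valid f g s.inl s.inr s.condition) (.inr x)
  · intro s m h₁ h₂
    refine (pushoutPres f g).hom_ext_gen fun x => ?_
    refine Eq.trans ?_ ((pushoutPres f g).lift_ofGen _
      (pushoutPres_valid f g s.inl s.inr s.condition) x).symm
    rcases x with x | x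
    · exact congrArg (fun F => app F x) h₁
    · exact congrArg (fun F => app F x) h₂

instance hasPushouts {A C D : OmegaCat.{u}} (f : A ⟶ C) (g : A ⟶ D) : Limits.HasPushout f g :=
  (pushout_isPushout f g).hasPushout

/-! ## The negative semi-path ω-category -/

/-- The quotient `𝕌ℙC / R⁻` of the underlying globular set of the path ω-category. -/
def germGlob (C : OmegaCat.{u}) (hC : C.NonContracting) : GlobSet.{u} :=
  (forgetGlob.obj (C.path hC)).quot (fun _ x y => C.germRel hC x.1 y.1)
    (fun α n _ _ h => C.germRel_d hC α n h)

/-- The canonical morphism `φ : 𝕌ℙC ⟶ 𝕌ℙC / R⁻`. -/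
def germMk (C : OmegaCat.{u}) (hC : C.NonContracting) :
    forgetGlob.obj (C.path hC) ⟶ C.germGlob hC :=
  GlobSet.quotMk _ _ _

/-- The negative semi-path ω-category `ℙ⁻C`: the pushout of `𝔽(φ) : 𝔽𝕌ℙC ⟶ 𝔽(𝕌ℙC / R⁻)` and of
the counit `𝔽𝕌ℙC ⟶ ℙC`. -/
noncomputable def semiPath (C : OmegaCat.{u}) (hC : C.NonContracting) : OmegaCat.{u} :=
  Limits.pushout (freeFunctor.map (C.germMk hC)) (freeAdj.counit.app (C.path hC))

/-- The canonical ω-functor `h⁻ : ℙC ⟶ ℙ⁻C`. -/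
noncomputable def toSemiPath (C : OmegaCat.{u}) (hC : C.NonContracting) :
    C.path hC ⟶ C.semiPath hC :=
  Limits.pushout.inr (freeFunctor.map (C.germMk hC)) (freeAdj.counit.app (C.path hC))

/-- The set `C₀` of `0`-dimensional elements. -/
def Vertex (C : OmegaCat.{u}) : Type u := {x : C.carrier // C.dim x = 0}

/-- The `0`-source, as a vertex. -/
def vertexSrc (C : OmegaCat.{u}) (x : C.carrier) : C.Vertex :=
  ⟨C.d (-1) 0 x, Nat.le_zero.1 ((C.dim_le_iff _ 0 1).2 (C.d_d_le _ _ _ _ _ le_rfl))⟩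

/-- The grading of `ℙC` by `0`-sources. -/
def pathGrading (C : OmegaCat.{u}) (hC : C.NonContracting) : C.path hC ⟶ disc C.Vertex :=
  OmegaFunctor.mk (C := C.path hC) (D := disc C.Vertex) (fun x => C.vertexSrc x.1)
    (fun α n x => Subtype.ext (C.d_d_lt (-1) α 0 (n + 1) x.1 (Nat.succ_pos n)))
    (fun n x y h h' => by
      refine Subtype.ext ?_
      show C.d (-1) 0 (C.comp (n + 1) x.1 y.1 _) = C.d (-1) 0 x.1
      rw [← C.d_d_lt (-1) (-1) 0 (n + 1) _ (Nat.succ_pos n), C.src_comp,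
        C.d_d_lt _ _ _ _ _ (Nat.succ_pos n)])

/-- The grading of `𝕌ℙC / R⁻` by `0`-sources. -/
def germGrading (C : OmegaCat.{u}) (hC : C.NonContracting) :
    C.germGlob hC ⟶ forgetGlob.obj (disc C.Vertex) :=
  GlobMap.mk (G := C.germGlob hC) (H := forgetGlob.obj (disc C.Vertex))
    (fun n => Quot.lift (GlobMap.toFun (forgetGlob.map (C.pathGrading hC)) n) (by
      intro x y h
      refine Subtype.ext ?_
      show C.vertexSrc x.1.1 = C.vertexSrc y.1.1
      have key : ∀ x y : (C.path hC).carrier, C.germRel hC x y →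
          C.vertexSrc x.1 = C.vertexSrc y.1 := by
        intro x y h
        induction h with
        | rel x z h =>
          obtain ⟨y, h, e⟩ := h
          refine Subtype.ext ?_
          show C.d (-1) 0 x.1 = C.d (-1) 0 z.1
          rw [e, C.src_comp]
        | refl x => rfl
        | symm x y _ ih => exact ih.symm
        | trans x y z _ _ ih₁ ih₂ => exact ih₁.trans ih₂
      exact key _ _ h))
    (fun α n x => by
      induction x using Quot.ind
      exact GlobMap.map_face (forgetGlob.map (C.pathGrading hC)) α n _)

/-- The grading of `ℙ⁻C` induced by the `0`-source: the unique ω-functor to the discrete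
ω-category on `C₀` whose composite with `h⁻` sends `x` to `s_0 x`. -/
noncomputable def semiPathGrading (C : OmegaCat.{u}) (hC : C.NonContracting) :
    C.semiPath hC ⟶ disc C.Vertex :=
  Limits.pushout.desc ((freeAdj.homEquiv _ _).symm (C.germGrading hC)) (C.pathGrading hC) (by
    rw [← Adjunction.homEquiv_naturality_left_symm]
    have h : C.germMk hC ≫ C.germGrading hC = forgetGlob.map (C.pathGrading hC) := rfl
    rw [h, Adjunction.homEquiv_counit, Adjunction.counit_naturality])

/-- The grade of `h⁻(x)` is `s_0 x`. -/
theorem semiPathGrading_toSemiPath (C : OmegaCat.{u}) (hC : C.NonContracting)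
    (x : (C.path hC).carrier) :
    app (C.semiPathGrading hC) (app (C.toSemiPath hC) x) = C.vertexSrc x.1 :=
  congrArg (fun F => app F x) (Limits.pushout.inr_desc _ _ _)

/-- The fibre `ℙ⁻_v C` of the negative semi-path ω-category over a vertex `v`. -/
noncomputable def semiPathFibre (C : OmegaCat.{u}) (hC : C.NonContracting) (v : C.Vertex) :
    OmegaCat.{u} :=
  fibre (C.semiPathGrading hC) v

end OmegaCat

/-! ## ω-categories of faces -/

/-- A finite set of oriented faces: `bd (-1) a` is the set `s_a` of source faces and `bd 1 a` the set
`t_a` of target faces of a face `a`. -/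
structure FaceSystem where
  Face : Type
  fintypeFace : Fintype Face
  decEqFace : DecidableEq Face
  dim : Face → ℕ
  bd : ℤˣ → Face → Finset Face
  dim_bd : ∀ (α : ℤˣ) (a b : Face), b ∈ bd α a → dim b + 1 = dim a

namespace FaceSystem

instance (K : FaceSystem) : Fintype K.Face := K.fintypeFace

instance (K : FaceSystem) : DecidableEq K.Face := K.decEqFace

/-- The incidence number: the coefficient of `b` in the boundary `t_a - s_a` of `a`. -/
def inc (K : FaceSystem) (a b : K.Face) : ℤ :=
  (if b ∈ K.bd 1 a then 1 else 0) - (if b ∈ K.bd (-1) a then 1 else 0)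

/-- A cell `x`: for each sign `α` and each dimension `i` a combination
`x_i^α = ∑ coeff α a • a` (over the faces `a` of dimension `i`) with natural coefficients, such that
`x_0^α` has augmentation `1` and `∂ x_{i+1}^α = x_i^+ - x_i^-`. The set of faces which is
described by such a cell consists of all faces occurring in it and of their subfaces. -/
@[ext]
structure Cell (K : FaceSystem) where
  coeff : ℤˣ → K.Face → ℕ
  aug : ∀ α : ℤˣ, ∑ a : K.Face with K.dim a = 0, coeff α a = 1
  bdry : ∀ (α : ℤˣ) (b : K.Face),
    (coeff 1 b : ℤ) - coeff (-1) b = ∑ a : K.Face, (coeff α a : ℤ) * K.inc a b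

variable (K : FaceSystem)

theorem inc_eq_zero {a b : K.Face} (h : K.dim b + 1 ≠ K.dim a) : K.inc a b = 0 := by
  unfold inc
  rw [if_neg (fun h' => h (K.dim_bd _ _ _ h')), if_neg (fun h' => h (K.dim_bd _ _ _ h')), sub_zero]

theorem sum_inc_congr {f g : K.Face → ℤ} {b : K.Face}
    (h : ∀ a, K.dim a = K.dim b + 1 → f a = g a) :
    ∑ a : K.Face, f a * K.inc a b = ∑ a : K.Face, g a * K.inc a b := by
  refine Finset.sum_congr rfl fun a _ => ?_
  by_cases ha : K.dim a = K.dim b + 1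
  · rw [h a ha]
  · rw [K.inc_eq_zero (fun h' => ha h'.symm), mul_zero, mul_zero]

/-- The `n`-source (`β = -1`) and the `n`-target (`β = 1`) of a cell: truncate above dimension `n`
and take `x_n^β` for both signs in dimension `n`. -/
def cellD (β : ℤˣ) (n : ℕ) (x : K.Cell) : K.Cell where
  coeff α a := if K.dim a < n then x.coeff α a else if K.dim a = n then x.coeff β a else 0
  aug α := by
    rcases Nat.eq_zero_or_pos n with rfl | hn
    · rw [← x.aug β]
      exact Finset.sum_congr rfl fun a ha => by simp [(Finset.mem_filter.1 ha).2]
    · rw [← x.aug α]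
      exact Finset.sum_congr rfl fun a ha => by simp [(Finset.mem_filter.1 ha).2, hn]
  bdry α b := by
    rcases lt_trichotomy (K.dim b + 1) n with h | h | h
    · rw [if_pos (by omega), if_pos (by omega), x.bdry α b]
      exact K.sum_inc_congr fun a ha => by rw [if_pos (by omega)]
    · rw [if_pos (by omega), if_pos (by omega), x.bdry β b]
      exact K.sum_inc_congr fun a ha => by rw [if_neg (by omega), if_pos (by omega)]
    · rw [Finset.sum_eq_zero]
      · split_ifs <;> omega
      · intro a _
        by_cases ha : K.dim a = K.dim b + 1
        · rw [if_neg (by omega), if_neg (by omega)]; simp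
        · rw [K.inc_eq_zero (fun h' => ha h'.symm), mul_zero]

/-- The composite `x *_n y`: equal to `x` and `y` below dimension `n`, with the negative part of `x`
and the positive part of `y` in dimension `n`, and equal to `x + y` above dimension `n`. -/
def cellComp (n : ℕ) (x y : K.Cell) (h : K.cellD 1 n x = K.cellD (-1) n y) : K.Cell where
  coeff α a := if K.dim a < n then x.coeff α a
    else if K.dim a = n then (if α = -1 then x.coeff α a else y.coeff α a)
    else x.coeff α a + y.coeff α a
  aug α := by
    rcases Nat.eq_zero_or_pos n with rfl | hn
    · by_cases hα : α = -1
      · rw [← x.aug α]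
        exact Finset.sum_congr rfl fun a ha => by simp [(Finset.mem_filter.1 ha).2, hα]
      · rw [← y.aug α]
        exact Finset.sum_congr rfl fun a ha => by simp [(Finset.mem_filter.1 ha).2, hα]
    · rw [← x.aug α]
      exact Finset.sum_congr rfl fun a ha => by simp [(Finset.mem_filter.1 ha).2, hn]
  bdry α b := by
    have hc : ∀ (α : ℤˣ) (a : K.Face), (K.cellD 1 n x).coeff α a = (K.cellD (-1) n y).coeff α a :=
      fun α a => by rw [h]
    have hn : ∀ a, K.dim a = n → x.coeff 1 a = y.coeff (-1) a := fun a ha => by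
      have := hc 1 a
      simpa [cellD, ha] using this
    have hlt : ∀ α a, K.dim a < n → x.coeff α a = y.coeff α a := fun α a ha => by
      have := hc α a
      simpa [cellD, ha] using this
    have h1 : (1 : ℤˣ) ≠ -1 := by decide
    rcases lt_trichotomy (K.dim b) n with hb | hb | hb
    · rw [if_pos hb, if_pos hb]
      by_cases hα : α = -1
      · rw [x.bdry α b]
        refine K.sum_inc_congr fun a ha => ?_
        rcases lt_or_eq_of_le (show K.dim a ≤ n by omega) with h' | h'
        · rw [if_pos h']
        · rw [if_neg (by omega), if_pos h', if_pos hα]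
      · rw [hlt _ _ hb, hlt _ _ hb, y.bdry α b]
        refine K.sum_inc_congr fun a ha => ?_
        rcases lt_or_eq_of_le (show K.dim a ≤ n by omega) with h' | h'
        · rw [if_pos h', hlt _ _ h']
        · rw [if_neg (by omega), if_pos h', if_neg hα]
    · rw [if_neg (by omega), if_pos hb, if_neg h1, if_neg (by omega), if_pos hb, if_pos rfl]
      have e : (y.coeff 1 b : ℤ) - x.coeff (-1) b =
          ((x.coeff 1 b : ℤ) - x.coeff (-1) b) + ((y.coeff 1 b : ℤ) - y.coeff (-1) b) := by
        rw [hn b hb]; ring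
      rw [e, x.bdry α b, y.bdry α b, ← Finset.sum_add_distrib]
      simp_rw [← add_mul]
      refine K.sum_inc_congr fun a ha => ?_
      rw [if_neg (by omega), if_neg (by omega)]; push_cast; rfl
    · rw [if_neg (by omega), if_neg (by omega), if_neg (by omega), if_neg (by omega)]
      have e : ((x.coeff 1 b + y.coeff 1 b : ℕ) : ℤ) - (x.coeff (-1) b + y.coeff (-1) b : ℕ) =
          ((x.coeff 1 b : ℤ) - x.coeff (-1) b) + ((y.coeff 1 b : ℤ) - y.coeff (-1) b) := by
        push_cast; ring
      rw [e, x.bdry α b, y.bdry α b, ← Finset.sum_add_distrib]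
      simp_rw [← add_mul]
      refine K.sum_inc_congr fun a ha => ?_
      rw [if_neg (by omega), if_neg (by omega)]; push_cast; rfl

theorem cell_ext {K : FaceSystem} {x y : K.Cell} (h : ∀ α a, x.coeff α a = y.coeff α a) : x = y :=
  Cell.ext (funext fun α => funext fun a => h α a)

theorem cellD_eq {n : ℕ} {x y : K.Cell} (h : K.cellD 1 n x = K.cellD (-1) n y) (α : ℤˣ)
    (a : K.Face) : (K.dim a < n → x.coeff α a = y.coeff α a) ∧
      (K.dim a = n → x.coeff 1 a = y.coeff (-1) a) := by
  have hc : (K.cellD 1 n x).coeff α a = (K.cellD (-1) n y).coeff α a := by rw [h]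
  constructor
  · intro ha; simpa [cellD, ha] using hc
  · intro ha; simpa [cellD, ha] using hc

theorem cellD_eq_of {n : ℕ} {x y : K.Cell} (h₁ : ∀ α a, K.dim a < n → x.coeff α a = y.coeff α a)
    (h₂ : ∀ a, K.dim a = n → x.coeff 1 a = y.coeff (-1) a) : K.cellD 1 n x = K.cellD (-1) n y := by
  refine cell_ext fun α a => ?_
  simp only [cellD]
  split_ifs with h h'
  · exact h₁ α a h
  · exact h₂ a h'
  · rfl

/-- The ω-category of all cells (the ω-category of the based augmented chain complex of the faces). -/
def cellCat : OmegaCat.{0} where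
  carrier := K.Cell
  d := K.cellD
  comp := K.cellComp
  d_d_lt β α m n x h := cell_ext fun γ a => by
    simp only [cellD]; split_ifs <;> first | rfl | omega
  d_d_le β α m n x h := cell_ext fun γ a => by
    simp only [cellD]; split_ifs <;> first | rfl | omega
  src_unit n x h := cell_ext fun γ a => by
    simp only [cellD, cellComp]; split_ifs <;> first | rfl | omega | simp_all
  tgt_unit n x h := cell_ext fun γ a => by
    rcases Int.units_eq_one_or γ with rfl | rfl <;>
    · simp only [cellD, cellComp]; split_ifs <;> rfl
  src_comp n x y h := cell_ext fun γ a => by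
    simp only [cellD, cellComp]; split_ifs <;> rfl
  tgt_comp n x y h := cell_ext fun γ a => by
    have := K.cellD_eq h γ a
    have h1 : (1 : ℤˣ) ≠ -1 := by decide
    simp only [cellD, cellComp]; split_ifs <;> first | rfl | omega
  d_comp α m n x y h hmn := by
    have key := K.cellD_eq h
    have h' : K.cellD 1 n (K.cellD α m x) = K.cellD (-1) n (K.cellD α m y) := by
      refine K.cellD_eq_of (fun β a ha => ?_) (fun a ha => ?_)
      · simp only [cellD]
        rw [(key β a).1 ha, (key α a).1 ha]
      · simp only [cellD]
        split_ifs
        · exact (key α a).2 ha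
        · omega
        · rfl
    refine ⟨h', cell_ext fun γ a => ?_⟩
    have k₁ := key γ a
    have k₂ := key α a
    simp only [cellD, cellComp]; split_ifs <;> first | rfl | omega
  assoc n x y z h₁ h₂ h₃ h₄ := cell_ext fun γ a => by
    simp only [cellComp]; split_ifs <;> first | rfl | omega
  interchange m n x y z w hmn h₁ h₂ h₃ h₄ h₅ h₆ := cell_ext fun γ a => by
    have k₁ := K.cellD_eq h₁ γ a
    have k₂ := K.cellD_eq h₂ γ a
    have k₄ := K.cellD_eq h₄ γ a
    have k₅ := K.cellD_eq h₅ γ a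
    simp only [cellComp]; split_ifs <;> first | rfl | omega
  finite_dim x := by
    have hN : ∀ a : K.Face, K.dim a < (Finset.univ.sup K.dim) + 1 := fun a =>
      Nat.lt_succ_of_le (Finset.le_sup (Finset.mem_univ a))
    refine ⟨(Finset.univ.sup K.dim) + 1, cell_ext fun γ a => ?_, cell_ext fun γ a => ?_⟩ <;>
    · simp only [cellD]
      rw [if_pos (hN a)]

theorem vanish_of_functional (l : K.Face → ℤ)
    (hl : ∀ a, 1 ≤ K.dim a → ∑ b : K.Face, l b * K.inc a b = 1) (x : K.Cell)
    (h₀ : ∀ b, K.dim b = 0 → x.coeff 1 b = x.coeff (-1) b) (k : ℕ) :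
    ∀ a, K.dim a = k + 1 → ∀ α, x.coeff α a = 0 := by
  have step : ∀ k, (∀ b, K.dim b = k → x.coeff 1 b = x.coeff (-1) b) →
      ∀ a, K.dim a = k + 1 → ∀ α, x.coeff α a = 0 := by
    intro k hk a ha α
    have e : ∑ b : K.Face with K.dim b = k,
        l b * ((x.coeff 1 b : ℤ) - x.coeff (-1) b) = 0 :=
      Finset.sum_eq_zero fun b hb => by
        rw [hk b (Finset.mem_filter.1 hb).2, sub_self, mul_zero]
    have e' : ∑ b : K.Face with K.dim b = k, l b * ((x.coeff 1 b : ℤ) - x.coeff (-1) b) =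
        ∑ a : K.Face with K.dim a = k + 1, (x.coeff α a : ℤ) := by
      simp_rw [x.bdry α, Finset.mul_sum]
      rw [Finset.sum_comm, Finset.sum_filter]
      refine Finset.sum_congr rfl fun a _ => ?_
      by_cases ha : K.dim a = k + 1
      · have e₁ : (x.coeff α a : ℤ) = x.coeff α a * ∑ b : K.Face, l b * K.inc a b := by
          rw [hl a (by omega), mul_one]
        rw [if_pos ha]
        refine Eq.trans ?_ e₁.symm
        rw [Finset.mul_sum, Finset.sum_filter]
        refine Finset.sum_congr rfl fun b _ => ?_
        by_cases hb : K.dim b = k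
        · rw [if_pos hb]; ring
        · rw [if_neg hb, K.inc_eq_zero (by omega)]; ring
      · rw [if_neg ha]
        refine Finset.sum_eq_zero fun b hb => ?_
        rw [K.inc_eq_zero (by have := (Finset.mem_filter.1 hb).2; omega)]; ring
    rw [e'] at e
    have := (Finset.sum_eq_zero_iff_of_nonneg (fun a _ => Int.natCast_nonneg _)).1 e a
      (Finset.mem_filter.2 ⟨Finset.mem_univ _, ha⟩)
    exact_mod_cast this
  induction k with
  | zero => exact step 0 h₀
  | succ k ih => exact step (k + 1) fun b hb => by rw [ih b hb, ih b hb]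

theorem nonContracting_of_functional (l : K.Face → ℤ)
    (hl : ∀ a, 1 ≤ K.dim a → ∑ b : K.Face, l b * K.inc a b = 1) : K.cellCat.NonContracting := by
  intro x hx
  have key : ∀ α : ℤˣ, K.cellCat.dim (K.cellCat.d α 1 x) = 1 := by
    intro α
    have h₁ : K.cellCat.dim (K.cellCat.d α 1 x) ≤ 1 :=
      (K.cellCat.dim_le_iff _ 1 1).2 (K.cellCat.d_d_le _ _ _ _ _ le_rfl)
    by_contra hne
    have h₂ : K.cellCat.dim (K.cellCat.d α 1 x) ≤ 0 := by omega
    have h₃ : ∀ β, K.cellCat.d β 0 x = K.cellCat.d α 1 x := fun β => by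
      rw [← K.cellCat.d_d_lt β α 0 1 x Nat.zero_lt_one]
      exact K.cellCat.d_of_dim_le h₂ β
    have h₄ : K.cellD 1 0 x = K.cellD (-1) 0 x := (h₃ 1).trans (h₃ (-1)).symm
    have h₅ : ∀ b, K.dim b = 0 → x.coeff 1 b = x.coeff (-1) b := fun b hb => by
      have : (K.cellD 1 0 x).coeff 1 b = (K.cellD (-1) 0 x).coeff 1 b := by rw [h₄]
      simpa [cellD, hb] using this
    refine (K.cellCat.one_le_dim_iff x 1).1 hx (cell_ext fun γ a => ?_)
    show (K.cellD 1 0 x).coeff γ a = x.coeff γ a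
    simp only [cellD]
    by_cases ha : K.dim a = 0
    · rw [if_neg (by omega), if_pos ha]
      rcases Int.units_eq_one_or γ with rfl | rfl
      · rfl
      · exact h₅ a ha
    · rw [if_neg (by omega), if_neg ha]
      exact (K.vanish_of_functional l hl x h₅ (K.dim a - 1) a (by omega) γ).symm
  exact ⟨key _, key _⟩

theorem sum_inc (b : K.Face) {N : ℕ} (J : Finset (Fin N)) (c : Fin N → K.Face) (χ : Fin N → ℤˣ)
    (hc : ∀ i ∈ J, ∀ j ∈ J, c i = c j → i = j)
    (h : ∀ β a, b ∈ K.bd β a ↔ ∃ j ∈ J, a = c j ∧ χ j = β) (f : K.Face → ℤ) :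
    ∑ a : K.Face, f a * K.inc a b = ∑ j ∈ J, f (c j) * (χ j : ℤ) := by
  have e : ∀ a, K.inc a b = ∑ j ∈ J, if a = c j then (χ j : ℤ) else 0 := by
    intro a
    by_cases ha : ∃ j ∈ J, a = c j
    · obtain ⟨j, hj, rfl⟩ := ha
      rw [Finset.sum_eq_single_of_mem j hj
        (fun i hi hij => if_neg fun e => hij (hc j hj i hi e).symm), if_pos rfl]
      have hβ : ∀ β, b ∈ K.bd β (c j) ↔ χ j = β := fun β => by
        rw [h]
        exact ⟨fun ⟨i, hi, e, h⟩ => by rw [hc j hj i hi e]; exact h, fun h => ⟨j, hj, rfl, h⟩⟩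
      unfold inc
      rcases Int.units_eq_one_or (χ j) with e | e
      · rw [if_pos ((hβ 1).2 e), if_neg (fun h' => by rw [hβ, e] at h'; revert h'; decide), e]
        simp
      · rw [if_neg (fun h' => by rw [hβ, e] at h'; revert h'; decide), if_pos ((hβ (-1)).2 e), e]
        simp
    · have h₀ : ∀ β, b ∉ K.bd β a := fun β h' => by
        obtain ⟨j, hj, e, _⟩ := (h β a).1 h'
        exact ha ⟨j, hj, e⟩
      unfold inc
      rw [if_neg (h₀ _), if_neg (h₀ _), sub_zero, Finset.sum_eq_zero]
      intro j hj
      exact if_neg fun e => ha ⟨j, hj, e⟩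
  simp_rw [e, Finset.mul_sum]
  rw [Finset.sum_comm]
  refine Finset.sum_congr rfl fun j _ => ?_
  simp

/-- The alternating sum behind the boundary of an atom. -/
theorem telescope {N : ℕ} (J : Finset (Fin N)) (χ : Fin N → ℤˣ) (α : ℤˣ) :
    ∑ j ∈ J, (if ∀ k ∈ J, (k < j → χ k = α) ∧ (j < k → χ k = -α) then (χ j : ℤ) else 0) =
      (if ∀ k ∈ J, χ k = 1 then 1 else 0) - (if ∀ k ∈ J, χ k = -1 then 1 else 0) := by
  set T : ℕ → ℤ := fun m =>
    if ∀ k ∈ J, (k.val < m → χ k = α) ∧ (m ≤ k.val → χ k = -α) then 1 else 0 with hT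
  have hne : α ≠ -α := by rcases Int.units_eq_one_or α with rfl | rfl <;> decide
  have h₁ : ∀ j ∈ J, (if ∀ k ∈ J, (k < j → χ k = α) ∧ (j < k → χ k = -α) then (χ j : ℤ) else 0) =
      α * (T (j.val + 1) - T j.val) := by
    intro j hj
    by_cases hA : ∀ k ∈ J, (k < j → χ k = α) ∧ (j < k → χ k = -α)
    · rw [if_pos hA]
      by_cases hχ : χ j = α
      · have t₁ : T (j.val + 1) = 1 := if_pos fun k hk => ⟨fun h => by
          rcases lt_or_eq_of_le (Nat.lt_succ_iff.1 h) with h' | h'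
          · exact (hA k hk).1 h'
          · rw [Fin.ext h', hχ], fun h => (hA k hk).2 h⟩
        have t₂ : T j.val = 0 := if_neg fun h => hne (hχ.symm.trans ((h j hj).2 le_rfl))
        rw [t₁, t₂, hχ]; ring
      · have hχ' : χ j = -α := by
          rcases Int.units_eq_one_or α with rfl | rfl <;>
          rcases Int.units_eq_one_or (χ j) with e | e <;> simp_all
        have t₁ : T (j.val + 1) = 0 := if_neg fun h => hχ ((h j hj).1 (Nat.lt_succ_self _))
        have t₂ : T j.val = 1 := if_pos fun k hk => ⟨fun h => (hA k hk).1 h, fun h => by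
          rcases lt_or_eq_of_le h with h' | h'
          · exact (hA k hk).2 h'
          · rw [← Fin.ext h', hχ']⟩
        rw [t₁, t₂, hχ']; push_cast; ring
    · rw [if_neg hA]
      have t₁ : T (j.val + 1) = 0 := if_neg fun h => hA fun k hk =>
        ⟨fun h' => (h k hk).1 (Nat.lt_succ_of_lt h'), fun h' => (h k hk).2 h'⟩
      have t₂ : T j.val = 0 := if_neg fun h => hA fun k hk =>
        ⟨fun h' => (h k hk).1 h', fun h' => (h k hk).2 (le_of_lt h')⟩
      rw [t₁, t₂]; ring
  have h₂ : ∀ j ∉ J, (α : ℤ) * (T (j.val + 1) - T j.val) = 0 := by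
    intro j hj
    have : T (j.val + 1) = T j.val := by
      simp only [hT]
      refine if_congr (forall₂_congr fun k hk => ?_) rfl rfl
      have : k.val ≠ j.val := fun h => hj (by rw [← Fin.ext h]; exact hk)
      rw [show (k.val < j.val + 1 ↔ k.val < j.val) by omega,
        show (j.val + 1 ≤ k.val ↔ j.val ≤ k.val) by omega]
    rw [this]; ring
  rw [Finset.sum_congr rfl h₁, Finset.sum_subset (Finset.subset_univ J) (fun j _ hj => h₂ j hj),
    ← Finset.mul_sum, Fin.sum_univ_eq_sum_range (fun m => T (m + 1) - T m),
    Finset.sum_range_sub]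
  have tN : T N = if ∀ k ∈ J, χ k = α then 1 else 0 := by
    simp only [hT]
    refine if_congr (forall₂_congr fun k hk => ?_) rfl rfl
    have := k.2
    simp [this]
  have t0 : T 0 = if ∀ k ∈ J, χ k = -α then 1 else 0 := by
    simp only [hT]
    refine if_congr (forall₂_congr fun k hk => ?_) rfl rfl
    simp
  rw [tN, t0]
  rcases Int.units_eq_one_or α with rfl | rfl
  · simp
  · simp

end FaceSystem

theorem OmegaCat.sub_dim (C : OmegaCat.{u}) (S : Set C.carrier) (hd hc)
    (x : (C.sub S hd hc).carrier) : (C.sub S hd hc).dim x = C.dim x.1 :=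
  congrArg sInf (Set.ext fun _ => and_congr Subtype.ext_iff Subtype.ext_iff)

theorem OmegaCat.NonContracting.sub {C : OmegaCat.{u}} (hC : C.NonContracting) (S : Set C.carrier)
    (hd hc) : (C.sub S hd hc).NonContracting := by
  intro x hx
  rw [OmegaCat.sub_dim] at hx ⊢
  rw [OmegaCat.sub_dim]
  exact hC x.1 hx

/-! ## The cube -/

section Cube

/-- The number of zeros of the word `a` strictly before the position `j`. -/
def zerosBefore {n : ℕ} (a : Fin n → SignType) (j : Fin n) : ℕ :=
  (Finset.univ.filter (fun k => k < j ∧ a k = 0)).card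

/-- The faces of the `n`-cube: words of length `n` in the letters `-, 0, +`, the dimension being the
number of zeros. In `s_a` (resp. `t_a`) the `i`-th zero is replaced by `(-)^i` (resp. `(-)^{i+1}`);
here `i = zerosBefore a j + 1` for the zero in position `j`. -/
abbrev cubeFaces (n : ℕ) : FaceSystem where
  Face := Fin n → SignType
  fintypeFace := inferInstance
  decEqFace := inferInstance
  dim a := (Finset.univ.filter (fun j => a j = 0)).card
  bd α a := Finset.univ.filter (fun b => ∃ j, a j = 0 ∧
    ((b j : ℤ) = ((α * (-1) ^ zerosBefore a j : ℤˣ) : ℤ)) ∧ ∀ k, k ≠ j → b k = a k)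
  dim_bd α a b h := by
    obtain ⟨j, h₁, h₂, h₃⟩ := (Finset.mem_filter.1 h).2
    have hb : b j ≠ 0 := fun e => by
      rw [e] at h₂; exact (Units.ne_zero _ h₂.symm)
    have e : Finset.univ.filter (fun j => a j = 0) =
        insert j (Finset.univ.filter (fun j => b j = 0)) := by
      ext k
      by_cases hk : k = j
      · subst hk; simp [h₁]
      · simp [hk, h₃ k hk]
    rw [e, Finset.card_insert_of_notMem (by simp [hb])]

variable {n : ℕ}

/-- The sign at a nonzero position, corrected by the number of zeros before it. -/
def cubeSign (b : Fin n → SignType) (j : Fin n) : ℤˣ :=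
  (if b j = 1 then 1 else -1) * (-1) ^ zerosBefore b j

theorem sign_eq_iff {x : SignType} (hx : x ≠ 0) (β : ℤˣ) (m : ℕ) :
    (x : ℤ) = ((β * (-1) ^ m : ℤˣ) : ℤ) ↔ (if x = 1 then 1 else -1) * (-1) ^ m = β := by
  rcases neg_one_pow_eq_or ℤˣ m with e | e <;> rw [e] <;>
  rcases Int.units_eq_one_or β with rfl | rfl <;> cases x <;> first | exact absurd rfl hx | decide

theorem zerosBefore_update_of_lt (b : Fin n → SignType) {j k : Fin n} (h : k < j) (x : SignType) :
    zerosBefore (Function.update b j x) k = zerosBefore b k := by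
  unfold zerosBefore
  congr 1
  refine Finset.filter_congr fun i _ => and_congr_right fun hi => ?_
  rw [Function.update_of_ne (ne_of_lt (hi.trans h))]

theorem zerosBefore_update_self (b : Fin n → SignType) (j : Fin n) (x : SignType) :
    zerosBefore (Function.update b j x) j = zerosBefore b j := by
  unfold zerosBefore
  congr 1
  refine Finset.filter_congr fun i _ => and_congr_right fun hi => ?_
  rw [Function.update_of_ne (ne_of_lt hi)]

theorem zerosBefore_update_zero (b : Fin n → SignType) {j k : Fin n} (h : j < k) (hb : b j ≠ 0) :
    zerosBefore (Function.update b j 0) k = zerosBefore b k + 1 := by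
  unfold zerosBefore
  rw [← Finset.card_insert_of_notMem (a := j) (by simp [hb])]
  congr 1
  ext i
  by_cases hi : i = j
  · subst hi; simp [h]
  · simp [hi]

theorem cube_mem_bd (a b : Fin n → SignType) (β : ℤˣ) :
    b ∈ (cubeFaces n).bd β a ↔ ∃ j ∈ Finset.univ.filter (fun j => b j ≠ 0),
      a = Function.update b j 0 ∧ cubeSign b j = β := by
  simp only [cubeFaces, Finset.mem_filter, Finset.mem_univ, true_and]
  refine exists_congr fun j => ⟨fun ⟨h₁, h₂, h₃⟩ => ?_, fun ⟨h₁, h₂, h₃⟩ => ?_⟩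
  · have hb : b j ≠ 0 := fun e => by
      rw [e] at h₂; exact (Units.ne_zero _ h₂.symm)
    have e : a = Function.update b j 0 := by
      funext k
      by_cases hk : k = j
      · subst hk; rw [h₁, Function.update_self]
      · rw [Function.update_of_ne hk, h₃ k hk]
    refine ⟨hb, e, ?_⟩
    rw [e, zerosBefore_update_self] at h₂
    exact (sign_eq_iff hb _ _).1 h₂
  · subst h₂
    refine ⟨Function.update_self .., ?_, fun k hk => (Function.update_of_ne hk ..).symm⟩
    rw [zerosBefore_update_self]
    exact (sign_eq_iff h₁ _ _).2 h₃

theorem cube_dim_eq_zero (a : Fin n → SignType) : (cubeFaces n).dim a = 0 ↔ ∀ j, a j ≠ 0 := by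
  show (Finset.univ.filter (fun j => a j = 0)).card = 0 ↔ _
  rw [Finset.card_eq_zero, Finset.filter_eq_empty_iff]
  exact ⟨fun h j => h (Finset.mem_univ j), fun h j _ => h j⟩

/-- The support of the atom of a cube face: `b` occurs in `⟨a⟩^α` if it is a subface of `a` and if
every zero of `a` which is replaced in `b` is replaced by the sign `α (-1)^m`, where `m` is the number
of zeros of `b` before it. -/
def InCubeAtom (α : ℤˣ) (a b : Fin n → SignType) : Prop :=
  (∀ j, a j ≠ 0 → b j = a j) ∧
    ∀ j, a j = 0 → b j ≠ 0 → (b j : ℤ) = ((α * (-1) ^ zerosBefore b j : ℤˣ) : ℤ)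

instance (α : ℤˣ) (a b : Fin n → SignType) : Decidable (InCubeAtom α a b) := by
  unfold InCubeAtom; infer_instance

theorem inCubeAtom_iff (α : ℤˣ) (a b : Fin n → SignType) :
    InCubeAtom α a b ↔ (∀ j, a j ≠ 0 → b j = a j) ∧
      ∀ j ∈ Finset.univ.filter (fun j => a j = 0 ∧ b j ≠ 0), cubeSign b j = α := by
  simp only [InCubeAtom, Finset.mem_filter, Finset.mem_univ, true_and, and_imp]
  exact and_congr_right fun _ => forall_congr' fun j => forall_congr' fun _ =>
    forall_congr' fun hb => sign_eq_iff hb _ _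

theorem inCubeAtom_update (α : ℤˣ) (a b : Fin n → SignType) (hab : ∀ j, a j ≠ 0 → b j = a j)
    (j : Fin n) (haj : a j = 0) (hbj : b j ≠ 0) :
    InCubeAtom α a (Function.update b j 0) ↔
      ∀ k ∈ Finset.univ.filter (fun j => a j = 0 ∧ b j ≠ 0),
        (k < j → cubeSign b k = α) ∧ (j < k → cubeSign b k = -α) := by
  rw [inCubeAtom_iff]
  have h₀ : ∀ k, a k ≠ 0 → Function.update b j 0 k = a k := fun k hk => by
    rw [Function.update_of_ne (fun e => hk (by rw [e, haj])), hab k hk]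
  rw [and_iff_right h₀]
  simp only [Finset.mem_filter, Finset.mem_univ, true_and, and_imp]
  refine forall_congr' fun k => forall_congr' fun hk => ?_
  rcases lt_trichotomy k j with h | h | h
  · simp only [cubeSign, Function.update_of_ne (ne_of_lt h), zerosBefore_update_of_lt b h, h,
      not_lt_of_gt h, false_imp_iff, and_true, true_imp_iff]
  · subst h; simp
  · simp only [cubeSign, Function.update_of_ne (ne_of_gt h), zerosBefore_update_zero b h hbj, h,
      not_lt_of_gt h, false_imp_iff, true_and, true_imp_iff, pow_succ]
    refine forall_congr' fun _ => ?_
    rw [← mul_assoc, mul_neg, mul_one, neg_eq_iff_eq_neg]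

/-- The atom `R(a)` of a face `a` of the cube, as a cell. -/
def cubeAtom (a : Fin n → SignType) : (cubeFaces n).Cell where
  coeff α b := if InCubeAtom α a b then 1 else 0
  aug α := by
    set b₀ : Fin n → SignType := fun j => if a j = 0 then (if α = 1 then 1 else -1) else a j
    have hz : ∀ b : Fin n → SignType, (∀ j, b j ≠ 0) → ∀ j, zerosBefore b j = 0 := fun b hb j => by
      simp [zerosBefore, hb]
    have hs : ∀ x : SignType, x ≠ 0 →
        ((x : ℤ) = ((α * (-1) ^ 0 : ℤˣ) : ℤ) ↔ x = if α = 1 then 1 else -1) := by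
      intro x hx
      rcases Int.units_eq_one_or α with rfl | rfl <;> cases x <;>
        first | exact absurd rfl hx | decide
    have key : ∀ b : Fin n → SignType, (cubeFaces n).dim b = 0 → (InCubeAtom α a b ↔ b = b₀) := by
      intro b hb
      have hb : ∀ j, b j ≠ 0 := (cube_dim_eq_zero b).1 hb
      constructor
      · rintro ⟨h₁, h₂⟩
        funext j
        by_cases ha : a j = 0
        · have := h₂ j ha (hb j)
          rw [hz b hb j, hs _ (hb j)] at this
          simp [b₀, ha, this]
        · simp [b₀, ha, h₁ j ha]
      · rintro rfl
        refine ⟨fun j hj => by simp [b₀, hj], fun j hj hj' => ?_⟩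
        rw [hz b₀ hb j, hs _ hj']
        simp [b₀, hj]
    have hb₀ : (cubeFaces n).dim b₀ = 0 := by
      refine (cube_dim_eq_zero b₀).2 fun j => ?_
      show (if a j = 0 then (if α = 1 then (1 : SignType) else -1) else a j) ≠ 0
      split_ifs with h₁ h₂
      · decide
      · decide
      · exact h₁
    rw [Finset.sum_eq_single_of_mem b₀ (Finset.mem_filter.2 ⟨Finset.mem_univ _, hb₀⟩)
      (fun b hb hne => if_neg fun h => hne ((key b (Finset.mem_filter.1 hb).2).1 h))]
    exact if_pos ((key b₀ hb₀).2 rfl)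
  bdry α b := by
    rw [(cubeFaces n).sum_inc b (Finset.univ.filter (fun j => b j ≠ 0))
      (fun j => Function.update b j 0) (cubeSign b) ?_ (fun β a => cube_mem_bd a b β)
      (fun c => ((if InCubeAtom α a c then 1 else 0 : ℕ) : ℤ))]
    · by_cases hab : ∀ j, a j ≠ 0 → b j = a j
      · have e : ∑ j ∈ Finset.univ.filter (fun j => b j ≠ 0),
            ((if InCubeAtom α a (Function.update b j 0) then 1 else 0 : ℕ) : ℤ) * cubeSign b j =
            ∑ j ∈ Finset.univ.filter (fun j => a j = 0 ∧ b j ≠ 0),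
              (if ∀ k ∈ Finset.univ.filter (fun j => a j = 0 ∧ b j ≠ 0),
                (k < j → cubeSign b k = α) ∧ (j < k → cubeSign b k = -α)
                then (cubeSign b j : ℤ) else 0) := by
          symm
          refine Finset.sum_subset_zero_on_sdiff (fun j hj => ?_) (fun j hj => ?_) (fun j hj => ?_)
          · simp only [Finset.mem_filter, Finset.mem_univ, true_and] at hj ⊢
            exact hj.2
          · simp only [Finset.mem_filter, Finset.mem_univ, true_and, Finset.mem_sdiff,
              not_and, not_not] at hj
            have haj : a j ≠ 0 := fun h => hj.1 (hj.2 h)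
            rw [if_neg]
            · simp
            · exact fun h => haj (by rw [← h.1 j haj, Function.update_self])
          · simp only [Finset.mem_filter, Finset.mem_univ, true_and] at hj
            rw [← if_congr (inCubeAtom_update α a b hab j hj.1 hj.2) rfl rfl]
            split_ifs <;> simp
        rw [e, FaceSystem.telescope]
        have h' : ∀ β, InCubeAtom β a b ↔
            ∀ k ∈ Finset.univ.filter (fun j => a j = 0 ∧ b j ≠ 0), cubeSign b k = β := fun β =>
          (inCubeAtom_iff β a b).trans (and_iff_right hab)
        rw [if_congr (h' 1) rfl rfl, if_congr (h' (-1)) rfl rfl]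
        push_cast
        rfl
      · rw [if_neg (fun h => hab h.1), if_neg (fun h => hab h.1), Finset.sum_eq_zero]
        · simp
        · intro j hj
          rw [if_neg]
          · simp
          · rintro ⟨h, _⟩
            push Not at hab
            obtain ⟨k, hk, hk'⟩ := hab
            by_cases hkj : k = j
            · subst hkj
              have := h k hk
              rw [Function.update_self] at this
              exact hk this.symm
            · exact hk' (by rw [← h k hk, Function.update_of_ne hkj])
    · intro i hi j hj h
      by_contra hij
      have := congrFun h i
      rw [Function.update_self, Function.update_of_ne hij] at this
      exact (Finset.mem_filter.1 hi).2 this.symm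

/-- The `n`-cube `I^n`: the ω-category generated by the atoms of the faces of the cube. -/
def cubeCat (n : ℕ) : OmegaCat.{0} := (cubeFaces n).cellCat.generate (Set.range cubeAtom)

/-- The element `R(a)` of `I^n`, for a face `a` of the cube. -/
def cubeFace (a : Fin n → SignType) : (cubeCat n).carrier :=
  ⟨cubeAtom a, .of _ ⟨a, rfl⟩⟩

/-- The number of plus signs before the first zero. -/
def cubeHeight (b : Fin n → SignType) : ℤ :=
  ∑ j : Fin n, if b j = 1 ∧ ∀ k < j, b k ≠ 0 then 1 else 0

theorem cubeHeight_update (a : Fin n → SignType) (j : Fin n) (ha : a j = 0) :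
    cubeHeight (Function.update a j 1) - cubeHeight (Function.update a j (-1)) =
      if zerosBefore a j = 0 then 1 else 0 := by
  unfold cubeHeight
  rw [← Finset.sum_sub_distrib, Finset.sum_eq_single j]
  · have h : ∀ x, (∀ k < j, Function.update a j x k ≠ 0) ↔ zerosBefore a j = 0 := fun x => by
      rw [zerosBefore, Finset.card_eq_zero, Finset.filter_eq_empty_iff]
      refine ⟨fun h k _ hk => h k hk.1 ?_, fun h k hk hk' => h (Finset.mem_univ k) ⟨hk, ?_⟩⟩
      · rw [Function.update_of_ne (ne_of_lt hk.1), hk.2]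
      · rwa [Function.update_of_ne (ne_of_lt hk)] at hk'
    simp only [Function.update_self, h]
    simp [show (-1 : SignType) ≠ 1 by decide]
  · intro k _ hk
    rw [sub_eq_zero]
    refine if_congr ?_ rfl rfl
    rw [Function.update_of_ne hk, Function.update_of_ne hk]
    refine and_congr_right fun _ => forall₂_congr fun i _ => ?_
    by_cases hi : i = j
    · subst hi
      simp [show (-1 : SignType) ≠ 0 by decide]
    · rw [Function.update_of_ne hi, Function.update_of_ne hi]
  · simp

theorem cube_bd_eq (β : ℤˣ) (a : Fin n → SignType) : (cubeFaces n).bd β a =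
    (Finset.univ.filter (fun j => a j = 0)).image (fun j => Function.update a j
      (if β * (-1) ^ zerosBefore a j = 1 then 1 else -1)) := by
  have hs : ∀ (x : SignType) (γ : ℤˣ), (x : ℤ) = (γ : ℤ) ↔ (if γ = 1 then 1 else -1) = x := by
    intro x γ
    rcases Int.units_eq_one_or γ with rfl | rfl <;> cases x <;> decide
  ext b
  simp only [cubeFaces, Finset.mem_filter, Finset.mem_univ, true_and, Finset.mem_image]
  refine exists_congr fun j => and_congr_right fun _ => ?_
  rw [hs, Function.update_eq_iff]
  exact and_congr_right fun _ => forall₂_congr fun k _ => eq_comm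

theorem cubeHeight_bd (a : Fin n → SignType) (ha : 1 ≤ (cubeFaces n).dim a) :
    ∑ b : (cubeFaces n).Face, cubeHeight b * (cubeFaces n).inc a b = 1 := by
  have e : ∀ β, ∑ b : (cubeFaces n).Face,
      cubeHeight b * (if b ∈ (cubeFaces n).bd β a then 1 else 0) =
      ∑ j ∈ Finset.univ.filter (fun j => a j = 0), cubeHeight (Function.update a j
      (if β * (-1) ^ zerosBefore a j = 1 then 1 else -1)) := by
    intro β
    have h₀ : ∀ s : Finset (cubeFaces n).Face, ∑ b : (cubeFaces n).Face,
        cubeHeight b * (if b ∈ s then 1 else 0) = ∑ b ∈ s, cubeHeight b := fun s => by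
      simp_rw [mul_ite, mul_one, mul_zero]
      rw [← Finset.sum_filter, Finset.filter_mem_eq_inter, Finset.univ_inter]
    rw [h₀, cube_bd_eq]
    refine Finset.sum_image fun i hi j _ h => ?_
    by_contra hij
    have := congrFun h i
    simp only [Function.update_self, Function.update_of_ne hij] at this
    rw [(Finset.mem_filter.1 hi).2] at this
    revert this
    split_ifs <;> decide
  unfold FaceSystem.inc
  simp_rw [mul_sub]
  rw [Finset.sum_sub_distrib, e, e, ← Finset.sum_sub_distrib]
  have hne : (Finset.univ.filter (fun j => a j = 0)).Nonempty := Finset.card_pos.1 ha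
  set m := (Finset.univ.filter (fun j => a j = 0)).min' hne with hm
  have hma : a m = 0 := (Finset.mem_filter.1 (Finset.min'_mem _ hne)).2
  have hmz : ∀ j, a j = 0 → (zerosBefore a j = 0 ↔ j = m) := by
    intro j hj
    rw [zerosBefore, Finset.card_eq_zero, Finset.filter_eq_empty_iff]
    constructor
    · intro h
      have h₁ : m ≤ j := Finset.min'_le _ _ (by simp [hj])
      rcases lt_or_eq_of_le h₁ with h₂ | h₂
      · exact absurd ⟨h₂, hma⟩ (h (Finset.mem_univ m))
      · exact h₂.symm
    · rintro rfl k _ ⟨hk, hk'⟩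
      exact absurd (Finset.min'_le _ k (by simp [hk'])) (not_le_of_gt hk)
  rw [Finset.sum_eq_single_of_mem m (Finset.min'_mem _ hne)]
  · have h₀ := (hmz m hma).2 rfl
    rw [h₀]
    have := cubeHeight_update a m hma
    rw [if_pos h₀] at this
    simpa using this
  · intro j hj hjm
    have haj := (Finset.mem_filter.1 hj).2
    have := cubeHeight_update a j haj
    rw [if_neg (fun h => hjm ((hmz j haj).1 h))] at this
    rcases neg_one_pow_eq_or ℤˣ (zerosBefore a j) with e | e <;> rw [e]
    · simpa using this
    · simpa using (by linarith : cubeHeight (Function.update a j (-1)) -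
        cubeHeight (Function.update a j 1) = 0)

/-- The cube is non-contracting. -/
theorem cubeCat_nonContracting (n : ℕ) : (cubeCat n).NonContracting :=
  ((cubeFaces n).nonContracting_of_functional cubeHeight cubeHeight_bd).sub _
    (fun α m x hx => .d α m x hx) (fun m x y h hx hy => .comp m x y h hx hy)

theorem inCubeAtom_self (α : ℤˣ) (a : Fin n → SignType) : InCubeAtom α a a :=
  ⟨fun _ _ => rfl, fun _ h h' => absurd h h'⟩

theorem one_le_dim_cubeFace (a : Fin n → SignType) (ha : ∃ j, a j = 0) :
    1 ≤ (cubeCat n).dim (cubeFace a) := by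
  rw [(cubeCat n).one_le_dim_iff _ 1]
  intro h
  have h' : (cubeFaces n).cellD 1 0 (cubeAtom a) = cubeAtom a := congrArg Subtype.val h
  have h₁ : ((cubeFaces n).cellD 1 0 (cubeAtom a)).coeff 1 a = (cubeAtom a).coeff 1 a := by rw [h']
  have hd : (cubeFaces n).dim a ≠ 0 := by
    obtain ⟨j, hj⟩ := ha
    exact fun h => (cube_dim_eq_zero a).1 h j hj
  have h₂ : (0 : ℕ) = if InCubeAtom 1 a a then 1 else 0 := by
    refine Eq.trans ?_ h₁
    show 0 = if (cubeFaces n).dim a < 0 then (cubeAtom a).coeff 1 a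
      else if (cubeFaces n).dim a = 0 then (cubeAtom a).coeff 1 a else 0
    rw [if_neg (Nat.not_lt_zero _), if_neg hd]
  rw [if_pos (inCubeAtom_self 1 a)] at h₂
  exact absurd h₂ (by decide)

theorem dim_cubeFace_eq_zero (a : Fin n → SignType) (ha : ∀ j, a j ≠ 0) :
    (cubeCat n).dim (cubeFace a) = 0 := by
  rw [← Nat.le_zero, (cubeCat n).dim_le_iff _ _ 1]
  refine Subtype.ext (FaceSystem.cell_ext fun α b => ?_)
  have hb : ∀ α, InCubeAtom α a b ↔ b = a := fun α =>
    ⟨fun h => funext fun j => h.1 j (ha j), fun h => h ▸ inCubeAtom_self α a⟩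
  show (if (cubeFaces n).dim b < 0 then (if InCubeAtom α a b then 1 else 0)
    else if (cubeFaces n).dim b = 0 then (if InCubeAtom 1 a b then 1 else 0) else 0) =
      if InCubeAtom α a b then 1 else 0
  rw [if_neg (Nat.not_lt_zero _), if_congr (hb 1) rfl rfl, if_congr (hb α) rfl rfl]
  by_cases e : b = a
  · rw [if_pos e, if_pos (by rw [e]; exact (cube_dim_eq_zero a).2 ha)]
  · simp [e]

/-- The initial vertex `R(-…-)` of the cube. -/
def cubeInitial (n : ℕ) : (cubeCat n).Vertex :=
  ⟨cubeFace (fun _ => -1), dim_cubeFace_eq_zero _ (fun _ => by decide)⟩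

end Cube

/-! ## The simplex -/

section Simplex

variable {n : ℕ}

/-- The sign `(-1)^i` of the position `i` (counted from `1`) of `v` among the elements of `τ` which
are smaller than `v`, followed by `v` itself. -/
def simplexSign (τ : Finset (Fin (n + 1))) (v : Fin (n + 1)) : ℤˣ :=
  (-1) ^ ((τ.filter (fun u => u < v)).card + 1)

/-- The faces of the `n`-simplex: non-empty subsets `σ` of `{0, …, n}`, of dimension `|σ| - 1`.
In `s_σ` (resp. `t_σ`) an element in odd (resp. even) position is removed, positions being
counted from `1`. -/
abbrev simplexFaces (n : ℕ) : FaceSystem where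
  Face := {σ : Finset (Fin (n + 1)) // σ.Nonempty}
  fintypeFace := inferInstance
  decEqFace := inferInstance
  dim σ := σ.1.card - 1
  bd α σ := Finset.univ.filter (fun τ => ∃ v ∈ σ.1, τ.1 = σ.1.erase v ∧ simplexSign σ.1 v = α)
  dim_bd α σ τ h := by
    obtain ⟨v, hv, e, _⟩ := (Finset.mem_filter.1 h).2
    have h₁ := τ.2.card_pos
    have h₂ := Finset.card_erase_add_one hv
    rw [← e] at h₂
    omega

theorem simplexSign_insert_of_le (τ : Finset (Fin (n + 1))) {v w : Fin (n + 1)} (h : w ≤ v) :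
    simplexSign (insert v τ) w = simplexSign τ w := by
  unfold simplexSign
  rw [Finset.filter_insert, if_neg (not_lt_of_ge h)]

theorem simplexSign_insert_of_lt (τ : Finset (Fin (n + 1))) {v w : Fin (n + 1)} (h : v < w)
    (hv : v ∉ τ) : simplexSign (insert v τ) w = -simplexSign τ w := by
  unfold simplexSign
  rw [Finset.filter_insert, if_pos h, Finset.card_insert_of_notMem (by simp [hv]), pow_succ]
  simp

theorem simplex_mem_bd (σ τ : (simplexFaces n).Face) (β : ℤˣ) :
    τ ∈ (simplexFaces n).bd β σ ↔ ∃ v ∈ τ.1ᶜ,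
      σ = ⟨insert v τ.1, Finset.insert_nonempty v τ.1⟩ ∧ simplexSign τ.1 v = β := by
  simp only [simplexFaces, Finset.mem_filter, Finset.mem_univ, true_and, Finset.mem_compl]
  refine exists_congr fun v => ⟨fun ⟨h₁, h₂, h₃⟩ => ?_, fun ⟨h₁, h₂, h₃⟩ => ?_⟩
  · have hv : v ∉ τ.1 := by rw [h₂]; exact Finset.notMem_erase v _
    have e : σ.1 = insert v τ.1 := by rw [h₂, Finset.insert_erase h₁]
    refine ⟨hv, Subtype.ext e, ?_⟩
    rwa [e, simplexSign_insert_of_le _ le_rfl] at h₃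
  · subst h₂
    refine ⟨Finset.mem_insert_self _ _, (Finset.erase_insert h₁).symm, ?_⟩
    rwa [simplexSign_insert_of_le _ le_rfl]

/-- The support of the atom of a face of the simplex: `τ` occurs in `⟨σ⟩^α` if `τ ⊆ σ` and if every
`v ∈ σ` which is not in `τ` has the position sign `α` relative to `τ`. -/
def InSimplexAtom (α : ℤˣ) (σ τ : Finset (Fin (n + 1))) : Prop :=
  τ ⊆ σ ∧ ∀ v ∈ σ \ τ, simplexSign τ v = α

instance (α : ℤˣ) (σ τ : Finset (Fin (n + 1))) : Decidable (InSimplexAtom α σ τ) := by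
  unfold InSimplexAtom; infer_instance

theorem inSimplexAtom_insert (α : ℤˣ) (σ τ : Finset (Fin (n + 1))) (hτ : τ ⊆ σ)
    (v : Fin (n + 1)) (hv : v ∈ σ \ τ) :
    InSimplexAtom α σ (insert v τ) ↔
      ∀ w ∈ σ \ τ, (w < v → simplexSign τ w = α) ∧ (v < w → simplexSign τ w = -α) := by
  rw [Finset.mem_sdiff] at hv
  rw [InSimplexAtom, and_iff_right (Finset.insert_subset hv.1 hτ)]
  simp only [Finset.mem_sdiff, Finset.mem_insert, not_or, and_imp]
  refine forall₂_congr fun w hw => ?_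
  rcases lt_trichotomy w v with h | h | h
  · simp [h, ne_of_lt h, not_lt_of_gt h, simplexSign_insert_of_le τ h.le]
  · subst h; simp
  · simp [h, ne_of_gt h, not_lt_of_gt h, simplexSign_insert_of_lt τ h hv.2, neg_eq_iff_eq_neg]

/-- The atom `R(σ)` of a face `σ` of the simplex, as a cell. -/
def simplexAtom (σ : (simplexFaces n).Face) : (simplexFaces n).Cell where
  coeff α τ := if InSimplexAtom α σ.1 τ.1 then 1 else 0
  aug α := by
    have key : ∃ u ∈ σ.1, ∀ w ∈ σ.1, InSimplexAtom α σ.1 {w} ↔ w = u := by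
      have hs : ∀ w v : Fin (n + 1), v ≠ w →
          (simplexSign {w} v = if w < v then 1 else -1) := fun w v _ => by
        unfold simplexSign
        rw [Finset.filter_singleton]
        split_ifs <;> simp
      have hd : ∀ w ∈ σ.1, (InSimplexAtom α σ.1 {w} ↔
          ∀ v ∈ σ.1, v ≠ w → (if w < v then (1 : ℤˣ) else -1) = α) := fun w hw => by
        rw [InSimplexAtom, and_iff_right (Finset.singleton_subset_iff.2 hw)]
        simp only [Finset.mem_sdiff, Finset.mem_singleton, and_imp]
        exact forall₂_congr fun v _ => forall_congr' fun h => by rw [hs w v h]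
      have h1 : (1 : ℤˣ) ≠ -1 := by decide
      rcases Int.units_eq_one_or α with rfl | rfl
      · refine ⟨σ.1.min' σ.2, Finset.min'_mem _ _, fun w hw => ?_⟩
        rw [hd w hw]
        constructor
        · intro h
          by_contra hne
          have h' := h _ (Finset.min'_mem _ σ.2) (Ne.symm hne)
          rw [if_neg (not_lt_of_ge (Finset.min'_le _ _ hw))] at h'
          exact h1 h'.symm
        · rintro rfl v hv hne
          exact if_pos (lt_of_le_of_ne (Finset.min'_le _ _ hv) (Ne.symm hne))
      · refine ⟨σ.1.max' σ.2, Finset.max'_mem _ _, fun w hw => ?_⟩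
        rw [hd w hw]
        constructor
        · intro h
          by_contra hne
          have h' := h _ (Finset.max'_mem _ σ.2) (Ne.symm hne)
          rw [if_pos (lt_of_le_of_ne (Finset.le_max' _ _ hw) hne)] at h'
          exact h1 h'
        · rintro rfl v hv hne
          exact if_neg (not_lt_of_ge (Finset.le_max' _ _ hv))
    obtain ⟨u, hu, key⟩ := key
    let f : (simplexFaces n).Face := ⟨{u}, Finset.singleton_nonempty u⟩
    have hf : (simplexFaces n).dim f = 0 := by
      show ({u} : Finset (Fin (n + 1))).card - 1 = 0
      simp
    rw [Finset.sum_eq_single_of_mem f (Finset.mem_filter.2 ⟨Finset.mem_univ _, hf⟩)]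
    · exact if_pos ((key u hu).2 rfl)
    · intro τ hτ hne
      have h₁ : τ.1.card - 1 = 0 := (Finset.mem_filter.1 hτ).2
      have h₂ := τ.2.card_pos
      obtain ⟨w, hw⟩ := Finset.card_eq_one.1 (show τ.1.card = 1 by omega)
      refine if_neg fun h => hne (Subtype.ext ?_)
      have hwσ : w ∈ σ.1 := h.1 (by rw [hw]; exact Finset.mem_singleton_self w)
      rw [hw] at h
      rw [hw, (key w hwσ).1 h]
  bdry α τ := by
    rw [(simplexFaces n).sum_inc τ τ.1ᶜ
      (fun v => ⟨insert v τ.1, Finset.insert_nonempty v τ.1⟩) (simplexSign τ.1) ?_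
      (fun β σ => simplex_mem_bd σ τ β)
      (fun ρ => ((if InSimplexAtom α σ.1 ρ.1 then 1 else 0 : ℕ) : ℤ))]
    · by_cases hτ : τ.1 ⊆ σ.1
      · have e : ∑ v ∈ τ.1ᶜ,
            ((if InSimplexAtom α σ.1 (insert v τ.1) then 1 else 0 : ℕ) : ℤ) * simplexSign τ.1 v =
            ∑ v ∈ σ.1 \ τ.1, (if ∀ w ∈ σ.1 \ τ.1, (w < v → simplexSign τ.1 w = α) ∧
              (v < w → simplexSign τ.1 w = -α) then (simplexSign τ.1 v : ℤ) else 0) := by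
          symm
          refine Finset.sum_subset_zero_on_sdiff (fun v hv => ?_) (fun v hv => ?_) (fun v hv => ?_)
          · exact Finset.mem_compl.2 (Finset.mem_sdiff.1 hv).2
          · have hv : v ∉ σ.1 := fun h => (Finset.mem_sdiff.1 hv).2 (Finset.mem_sdiff.2
              ⟨h, Finset.mem_compl.1 (Finset.mem_sdiff.1 hv).1⟩)
            rw [if_neg (fun h => hv (h.1 (Finset.mem_insert_self v _)))]
            simp
          · rw [← if_congr (inSimplexAtom_insert α σ.1 τ.1 hτ v hv) rfl rfl]
            split_ifs <;> simp
        rw [e, FaceSystem.telescope]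
        have h' : ∀ β, InSimplexAtom β σ.1 τ.1 ↔ ∀ w ∈ σ.1 \ τ.1, simplexSign τ.1 w = β :=
          fun β => and_iff_right hτ
        rw [if_congr (h' 1) rfl rfl, if_congr (h' (-1)) rfl rfl]
        push_cast
        rfl
      · rw [if_neg (fun h => hτ h.1), if_neg (fun h => hτ h.1), Finset.sum_eq_zero]
        · simp
        · intro v _
          rw [if_neg (fun h => hτ ((Finset.subset_insert v _).trans h.1))]
          simp
    · intro v hv w hw h
      have h' : insert v τ.1 = insert w τ.1 := congrArg Subtype.val h
      have := h' ▸ Finset.mem_insert_self v τ.1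
      exact (Finset.mem_insert.1 this).resolve_right (Finset.mem_compl.1 hv)

/-- The `n`-simplex `Δ^n`: the ω-category generated by the atoms of the faces of the simplex. -/
def simplexCat (n : ℕ) : OmegaCat.{0} := (simplexFaces n).cellCat.generate (Set.range simplexAtom)

/-- The element `R(σ)` of `Δ^n`, for a face `σ` of the simplex. -/
def simplexFace (σ : (simplexFaces n).Face) : (simplexCat n).carrier :=
  ⟨simplexAtom σ, .of _ ⟨σ, rfl⟩⟩

end Simplex

/-- The map `φ_n⁻` from the faces of the `n`-simplex to those of the `(n+1)`-cube: the letters at the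
positions in `σ` are `0`, the others are `-`. -/
def faceMap (n : ℕ) (σ : (simplexFaces n).Face) : Fin (n + 1) → SignType :=
  fun j => if j ∈ σ.1 then 0 else -1

/-- The element `R(φ_n⁻(σ))` of the path ω-category of the `(n+1)`-cube. -/
def facePath (n : ℕ) (σ : (simplexFaces n).Face) :
    ((cubeCat (n + 1)).path (cubeCat_nonContracting (n + 1))).carrier :=
  ⟨cubeFace (faceMap n σ), one_le_dim_cubeFace _
    (σ.2.imp fun _ hj => if_pos hj)⟩

/-!
Write `Q` for the fibre `ℙ⁻_v` of the cube over its initial vertex `v`. Two facts about `Q` come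
from the universal property of the pushout. Restricting a cell of the cube to the faces `φ⁻(σ)` is
an ω-functor to the cells of the simplex, defined on the elements of `ℙ(I^{n+1})` which start at `v`
(`restrictCell_cellD`, `restrictCell_cellComp`), since the boundary of `φ⁻(σ)` restricted to these
faces is the boundary of `σ`; it does not see the second factor of a composite along a vertex
(`coeff_faceMap_eq_zero`), so it is constant on the classes of `R⁻` and induces an ω-functor
`fibreToSimplex` on `Q` which sends `h⁻(R(φ⁻(σ)))` to `R(σ)`. Moreover `Q` consists of composites of
the elements `h⁻(R(φ⁻(σ)))` (`fibre_composite`): a cell of the cube is a composite of atoms, and in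
`ℙ⁻` a composite along a vertex equals its first factor.

It remains to see that an ω-functor from an ω-category to the cells of the simplex is injective as
soon as its domain is generated under composition alone by one element over each atom, of at most
the dimension of its face. This is `Cover.val_injective`, and it is a freeness statement about the
simplex. It uses a linear order on the faces in which a face comes after the other faces of the
negative part of its atom, and before those of the positive part (`OrientedBasis`; such orders exist
for the cube and the simplex). With such an order a cell whose part of dimension above `p` is a sum
of atoms is cut, along dimension `p`, into the pieces given by an initial segment and the remaining
final segment (`splice`), and atoms which can be executed in either order commute by the interchange
law. In this way each element of `Q` over a given cell is brought to the same normal form, a sorted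
composite of elements with a single atom above dimension `p`, and one concludes by induction on `p`.
The same cutting argument shows that every cell of the cube is a composite of atoms
(`cell_induction`).
-/

namespace FaceSystem

/-! ### Cells as sums of atoms -/

/-- A basis of atoms for the cells of a face system: every face `a` has an atom `atom a`, a cell in
which `a` occurs once and which otherwise consists of faces of smaller dimension. Loop-freeness is
encoded by an injective map `ht` to a linear order under which the faces of the negative part of
`atom a` lie below `a` and those of the positive part lie above `a`. -/
structure OrientedBasis (K : FaceSystem) (L : Type) [LinearOrder L] where
  atom : K.Face → K.Cell
  ht : K.Face → L
  ht_injective : Function.Injective ht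
  coeff_self : ∀ α a, (atom a).coeff α a = 1
  dim_lt : ∀ α a b, (atom a).coeff α b ≠ 0 → b ≠ a → K.dim b < K.dim a
  ht_src : ∀ a b, (atom a).coeff (-1) b ≠ 0 → ht b ≤ ht a
  ht_tgt : ∀ a b, (atom a).coeff 1 b ≠ 0 → ht a ≤ ht b

/-- A cell is determined by its coefficients outside dimension `j` together with its negative part in
dimension `j`: the positive part there is given by the boundary of the next dimension. -/
theorem eq_of_src {K : FaceSystem} {w w' : K.Cell} (j : ℕ)
    (h₁ : ∀ α a, K.dim a < j → w.coeff α a = w'.coeff α a)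
    (h₂ : ∀ a, K.dim a = j → w.coeff (-1) a = w'.coeff (-1) a)
    (h₃ : ∀ α a, j < K.dim a → w.coeff α a = w'.coeff α a) : w = w' := by
  refine cell_ext fun α a => ?_
  rcases lt_trichotomy (K.dim a) j with h | h | h
  · exact h₁ α a h
  · rcases Int.units_eq_one_or α with rfl | rfl
    · have e₁ := w.bdry 1 a
      have e₂ := w'.bdry 1 a
      rw [K.sum_inc_congr (g := fun b => (w'.coeff 1 b : ℤ))
        (fun b hb => by rw [h₃ 1 b (by omega)])] at e₁
      have := h₂ a h
      omega
    · exact h₂ a h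
  · exact h₃ α a h

theorem eq_of_tgt {K : FaceSystem} {w w' : K.Cell} (j : ℕ)
    (h₁ : ∀ α a, K.dim a < j → w.coeff α a = w'.coeff α a)
    (h₂ : ∀ a, K.dim a = j → w.coeff 1 a = w'.coeff 1 a)
    (h₃ : ∀ α a, j < K.dim a → w.coeff α a = w'.coeff α a) : w = w' := by
  refine eq_of_src j h₁ (fun a h => ?_) h₃
  have e₁ := w.bdry 1 a
  have e₂ := w'.bdry 1 a
  rw [K.sum_inc_congr (g := fun b => (w'.coeff 1 b : ℤ))
    (fun b hb => by rw [h₃ 1 b (by omega)])] at e₁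
  have := h₂ a h
  omega

/-- Composites with the same first factor above dimension `j` have the same factors. -/
theorem cellComp_cancel {K : FaceSystem} {j : ℕ} {u v u' v' : K.Cell}
    {h : K.cellD 1 j u = K.cellD (-1) j v} {h' : K.cellD 1 j u' = K.cellD (-1) j v'}
    (e : K.cellComp j u v h = K.cellComp j u' v' h')
    (hu : ∀ α a, j < K.dim a → u.coeff α a = u'.coeff α a) : u = u' ∧ v = v' := by
  have e' : ∀ α a, (K.cellComp j u v h).coeff α a = (K.cellComp j u' v' h').coeff α a :=
    fun α a => by rw [e]
  have h1 : (1 : ℤˣ) ≠ -1 := by decide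
  have e₁ : u = u' := by
    refine eq_of_src j (fun α a ha => ?_) (fun a ha => ?_) hu
    · simpa [cellComp, ha] using e' α a
    · simpa [cellComp, ha] using e' (-1) a
  subst e₁
  refine ⟨rfl, eq_of_tgt j (fun α a ha => ?_) (fun a ha => ?_) (fun α a ha => ?_)⟩
  · rw [← (K.cellD_eq h α a).1 ha, (K.cellD_eq h' α a).1 ha]
  · simpa [cellComp, ha, h1] using e' 1 a
  · simpa [cellComp, not_lt_of_gt ha, ne_of_gt ha] using e' α a

namespace OrientedBasis

variable {K : FaceSystem} {L : Type} [LinearOrder L] (B : K.OrientedBasis L)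

theorem coeff_of_dim_le {a b : K.Face} (α : ℤˣ) (h : K.dim a ≤ K.dim b) :
    (B.atom a).coeff α b = if b = a then 1 else 0 := by
  split_ifs with e
  · rw [e, B.coeff_self]
  · by_contra hne
    exact absurd (B.dim_lt α a b hne e) (not_lt_of_ge h)

theorem coeff_disjoint {a b : K.Face} (h : b ≠ a) :
    (B.atom a).coeff 1 b = 0 ∨ (B.atom a).coeff (-1) b = 0 := by
  by_contra! hne
  exact h (B.ht_injective (le_antisymm (B.ht_src a b hne.2) (B.ht_tgt a b hne.1)))

theorem atom_injective : Function.Injective B.atom := by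
  intro a b h
  by_contra hne
  have h₁ := B.dim_lt 1 a b (by rw [h, B.coeff_self]; exact one_ne_zero) (Ne.symm hne)
  have h₂ := B.dim_lt 1 b a (by rw [← h, B.coeff_self]; exact one_ne_zero) hne
  omega

/-- The coefficient of the face `a` in the sum of the atoms of a list of faces. -/
def total (l : List K.Face) (α : ℤˣ) (a : K.Face) : ℕ := (l.map fun b => (B.atom b).coeff α a).sum

@[simp] theorem total_nil (α : ℤˣ) (a : K.Face) : B.total [] α a = 0 := rfl

@[simp] theorem total_cons (b : K.Face) (l : List K.Face) (α : ℤˣ) (a : K.Face) :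
    B.total (b :: l) α a = (B.atom b).coeff α a + B.total l α a := by simp [total]

@[simp] theorem total_append (l l' : List K.Face) (α : ℤˣ) (a : K.Face) :
    B.total (l ++ l') α a = B.total l α a + B.total l' α a := by simp [total]

theorem total_perm {l l' : List K.Face} (h : l.Perm l') (α : ℤˣ) (a : K.Face) :
    B.total l α a = B.total l' α a := (h.map _).sum_eq

theorem total_ne_zero {l : List K.Face} {α : ℤˣ} {a : K.Face} (h : B.total l α a ≠ 0) :
    ∃ b ∈ l, (B.atom b).coeff α a ≠ 0 := by
  by_contra! h'
  refine h (List.sum_eq_zero fun x hx => ?_)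
  obtain ⟨b, hb, rfl⟩ := List.mem_map.1 hx
  exact h' b hb

theorem total_of_dim_le {l : List K.Face} {a : K.Face} (h : ∀ b ∈ l, K.dim b ≤ K.dim a) (α : ℤˣ) :
    B.total l α a = l.count a := by
  induction l with
  | nil => rfl
  | cons b l ih =>
    rw [total_cons, ih (fun c hc => h c (List.mem_cons_of_mem _ hc)),
      B.coeff_of_dim_le α (h b List.mem_cons_self), List.count_cons, add_comm]
    simp only [beq_iff_eq, @eq_comm _ a b]

theorem total_bdry (l : List K.Face) (α : ℤˣ) (b : K.Face) :
    (B.total l 1 b : ℤ) - B.total l (-1) b = ∑ a : K.Face, (B.total l α a : ℤ) * K.inc a b := by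
  induction l with
  | nil => simp
  | cons c l ih =>
    simp only [total_cons, Nat.cast_add, add_mul, Finset.sum_add_distrib]
    rw [← ih, ← (B.atom c).bdry α b]
    ring

theorem total_aug (l : List K.Face) (α : ℤˣ) :
    ∑ a : K.Face with K.dim a = 0, B.total l α a = l.length := by
  induction l with
  | nil => simp
  | cons c l ih =>
    simp only [total_cons, Finset.sum_add_distrib, ih, (B.atom c).aug α, List.length_cons]
    omega

/-- Above dimension `j`, the cell `w` is the sum of the atoms of a list of faces of dimension
greater than `j`. -/
structure SumAbove (j : ℕ) (w : K.Cell) (l : List K.Face) : Prop where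
  lt_dim : ∀ b ∈ l, j < K.dim b
  coeff_eq : ∀ α a, j < K.dim a → w.coeff α a = B.total l α a

variable {B}

theorem SumAbove.perm {j : ℕ} {w : K.Cell} {l l' : List K.Face} (h : B.SumAbove j w l)
    (hl : l.Perm l') : B.SumAbove j w l' :=
  ⟨fun b hb => h.lt_dim b (hl.mem_iff.2 hb), fun α a ha => by
    rw [h.coeff_eq α a ha, B.total_perm hl]⟩

/-- In dimension `j` the positive and the negative part of `w` differ by the boundary of the sum
of atoms which `w` is above dimension `j`. -/
theorem SumAbove.jump {j : ℕ} {w : K.Cell} {l : List K.Face} (h : B.SumAbove j w l) {a : K.Face}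
    (ha : K.dim a = j) :
    (w.coeff 1 a : ℤ) - w.coeff (-1) a = B.total l 1 a - B.total l (-1) a := by
  rw [w.bdry 1 a, B.total_bdry l 1 a]
  exact K.sum_inc_congr fun b hb => by rw [h.coeff_eq 1 b (by omega)]

theorem SumAbove.atom_le {j : ℕ} {w : K.Cell} {b : K.Face} (h : B.SumAbove j w [b]) {a : K.Face}
    (ha : K.dim a = j) (α : ℤˣ) : (B.atom b).coeff α a ≤ w.coeff α a := by
  have h₁ := h.jump ha
  have h₂ := h.lt_dim b List.mem_cons_self
  have h₃ := B.coeff_disjoint (a := b) (b := a) (by rintro rfl; omega)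
  simp only [total_cons, total_nil, add_zero] at h₁
  rcases Int.units_eq_one_or α with rfl | rfl <;> omega

variable (B)

/-- The cell which agrees with `w` below dimension `j`, has the parts `f` in dimension `j`, and is
the sum of the atoms of `l` above dimension `j`. The part `f α` has to differ from the negative
part of `w` by the boundary of some sum of atoms. -/
def splice (j : ℕ) (w : K.Cell) (l : List K.Face) (f : ℤˣ → K.Face → ℕ)
    (hf : ∀ α, ∃ m : List K.Face, ∀ a, K.dim a = j →
      (f α a : ℤ) = w.coeff (-1) a + (B.total m 1 a - B.total m (-1) a))
    (hl : ∀ a, K.dim a = j → (f 1 a : ℤ) - f (-1) a = B.total l 1 a - B.total l (-1) a) :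
    K.Cell where
  coeff α a := if K.dim a < j then w.coeff α a else if K.dim a = j then f α a else B.total l α a
  aug α := by
    rcases Nat.eq_zero_or_pos j with rfl | hj
    · obtain ⟨m, hm⟩ := hf α
      have e : (∑ a : K.Face with K.dim a = 0, (f α a : ℤ)) = 1 := by
        rw [Finset.sum_congr rfl (fun a ha => hm a (Finset.mem_filter.1 ha).2),
          Finset.sum_add_distrib, Finset.sum_sub_distrib]
        simp only [← Nat.cast_sum, B.total_aug, w.aug]
        simp
      have e' : ∑ a : K.Face with K.dim a = 0, f α a = 1 := by exact_mod_cast e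
      rw [← e']
      exact Finset.sum_congr rfl fun a ha => by simp [(Finset.mem_filter.1 ha).2]
    · rw [← w.aug α]
      exact Finset.sum_congr rfl fun a ha => by simp [(Finset.mem_filter.1 ha).2, hj]
  bdry α b := by
    rcases lt_trichotomy (K.dim b) j with hb | hb | hb
    · rw [if_pos hb, if_pos hb]
      rcases lt_or_eq_of_le (Nat.succ_le_of_lt hb) with hb' | hb'
      · rw [w.bdry α b]
        exact K.sum_inc_congr fun a ha => by rw [if_pos (by omega)]
      · obtain ⟨m, hm⟩ := hf α
        rw [K.sum_inc_congr (g := fun a => (w.coeff (-1) a : ℤ) +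
          (B.total m 1 a - B.total m (-1) a)) (fun a ha => by
            rw [if_neg (by omega), if_pos (by omega), hm a (by omega)])]
        simp only [add_mul, sub_mul, Finset.sum_add_distrib, Finset.sum_sub_distrib]
        rw [← w.bdry (-1) b, ← B.total_bdry m 1 b, ← B.total_bdry m (-1) b]
        ring
    · rw [if_neg (by omega), if_pos hb, if_neg (by omega), if_pos hb, hl b hb, B.total_bdry l α b]
      exact K.sum_inc_congr fun a ha => by rw [if_neg (by omega), if_neg (by omega)]
    · rw [if_neg (by omega), if_neg (by omega), if_neg (by omega), if_neg (by omega),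
        B.total_bdry l α b]
      exact K.sum_inc_congr fun a ha => by rw [if_neg (by omega), if_neg (by omega)]

variable {B}

/-- A cell which is a sum of atoms above dimension `j` can be cut along dimension `j` at any height:
no face of dimension `j` can be in the negative part of a low atom and in the positive part of a
high one. -/
theorem SumAbove.exists_cut {j : ℕ} {w : K.Cell} {l l' : List K.Face}
    (h : B.SumAbove j w (l ++ l')) (hsep : ∀ b ∈ l, ∀ b' ∈ l', B.ht b ≤ B.ht b') :
    ∃ (u v : K.Cell) (huv : K.cellD 1 j u = K.cellD (-1) j v),
      w = K.cellComp j u v huv ∧ B.SumAbove j u l ∧ B.SumAbove j v l' := by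
  have hjump : ∀ a, K.dim a = j → (w.coeff 1 a : ℤ) - w.coeff (-1) a =
      (B.total l 1 a + B.total l' 1 a) - (B.total l (-1) a + B.total l' (-1) a) := fun a ha => by
    have := h.jump ha
    simp only [total_append, Nat.cast_add] at this
    exact this
  have hnn : ∀ a, K.dim a = j → B.total l (-1) a ≤ w.coeff (-1) a + B.total l 1 a := by
    intro a ha
    -- otherwise `a` is in the negative part of a low atom, so, by `hjump`, in the positive part of a
    -- high one
    by_contra hlt
    obtain ⟨b, hb, hba⟩ := B.total_ne_zero (l := l) (α := -1) (a := a) (by omega)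
    have h₀ : B.total l' 1 a = 0 := by
      by_contra hne
      obtain ⟨b', hb', hba'⟩ := B.total_ne_zero hne
      have e : a = b := B.ht_injective (le_antisymm (B.ht_src b a hba)
        ((hsep b hb b' hb').trans (B.ht_tgt b' a hba')))
      have := h.lt_dim b (List.mem_append_left _ hb)
      rw [← e] at this
      omega
    have := hjump a ha
    omega
  set mid : K.Face → ℕ := fun a => w.coeff (-1) a + B.total l 1 a - B.total l (-1) a with hmid
  have hmid' : ∀ a, K.dim a = j →
      (mid a : ℤ) = w.coeff (-1) a + (B.total l 1 a - B.total l (-1) a) := fun a ha => by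
    have := hnn a ha
    simp only [hmid]
    omega
  have h1 : (1 : ℤˣ) ≠ -1 := by decide
  set u : K.Cell := B.splice j w l (fun α a => if α = -1 then w.coeff (-1) a else mid a)
    (fun α => by
      by_cases hα : α = -1
      · exact ⟨[], fun a _ => by simp [hα]⟩
      · exact ⟨l, fun a ha => by simp only [if_neg hα]; exact hmid' a ha⟩)
    (fun a ha => by simp only [if_neg h1, if_pos]; have := hmid' a ha; omega) with hu
  set v : K.Cell := B.splice j w l' (fun α a => if α = -1 then mid a else w.coeff 1 a)
    (fun α => by
      by_cases hα : α = -1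
      · exact ⟨l, fun a ha => by simp only [if_pos hα]; exact hmid' a ha⟩
      · refine ⟨l ++ l', fun a ha => ?_⟩
        simp only [if_neg hα, total_append, Nat.cast_add]
        have := hjump a ha
        omega)
    (fun a ha => by
      simp only [if_neg h1, if_pos]
      have := hmid' a ha
      have := hjump a ha
      omega) with hv
  have huv : K.cellD 1 j u = K.cellD (-1) j v := K.cellD_eq_of
    (fun α a ha => by simp [hu, hv, splice, ha])
    (fun a ha => by simp [hu, hv, splice, ha, h1])
  refine ⟨u, v, huv, cell_ext fun α a => ?_, ⟨fun b hb => h.lt_dim b (List.mem_append_left _ hb),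
    fun α a ha => by simp [hu, splice, not_lt_of_gt ha, ne_of_gt ha]⟩,
    ⟨fun b hb => h.lt_dim b (List.mem_append_right _ hb),
    fun α a ha => by simp [hv, splice, not_lt_of_gt ha, ne_of_gt ha]⟩⟩
  rcases lt_trichotomy (K.dim a) j with ha | ha | ha
  · simp [cellComp, hu, splice, ha]
  · rcases Int.units_eq_one_or α with rfl | rfl
    · simp [cellComp, hv, splice, ha, h1]
    · simp [cellComp, hu, splice, ha]
  · rw [h.coeff_eq α a ha]
    simp [cellComp, hu, hv, splice, not_lt_of_gt ha, ne_of_gt ha]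

/-- If the negative part of `w` in dimension `j + 1` contains the negative parts of the atoms which
make up `w` above that dimension, then the remaining faces complete a sum of atoms above
dimension `j`. -/
theorem SumAbove.exists_lower {j : ℕ} {w : K.Cell} {l : List K.Face} (h : B.SumAbove (j + 1) w l)
    (hle : ∀ a, K.dim a = j + 1 → B.total l (-1) a ≤ w.coeff (-1) a) :
    ∃ R : List K.Face, (∀ b ∈ R, K.dim b = j + 1) ∧ B.SumAbove j w (l ++ R) := by
  set f : K.Face → ℕ := fun a =>
    if K.dim a = j + 1 then w.coeff (-1) a - B.total l (-1) a else 0 with hf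
  set R : List K.Face := (∑ a : K.Face, f a • ({a} : Multiset K.Face)).toList with hR
  have hcount : ∀ a, R.count a = f a := fun a => by
    rw [← Multiset.coe_count, hR, Multiset.coe_toList, Multiset.count_sum']
    simp [Multiset.count_singleton]
  have hdim : ∀ b ∈ R, K.dim b = j + 1 := fun b hb => by
    have := hcount b ▸ List.count_pos_iff.2 hb
    by_contra hne
    simp [hf, hne] at this
  refine ⟨R, hdim, fun b hb => ?_, fun α a ha => ?_⟩
  · rcases List.mem_append.1 hb with hb | hb
    · have := h.lt_dim b hb; omega
    · have := hdim b hb; omega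
  · rw [total_append, B.total_of_dim_le (l := R) (fun b hb => by rw [hdim b hb]; exact ha) α, hcount]
    simp only [hf]
    split_ifs with hj
    · have h₁ := hle a hj
      have h₂ := h.jump hj
      rcases Int.units_eq_one_or α with rfl | rfl <;> omega
    · rw [h.coeff_eq α a (by omega), add_zero]

theorem SumAbove.exists_lower_of_length_le_one {j : ℕ} {w : K.Cell} {l : List K.Face}
    (h : B.SumAbove (j + 1) w l) (hl : l.length ≤ 1) :
    ∃ R : List K.Face, B.SumAbove j w (l ++ R) := by
  obtain ⟨R, _, hR⟩ := h.exists_lower fun a ha => by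
    match l, hl, h with
    | [], _, _ => exact Nat.zero_le _
    | [b], _, h => simpa using h.atom_le ha (-1)
  exact ⟨R, hR⟩

/-- Atoms of dimension `j + 1` do not contribute above that dimension. -/
theorem SumAbove.of_lower {j : ℕ} {w : K.Cell} {l R : List K.Face} (h : B.SumAbove j w (l ++ R))
    (hl : ∀ b ∈ l, j + 1 < K.dim b) (hR : ∀ b ∈ R, K.dim b = j + 1) : B.SumAbove (j + 1) w l :=
  ⟨hl, fun α a ha => by
    rw [h.coeff_eq α a (by omega), total_append,
      B.total_of_dim_le (l := R) (fun b hb => by rw [hR b hb]; omega) α,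
      List.count_eq_zero_of_not_mem (fun hm => by have := hR a hm; omega), add_zero]⟩

/-- A cell which is an atom above dimension `0` is an atom, because `x_0^-` and `x_0^+` are single
vertices; likewise for a cell of dimension `0`. -/
theorem SumAbove.eq_atom {w : K.Cell} {l : List K.Face} (h : B.SumAbove 0 w l)
    (hl : l.length ≤ 1) : ∃ b, w = B.atom b := by
  match l, hl, h with
  | [b], _, h =>
    refine ⟨b, (cell_ext fun α a => ?_).symm⟩
    rcases Nat.eq_zero_or_pos (K.dim a) with ha | ha
    · have e := (Finset.sum_eq_sum_iff_of_le (s := Finset.univ.filter fun a => K.dim a = 0)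
        (f := (B.atom b).coeff α) (g := w.coeff α)
        (fun a ha => h.atom_le (Finset.mem_filter.1 ha).2 α)).1 (by rw [w.aug, (B.atom b).aug])
      exact e a (Finset.mem_filter.2 ⟨Finset.mem_univ _, ha⟩)
    · simpa using (h.coeff_eq α a ha).symm
  | [], _, h =>
    have hj : ∀ a, K.dim a = 0 → w.coeff 1 a = w.coeff (-1) a := fun a ha => by
      have := h.jump ha
      simp only [total_nil] at this
      omega
    obtain ⟨b, hb, hb'⟩ := Finset.exists_ne_zero_of_sum_ne_zero
      (s := Finset.univ.filter fun a => K.dim a = 0) (f := w.coeff (-1))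
      (by rw [w.aug]; exact one_ne_zero)
    have hb := (Finset.mem_filter.1 hb).2
    have hdim : K.dim b = 0 := hb
    refine ⟨b, cell_ext fun α a => ?_⟩
    rcases Nat.eq_zero_or_pos (K.dim a) with ha | ha
    · rw [B.coeff_of_dim_le α (by omega)]
      have hα : w.coeff α a = w.coeff (-1) a := by
        rcases Int.units_eq_one_or α with rfl | rfl
        · exact hj a ha
        · rfl
      rw [hα]
      have e := Finset.add_sum_erase (Finset.univ.filter fun a => K.dim a = 0) (w.coeff (-1))
        (Finset.mem_filter.2 ⟨Finset.mem_univ _, hdim⟩)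
      rw [w.aug] at e
      split_ifs with hab
      · subst hab; omega
      · have := Finset.single_le_sum (f := w.coeff (-1))
          (s := (Finset.univ.filter fun a => K.dim a = 0).erase b) (fun _ _ => Nat.zero_le _)
          (Finset.mem_erase.2 ⟨hab, Finset.mem_filter.2 ⟨Finset.mem_univ _, ha⟩⟩)
        omega
    · rw [B.coeff_of_dim_le α (by omega), h.coeff_eq α a ha, if_neg (by rintro rfl; omega)]
      rfl

/-- Induction on cells: a property of atoms which is inherited by the composites along dimensions
up to `j` holds for all cells which are sums of atoms above dimension `j`; if there is at most one
atom then dimensions below `j` suffice. -/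
theorem SumAbove.induction_aux {P : K.Cell → Prop} (hatom : ∀ a, P (B.atom a)) (j : ℕ) :
    ((∀ p < j, ∀ u v h, P u → P v → P (K.cellComp p u v h)) →
      ∀ (l : List K.Face) (w : K.Cell), l.length ≤ 1 → B.SumAbove j w l → P w) ∧
    ((∀ p ≤ j, ∀ u v h, P u → P v → P (K.cellComp p u v h)) →
      ∀ (l : List K.Face) (w : K.Cell), B.SumAbove j w l → P w) := by
  have full : ∀ j, ((∀ p < j, ∀ u v h, P u → P v → P (K.cellComp p u v h)) →
      ∀ (l : List K.Face) (w : K.Cell), l.length ≤ 1 → B.SumAbove j w l → P w) →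
      ((∀ p ≤ j, ∀ u v h, P u → P v → P (K.cellComp p u v h)) →
        ∀ (l : List K.Face) (w : K.Cell), B.SumAbove j w l → P w) := by
    intro j hone hP l
    induction hn : l.length using Nat.strong_induction_on generalizing l with
    | _ n ih =>
    intro w h
    by_cases hl : l.length ≤ 1
    · exact hone (fun p hp => hP p hp.le) l w hl h
    · obtain ⟨b, hb, hmin⟩ : ∃ b ∈ l, ∀ c ∈ l, B.ht b ≤ B.ht c := by
        obtain ⟨b, hb, hmin⟩ := l.toFinset.exists_min_image B.ht
          (List.toFinset_nonempty_iff _ |>.2 (by rintro rfl; simp at hl))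
        exact ⟨b, List.mem_toFinset.1 hb, fun c hc => hmin c (List.mem_toFinset.2 hc)⟩
      have hlen := List.length_erase_of_mem hb
      obtain ⟨u, v, huv, rfl, hu, hv⟩ := (h.perm (List.perm_cons_erase hb)).exists_cut
        (l := [b]) (l' := l.erase b) (fun c hc c' hc' => by
          rw [List.mem_singleton.1 hc]; exact hmin c' (List.mem_of_mem_erase hc'))
      exact hP j le_rfl u v huv (ih 1 (by omega) [b] rfl u hu)
        (ih _ (by omega) (l.erase b) rfl v hv)
  have one : ∀ j, ((∀ p < j, ∀ u v h, P u → P v → P (K.cellComp p u v h)) →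
      ∀ (l : List K.Face) (w : K.Cell), l.length ≤ 1 → B.SumAbove j w l → P w) := by
    intro j
    induction j with
    | zero =>
      intro _ l w hl h
      obtain ⟨b, rfl⟩ := h.eq_atom hl
      exact hatom b
    | succ j ih =>
      intro hP l w hl h
      obtain ⟨R, hR⟩ := h.exists_lower_of_length_le_one hl
      exact full j ih (fun p hp => hP p (Nat.lt_succ_of_le hp)) _ w hR
  exact ⟨one j, full j (one j)⟩

/-- Every cell is a composite of atoms. -/
theorem cell_induction (B : K.OrientedBasis L) {P : K.Cell → Prop} (hatom : ∀ a, P (B.atom a))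
    (hcomp : ∀ p u v h, P u → P v → P (K.cellComp p u v h)) (w : K.Cell) : P w :=
  (SumAbove.induction_aux hatom (Finset.univ.sup K.dim)).2 (fun p _ => hcomp p) [] w
    ⟨fun _ h => absurd h List.not_mem_nil,
      fun _ a ha => absurd (Finset.le_sup (Finset.mem_univ a)) (not_le_of_gt ha)⟩

end OrientedBasis

end FaceSystem

namespace OmegaCat

/-! ### Composites without sources and targets -/

/-- The elements obtained from a set of elements by composition alone, without taking sources and
targets of composites. -/
inductive Composite (C : OmegaCat.{u}) (S : Set C.carrier) : C.carrier → Prop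
  | of (x : C.carrier) : x ∈ S → Composite C S x
  | comp (n : ℕ) (x y : C.carrier) (h : C.d 1 n x = C.d (-1) n y) :
      Composite C S x → Composite C S y → Composite C S (C.comp n x y h)

variable {C : OmegaCat.{u}}

theorem dim_d_le (α : ℤˣ) (n : ℕ) (x : C.carrier) : C.dim (C.d α n x) ≤ n :=
  (C.dim_le_iff _ _ α).2 (C.d_d_le _ _ _ _ _ le_rfl)

theorem comp_of_dim_right {n : ℕ} {x y : C.carrier} (h : C.d 1 n x = C.d (-1) n y)
    (hy : C.dim y ≤ n) : C.comp n x y h = x := by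
  have e : y = C.d 1 n x := by rw [h, C.d_of_dim_le hy]
  rw [C.comp_congr h rfl e, C.tgt_unit]

theorem comp_of_dim_left {n : ℕ} {x y : C.carrier} (h : C.d 1 n x = C.d (-1) n y)
    (hx : C.dim x ≤ n) : C.comp n x y h = y := by
  have e : x = C.d (-1) n y := by rw [← h, C.d_of_dim_le hx]
  rw [C.comp_congr h e rfl, C.src_unit]

theorem dim_comp_le {n p : ℕ} {x y : C.carrier} (h : C.d 1 n x = C.d (-1) n y) (hx : C.dim x ≤ p)
    (hy : C.dim y ≤ p) : C.dim (C.comp n x y h) ≤ p := by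
  rcases lt_or_ge n p with hn | hn
  · rw [C.dim_le_iff _ _ 1]
    obtain ⟨h', e⟩ := C.d_comp 1 p n x y h (by omega)
    rw [e]
    exact C.comp_congr h' (C.d_of_dim_le hx 1) (C.d_of_dim_le hy 1)
  · rwa [comp_of_dim_right h (hy.trans hn)]

theorem d_comp_eq_left {m n : ℕ} (hmn : m < n) (α : ℤˣ) {x y : C.carrier}
    (h : C.d 1 n x = C.d (-1) n y) : C.d α m (C.comp n x y h) = C.d α m x := by
  rw [← C.d_d_lt α (-1) m n _ hmn, C.src_comp, C.d_d_lt _ _ _ _ _ hmn]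

theorem d_comp_eq_right {m n : ℕ} (hmn : m < n) (α : ℤˣ) {x y : C.carrier}
    (h : C.d 1 n x = C.d (-1) n y) : C.d α m (C.comp n x y h) = C.d α m y := by
  rw [← C.d_d_lt α 1 m n _ hmn, C.tgt_comp, C.d_d_lt _ _ _ _ _ hmn]

theorem exists_interchange {m n : ℕ} (hmn : m < n) (x y z w : C.carrier)
    (h₁ : C.d 1 n x = C.d (-1) n y) (h₂ : C.d 1 n z = C.d (-1) n w)
    (h₃ : C.d 1 m (C.comp n x y h₁) = C.d (-1) m (C.comp n z w h₂)) :
    ∃ (h₄ : C.d 1 m x = C.d (-1) m z) (h₅ : C.d 1 m y = C.d (-1) m w)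
      (h₆ : C.d 1 n (C.comp m x z h₄) = C.d (-1) n (C.comp m y w h₅)),
      C.comp m (C.comp n x y h₁) (C.comp n z w h₂) h₃ =
        C.comp n (C.comp m x z h₄) (C.comp m y w h₅) h₆ := by
  have h₄ : C.d 1 m x = C.d (-1) m z := by
    rw [d_comp_eq_left hmn, d_comp_eq_left hmn] at h₃; exact h₃
  have h₅ : C.d 1 m y = C.d (-1) m w := by
    rw [d_comp_eq_right hmn, d_comp_eq_right hmn] at h₃; exact h₃
  have h₆ : C.d 1 n (C.comp m x z h₄) = C.d (-1) n (C.comp m y w h₅) := by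
    obtain ⟨_, e⟩ := C.d_comp 1 n m x z h₄ (by omega)
    obtain ⟨_, e'⟩ := C.d_comp (-1) n m y w h₅ (by omega)
    rw [e, e']
    exact C.comp_congr _ h₁ h₂
  exact ⟨h₄, h₅, h₆, C.interchange m n x y z w (by omega) h₁ h₂ h₃ h₄ h₅ h₆⟩

/-- A composite along a small dimension `m` is a composite along a larger dimension `n`, in which
the two factors are executed one after the other, the first one first. -/
theorem exists_comp_eq_left_first {m n : ℕ} (hmn : m < n) (x y : C.carrier)
    (h : C.d 1 m x = C.d (-1) m y) :
    ∃ (h₁ : C.d 1 m x = C.d (-1) m (C.d (-1) n y)) (h₂ : C.d 1 m (C.d 1 n x) = C.d (-1) m y) (h₃ : _),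
      C.comp m x y h = C.comp n (C.comp m x (C.d (-1) n y) h₁) (C.comp m (C.d 1 n x) y h₂) h₃ := by
  have hx : C.d 1 n x = C.d (-1) n (C.d 1 n x) := (C.d_d_le _ _ _ _ _ le_rfl).symm
  have hy : C.d 1 n (C.d (-1) n y) = C.d (-1) n y := C.d_d_le _ _ _ _ _ le_rfl
  have ex := C.tgt_unit n x hx
  have ey := C.src_unit n y hy
  obtain ⟨h₁, h₂, h₃, e⟩ := exists_interchange hmn x (C.d 1 n x) (C.d (-1) n y) y hx hy
    (by rw [ex, ey]; exact h)
  exact ⟨h₁, h₂, h₃, (C.comp_congr h ex.symm ey.symm).trans e⟩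

/-- A composite along a small dimension `m` is a composite along a larger dimension `n`, in which
the two factors are executed one after the other, the second one first. -/
theorem exists_comp_eq_right_first {m n : ℕ} (hmn : m < n) (x y : C.carrier)
    (h : C.d 1 m x = C.d (-1) m y) :
    ∃ (h₁ : C.d 1 m (C.d (-1) n x) = C.d (-1) m y) (h₂ : C.d 1 m x = C.d (-1) m (C.d 1 n y)) (h₃ : _),
      C.comp m x y h = C.comp n (C.comp m (C.d (-1) n x) y h₁) (C.comp m x (C.d 1 n y) h₂) h₃ := by
  have hx : C.d 1 n (C.d (-1) n x) = C.d (-1) n x := C.d_d_le _ _ _ _ _ le_rfl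
  have hy : C.d 1 n y = C.d (-1) n (C.d 1 n y) := (C.d_d_le _ _ _ _ _ le_rfl).symm
  have ex := C.src_unit n x hx
  have ey := C.tgt_unit n y hy
  obtain ⟨h₁, h₂, h₃, e⟩ := exists_interchange hmn (C.d (-1) n x) x y (C.d 1 n y) hx hy
    (by rw [ex, ey]; exact h)
  exact ⟨h₁, h₂, h₃, (C.comp_congr h ex.symm ey.symm).trans e⟩

end OmegaCat

namespace FaceSystem.OrientedBasis

open OmegaCat

variable {K : FaceSystem} {L : Type} [LinearOrder L] {B : K.OrientedBasis L}

/-! ### Indecomposability of atoms -/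

theorem SumAbove.exists_mono {j k : ℕ} {w : K.Cell} {l : List K.Face} (h : B.SumAbove j w l)
    (hl : l.length ≤ 1) (hjk : j ≤ k) : ∃ l' : List K.Face, l'.length ≤ 1 ∧ B.SumAbove k w l' := by
  match l, hl, h with
  | [], _, h =>
    exact ⟨[], Nat.zero_le _, fun _ hb => absurd hb List.not_mem_nil,
      fun α a ha => h.coeff_eq α a (by omega)⟩
  | [b], _, h =>
    rcases lt_or_ge k (K.dim b) with hb | hb
    · exact ⟨[b], le_rfl, fun c hc => by rwa [List.mem_singleton.1 hc],
        fun α a ha => h.coeff_eq α a (by omega)⟩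
    · refine ⟨[], Nat.zero_le _, fun _ hb => absurd hb List.not_mem_nil, fun α a ha => ?_⟩
      rw [h.coeff_eq α a (by omega), total_cons, B.coeff_of_dim_le α (by omega),
        if_neg (by rintro rfl; omega)]
      rfl

theorem SumAbove.nil_mono {j k : ℕ} {w : K.Cell} (h : B.SumAbove j w []) (hjk : j ≤ k) :
    B.SumAbove k w [] :=
  ⟨fun _ hb => absurd hb List.not_mem_nil, fun α a ha => h.coeff_eq α a (by omega)⟩

theorem sumAbove_nil_iff {j : ℕ} {w : K.Cell} :
    B.SumAbove j w [] ↔ ∀ α a, j < K.dim a → w.coeff α a = 0 :=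
  ⟨fun h α a ha => h.coeff_eq α a ha, fun h => ⟨fun _ hb => absurd hb List.not_mem_nil, h⟩⟩

theorem sumAbove_cellD {j n : ℕ} (h : n ≤ j) (α : ℤˣ) (w : K.Cell) :
    B.SumAbove j (K.cellD α n w) [] :=
  sumAbove_nil_iff.2 fun β a ha => by
    show (if K.dim a < n then _ else if K.dim a = n then _ else 0) = 0
    rw [if_neg (by omega), if_neg (by omega)]

theorem cellComp_coeff {n : ℕ} {u v : K.Cell} (h : K.cellD 1 n u = K.cellD (-1) n v) (α : ℤˣ)
    {a : K.Face} (ha : n < K.dim a) :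
    (K.cellComp n u v h).coeff α a = u.coeff α a + v.coeff α a := by
  show (if K.dim a < n then _ else if K.dim a = n then _ else _) = _
  rw [if_neg (by omega), if_neg (by omega)]

theorem SumAbove.comp {p j : ℕ} {u v : K.Cell} {l l' : List K.Face} (hu : B.SumAbove j u l)
    (hv : B.SumAbove j v l') (hp : p ≤ j) (h : K.cellD 1 p u = K.cellD (-1) p v) :
    B.SumAbove j (K.cellComp p u v h) (l ++ l') :=
  ⟨fun b hb => (List.mem_append.1 hb).elim (hu.lt_dim b) (hv.lt_dim b), fun α a ha => by
    rw [cellComp_coeff h α (by omega), hu.coeff_eq α a ha, hv.coeff_eq α a ha, total_append]⟩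

theorem sumAbove_atom (a : K.Face) (n : ℕ) :
    ∃ l : List K.Face, l.length ≤ 1 ∧ B.SumAbove n (B.atom a) l := by
  rcases lt_or_ge n (K.dim a) with h | h
  · exact ⟨[a], le_rfl, fun b hb => by rwa [List.mem_singleton.1 hb], fun α b _ => by simp⟩
  · refine ⟨[], Nat.zero_le _, sumAbove_nil_iff.2 fun α b hb => ?_⟩
    rw [B.coeff_of_dim_le α (by omega), if_neg (by rintro rfl; omega)]

/-- A part of an atom which does not contain its top face vanishes: going down in dimension, its
positive and negative parts agree, but those of the atom are disjoint. -/
theorem eq_zero_of_le_atom {j : ℕ} {b : K.Face} {v : K.Cell}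
    (hv : ∀ α a, j < K.dim a → v.coeff α a ≤ (B.atom b).coeff α a) (hb : v.coeff 1 b = 0)
    (c : K.Face) (hc : j < K.dim c) (α : ℤˣ) : v.coeff α c = 0 := by
  induction hk : K.dim b - K.dim c using Nat.strong_induction_on generalizing c α with
  | _ k ih =>
  have e : v.coeff 1 c = v.coeff (-1) c := by
    have := v.bdry 1 c
    rw [K.sum_inc_congr (g := fun _ => 0) (fun a ha => ?_)] at this
    · simp only [zero_mul, Finset.sum_const_zero] at this
      omega
    · rcases lt_or_ge (K.dim b) (K.dim a) with hab | hab
      · have := hv 1 a (by omega)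
        rw [B.coeff_of_dim_le 1 hab.le, if_neg (by rintro rfl; omega)] at this
        simp only [Nat.le_zero.1 this, Nat.cast_zero]
      · rw [ih _ (by omega) a (by omega) 1 rfl, Nat.cast_zero]
  have h₁ : v.coeff 1 c = 0 := by
    by_cases hcb : c = b
    · rw [hcb, hb]
    · have h₁ := hv 1 c hc
      have h₂ := hv (-1) c hc
      have := B.coeff_disjoint hcb
      omega
  rcases Int.units_eq_one_or α with rfl | rfl
  · exact h₁
  · rw [← e, h₁]

/-- If a composite is at most one atom above dimension `j` then it is concentrated in one of the
factors. -/
theorem SumAbove.split {p j : ℕ} {u v : K.Cell} {l : List K.Face}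
    {h : K.cellD 1 p u = K.cellD (-1) p v} (hw : B.SumAbove j (K.cellComp p u v h) l)
    (hl : l.length ≤ 1) (hp : p ≤ j) :
    (B.SumAbove j u l ∧ B.SumAbove j v []) ∨ (B.SumAbove j u [] ∧ B.SumAbove j v l) := by
  have hsum : ∀ α a, j < K.dim a → u.coeff α a + v.coeff α a = B.total l α a := fun α a ha => by
    rw [← hw.coeff_eq α a ha, cellComp_coeff h α (by omega)]
  match l, hl with
  | [], _ =>
    refine .inl ⟨sumAbove_nil_iff.2 fun α a ha => ?_, sumAbove_nil_iff.2 fun α a ha => ?_⟩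
    all_goals
      have := hsum α a ha
      simp only [total_nil] at this
      omega
  | [b], _ =>
    have hb := hw.lt_dim b List.mem_cons_self
    have hsum' : ∀ α a, j < K.dim a → u.coeff α a + v.coeff α a = (B.atom b).coeff α a :=
      fun α a ha => by simpa using hsum α a ha
    have h₁ := hsum' 1 b hb
    rw [B.coeff_self] at h₁
    rcases Nat.eq_zero_or_pos (v.coeff 1 b) with h₀ | h₀
    · have hz := eq_zero_of_le_atom (B := B) (v := v) (j := j) (b := b)
        (fun α a ha => by have := hsum' α a ha; omega) h₀
      exact .inl ⟨⟨hw.lt_dim, fun α a ha => by rw [← hsum α a ha, hz a ha α, add_zero]⟩,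
        sumAbove_nil_iff.2 fun α a ha => hz a ha α⟩
    · have hz := eq_zero_of_le_atom (B := B) (v := u) (j := j) (b := b)
        (fun α a ha => by have := hsum' α a ha; omega) (by omega)
      exact .inr ⟨sumAbove_nil_iff.2 fun α a ha => hz a ha α,
        ⟨hw.lt_dim, fun α a ha => by rw [← hsum α a ha, hz a ha α, zero_add]⟩⟩

theorem total_eq_sum (l : List K.Face) (α : ℤˣ) (a : K.Face) :
    B.total l α a = ∑ b : K.Face, l.count b * (B.atom b).coeff α a := by
  induction l with
  | nil => simp
  | cons c l ih =>
    simp only [total_cons, ih, List.count_cons, add_mul, Finset.sum_add_distrib, beq_iff_eq,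
      ite_mul, one_mul, zero_mul, Finset.sum_ite_eq, Finset.mem_univ, if_true]
    exact add_comm _ _

/-- The list of atoms is determined by the cell up to order, from the top dimension downwards. -/
theorem SumAbove.perm_of_eq {j : ℕ} {w : K.Cell} {l l' : List K.Face} (h : B.SumAbove j w l)
    (h' : B.SumAbove j w l') : l.Perm l' := by
  rw [List.perm_iff_count]
  have hN : ∀ a : K.Face, K.dim a ≤ Finset.univ.sup K.dim := fun a => Finset.le_sup (Finset.mem_univ a)
  intro a
  induction hk : Finset.univ.sup K.dim - K.dim a using Nat.strong_induction_on generalizing a with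
  | _ k ih =>
  rcases Nat.lt_or_ge j (K.dim a) with ha | ha
  · have e : B.total l 1 a = B.total l' 1 a := by rw [← h.coeff_eq 1 a ha, h'.coeff_eq 1 a ha]
    rw [total_eq_sum, total_eq_sum, ← Finset.add_sum_erase _ _ (Finset.mem_univ a),
      ← Finset.add_sum_erase (a := a) _ (fun b => l'.count b * _) (Finset.mem_univ a),
      B.coeff_self, mul_one, mul_one, Finset.sum_congr rfl (fun b hb => ?_)] at e
    · exact Nat.add_right_cancel e
    · by_cases hba : (B.atom b).coeff 1 a = 0
      · rw [hba, mul_zero, mul_zero]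
      · have hlt := B.dim_lt 1 b a hba (Finset.ne_of_mem_erase hb).symm
        have := hN b
        rw [ih _ (by omega) b rfl]
  · rw [List.count_eq_zero_of_not_mem fun hm => absurd (h.lt_dim a hm) (by omega),
      List.count_eq_zero_of_not_mem fun hm => absurd (h'.lt_dim a hm) (by omega)]

/-! ### Uniqueness of composites of atoms -/

/-- An ω-category `Q` which is generated under composition alone by elements `gen a` indexed by the
faces, together with an ω-functor to the cells which maps `gen a` to the atom of `a`. The dimension
of `gen a` is at most that of `a`. -/
structure Cover (B : K.OrientedBasis L) (Q : OmegaCat.{0}) where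
  map : Q ⟶ K.cellCat
  gen : K.Face → Q.carrier
  map_gen : ∀ a, app map (gen a) = B.atom a
  dim_gen : ∀ a, Q.dim (gen a) ≤ K.dim a
  composite : ∀ x, Q.Composite (Set.range gen) x

namespace Cover

variable {Q : OmegaCat.{0}} (F : B.Cover Q)

/-- The cell underlying an element. -/
def val (x : Q.carrier) : K.Cell := app F.map x

theorem val_d (α : ℤˣ) (n : ℕ) (x : Q.carrier) : F.val (Q.d α n x) = K.cellD α n (F.val x) :=
  app_d F.map α n x

theorem val_composable {n : ℕ} {x y : Q.carrier} (h : Q.d 1 n x = Q.d (-1) n y) :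
    K.cellD 1 n (F.val x) = K.cellD (-1) n (F.val y) := by rw [← val_d, ← val_d, h]

theorem val_comp {n : ℕ} {x y : Q.carrier} (h : Q.d 1 n x = Q.d (-1) n y) :
    F.val (Q.comp n x y h) = K.cellComp n (F.val x) (F.val y) (F.val_composable h) :=
  app_comp F.map n x y h (F.val_composable h)

theorem sumAbove_of_dim_le {p : ℕ} {x : Q.carrier} (h : Q.dim x ≤ p) : B.SumAbove p (F.val x) [] := by
  rw [← Q.d_of_dim_le h 1, val_d]
  exact sumAbove_cellD le_rfl _ _

/-- The ω-functor reflects dimension. -/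
theorem dim_le {p : ℕ} {x : Q.carrier} (h : B.SumAbove p (F.val x) []) : Q.dim x ≤ p := by
  induction F.composite x generalizing p with
  | of x hx =>
    obtain ⟨a, rfl⟩ := hx
    refine (F.dim_gen a).trans ?_
    by_contra hlt
    have h₁ := h.coeff_eq 1 a (by omega)
    have h₂ : F.val (F.gen a) = B.atom a := F.map_gen a
    rw [h₂, B.coeff_self] at h₁
    exact one_ne_zero h₁
  | comp n x y hxy _ _ ihx ihy =>
    have hs : B.SumAbove (max n p) (F.val x) [] ∧ B.SumAbove (max n p) (F.val y) [] := by
      have h' := h.nil_mono (le_max_right n p)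
      rw [F.val_comp] at h'
      rcases h'.split (Nat.zero_le _) (le_max_left n p) with h | h <;> exact h
    have hx := ihx hs.1
    have hy := ihy hs.2
    rcases lt_or_ge n p with hn | hn
    · rw [max_eq_right hn.le] at hx hy
      exact dim_comp_le hxy hx hy
    · rw [max_eq_left hn] at hy
      rw [comp_of_dim_right hxy hy] at h ⊢
      exact ihx h

/-- Only `gen b` lies over the atom of `b`, since one factor of a composite which is an atom has to be
an identity. -/
theorem eq_gen {x : Q.carrier} {b : K.Face} (h : F.val x = B.atom b) : x = F.gen b := by
  induction F.composite x with
  | of x hx =>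
    obtain ⟨a, rfl⟩ := hx
    exact congrArg F.gen (B.atom_injective ((F.map_gen a).symm.trans h))
  | comp n x y hxy _ _ ihx ihy =>
    obtain ⟨l, hl, hs⟩ := sumAbove_atom (B := B) b n
    have hs' := hs
    rw [← h, F.val_comp] at hs'
    rcases hs'.split hl le_rfl with hs' | hs'
    · rw [comp_of_dim_right hxy (F.dim_le hs'.2)] at h ⊢
      exact ihx h
    · rw [comp_of_dim_left hxy (F.dim_le hs'.1)] at h ⊢
      exact ihy h

/-- `Fac j l x`: the element `x` is a composite along dimension `j` whose successive factors are
single atoms above dimension `j`, namely those of the faces in the list `l`. -/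
inductive Fac (j : ℕ) : List K.Face → Q.carrier → Prop
  | nil (x : Q.carrier) : Q.dim x ≤ j → Fac j [] x
  | cons (b : K.Face) (l : List K.Face) (y z : Q.carrier) (h : Q.d 1 j y = Q.d (-1) j z) :
      B.SumAbove j (F.val y) [b] → Fac j l z → Fac j (b :: l) (Q.comp j y z h)

variable {F}

theorem Fac.sumAbove {j : ℕ} {l : List K.Face} {x : Q.carrier} (h : F.Fac j l x) :
    B.SumAbove j (F.val x) l := by
  induction h with
  | nil x h => exact F.sumAbove_of_dim_le h
  | cons b l y z h hy _ ih =>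
    rw [F.val_comp]
    exact hy.comp ih le_rfl _

theorem Fac.append {j : ℕ} {l m : List K.Face} {x y : Q.carrier} (hx : F.Fac j l x)
    (hy : F.Fac j m y) (h : Q.d 1 j x = Q.d (-1) j y) : F.Fac j (l ++ m) (Q.comp j x y h) := by
  induction hx with
  | nil x hx => rw [comp_of_dim_left h hx]; exact hy
  | cons b l u z huz hu _ ih =>
    have h₃ : Q.d 1 j z = Q.d (-1) j y := by rw [← h, Q.tgt_comp]
    have h₄ : Q.d 1 j u = Q.d (-1) j (Q.comp j z y h₃) := by rw [Q.src_comp, huz]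
    rw [Q.assoc j u z y huz h h₃ h₄]
    exact .cons b _ u _ h₄ hu (ih h₃)

theorem Fac.whisker_right {p j : ℕ} (hp : p < j) {l : List K.Face} {x c : Q.carrier}
    (hx : F.Fac j l x) (hc : Q.dim c ≤ j) (h : Q.d 1 p x = Q.d (-1) p c) :
    F.Fac j l (Q.comp p x c h) := by
  induction hx with
  | nil x hx => exact .nil _ (dim_comp_le h hx hc)
  | cons b l y z hyz hy _ ih =>
    have hcc : Q.d 1 j c = Q.d (-1) j c := by rw [Q.d_of_dim_le hc, Q.d_of_dim_le hc]
    have ec : Q.comp j c c hcc = c := comp_of_dim_right hcc hc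
    obtain ⟨h₄, h₅, h₆, e⟩ := exists_interchange hp y z c c hyz hcc (by rw [ec]; exact h)
    rw [Q.comp_congr h rfl ec.symm, e]
    refine .cons b l _ _ h₆ ?_ (ih h₅)
    rw [F.val_comp]
    exact hy.comp (F.sumAbove_of_dim_le hc) hp.le _

theorem Fac.whisker_left {p j : ℕ} (hp : p < j) {l : List K.Face} {x c : Q.carrier}
    (hx : F.Fac j l x) (hc : Q.dim c ≤ j) (h : Q.d 1 p c = Q.d (-1) p x) :
    F.Fac j l (Q.comp p c x h) := by
  induction hx with
  | nil x hx => exact .nil _ (dim_comp_le h hc hx)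
  | cons b l y z hyz hy _ ih =>
    have hcc : Q.d 1 j c = Q.d (-1) j c := by rw [Q.d_of_dim_le hc, Q.d_of_dim_le hc]
    have ec : Q.comp j c c hcc = c := comp_of_dim_right hcc hc
    obtain ⟨h₄, h₅, h₆, e⟩ := exists_interchange hp c c y z hcc hyz (by rw [ec]; exact h)
    rw [Q.comp_congr h ec.symm rfl, e]
    refine .cons b l _ _ h₆ ?_ (ih h₅)
    rw [F.val_comp]
    exact (F.sumAbove_of_dim_le hc).comp hy hp.le _

/-- An element which is at most one atom above dimension `j + 1` has a factorization along
dimension `j`: in a composite of generators, composites along larger dimensions are trivial, and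
those along smaller dimensions are whiskerings. -/
theorem exists_fac {j : ℕ} {x : Q.carrier} {l : List K.Face} (hl : l.length ≤ 1)
    (h : B.SumAbove (j + 1) (F.val x) l) : ∃ l', F.Fac j l' x := by
  induction F.composite x generalizing l with
  | of x hx =>
    obtain ⟨a, rfl⟩ := hx
    rcases lt_or_ge j (K.dim a) with ha | ha
    · have hu : Q.d 1 j (F.gen a) = Q.d (-1) j (Q.d 1 j (F.gen a)) :=
        (Q.d_d_le _ _ _ _ _ le_rfl).symm
      rw [← Q.tgt_unit j (F.gen a) hu]
      refine ⟨[a], .cons a [] _ _ hu ?_ (.nil _ (dim_d_le _ _ _))⟩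
      have e : F.val (F.gen a) = B.atom a := F.map_gen a
      rw [e]
      exact ⟨fun b hb => by rwa [List.mem_singleton.1 hb], fun α b _ => by simp⟩
    · exact ⟨[], .nil _ ((F.dim_gen a).trans ha)⟩
  | comp n x y hxy _ _ ihx ihy =>
    rcases lt_or_ge j n with hn | hn
    · obtain ⟨m, hm, hs⟩ := h.exists_mono hl (Nat.succ_le_of_lt hn)
      rw [F.val_comp] at hs
      rcases hs.split hm le_rfl with hs | hs
      · rw [comp_of_dim_right hxy (F.dim_le hs.2)] at h ⊢
        exact ihx hl h
      · rw [comp_of_dim_left hxy (F.dim_le hs.1)] at h ⊢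
        exact ihy hl h
    · rw [F.val_comp] at h
      obtain ⟨⟨m, hm⟩, ⟨m', hm'⟩⟩ : (∃ m, F.Fac j m x) ∧ (∃ m', F.Fac j m' y) := by
        rcases h.split hl (by omega) with hs | hs
        · exact ⟨ihx hl hs.1, ihy (Nat.zero_le _) hs.2⟩
        · exact ⟨ihx (Nat.zero_le _) hs.1, ihy hl hs.2⟩
      rcases lt_or_eq_of_le hn with hn | rfl
      · obtain ⟨h₁, h₂, h₃, e⟩ := exists_comp_eq_left_first hn x y hxy
        rw [e]
        exact ⟨m ++ m', (hm.whisker_right hn (dim_d_le _ _ _) h₁).append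
          (hm'.whisker_left hn (dim_d_le _ _ _) h₂) h₃⟩
      · exact ⟨m ++ m', hm.append hm' hxy⟩

variable (F)

/-- Elements whose cell is at most one atom above dimension `j` are determined by their cell. -/
def InjAbove (j : ℕ) : Prop :=
  ∀ (l : List K.Face) (x x' : Q.carrier), l.length ≤ 1 → B.SumAbove j (F.val x) l →
    F.val x = F.val x' → x = x'

variable {F}

theorem InjAbove.composable {j p : ℕ} (H : F.InjAbove j) (hp : p ≤ j) {x y : Q.carrier}
    (h : K.cellD 1 p (F.val x) = K.cellD (-1) p (F.val y)) : Q.d 1 p x = Q.d (-1) p y :=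
  H [] _ _ (Nat.zero_le _) (by rw [F.val_d]; exact sumAbove_cellD hp _ _)
    (by rw [F.val_d, F.val_d, h])

/-- Every cell lifts, as a composite of atoms along dimensions at most `j`. -/
theorem InjAbove.exists_lift {i j : ℕ} (H : F.InjAbove j) (hij : i ≤ j) {w : K.Cell}
    {l : List K.Face} (h : B.SumAbove i w l) : ∃ x, F.val x = w := by
  refine (SumAbove.induction_aux (B := B) (P := fun w => ∃ x, F.val x = w)
    (fun a => ⟨F.gen a, F.map_gen a⟩) i).2 ?_ l w h
  rintro p hp _ _ h ⟨x, rfl⟩ ⟨y, rfl⟩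
  exact ⟨Q.comp p x y (H.composable (hp.trans hij) h), F.val_comp _⟩

/-- Adjacent factors which are in the wrong order can be interchanged: the composite of the two
factors can be cut in the next lower dimension so that they are separated. -/
theorem InjAbove.swap {j : ℕ} (H : F.InjAbove j) {b c : K.Face} {y z : Q.carrier}
    (hyz : Q.d 1 j y = Q.d (-1) j z) (hy : B.SumAbove j (F.val y) [b])
    (hz : B.SumAbove j (F.val z) [c]) (hbc : B.ht c < B.ht b) :
    ∃ (z' y' : Q.carrier) (h : Q.d 1 j z' = Q.d (-1) j y'),
      B.SumAbove j (F.val z') [c] ∧ B.SumAbove j (F.val y') [b] ∧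
      Q.comp j y z hyz = Q.comp j z' y' h := by
  set w : K.Cell := F.val (Q.comp j y z hyz) with hw
  have hw' := F.val_comp hyz
  have hs : B.SumAbove j w [b, c] := by rw [hw, hw']; exact hy.comp hz le_rfl _
  have hle : ∀ a, K.dim a = j → B.total [b, c] (-1) a ≤ w.coeff (-1) a := by
    intro a ha
    have e₁ : w.coeff (-1) a = (F.val y).coeff (-1) a := by
      rw [hw, hw']; simp [cellComp, ha]
    have e₂ : (F.val y).coeff 1 a = (F.val z).coeff (-1) a :=
      (K.cellD_eq (F.val_composable hyz) 1 a).2 ha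
    have h₁ := hy.jump ha
    have h₂ := hy.atom_le ha (-1)
    have h₃ := hz.atom_le ha (-1)
    have h₄ : (B.atom b).coeff 1 a = 0 ∨ (B.atom c).coeff (-1) a = 0 := by
      by_contra! hne
      exact absurd ((B.ht_tgt b a hne.1).trans (B.ht_src c a hne.2)) (not_le_of_gt hbc)
    simp only [total_cons, total_nil, add_zero] at h₁ ⊢
    omega
  -- in dimension `0` two factors cannot be independent: `w` would contain two vertices
  obtain _ | i := j
  · have h₁ : ∑ a : K.Face with K.dim a = 0, B.total [b, c] (-1) a ≤
        ∑ a : K.Face with K.dim a = 0, w.coeff (-1) a :=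
      Finset.sum_le_sum fun a ha => hle a (Finset.mem_filter.1 ha).2
    rw [B.total_aug, w.aug] at h₁
    simp at h₁
  · obtain ⟨R, hRdim, hR⟩ := hs.exists_lower hle
    -- cut `w` along dimension `i` into a part with `c` and a part with `b`
    set lo := R.filter fun a => B.ht a ≤ B.ht c
    set hi := R.filter fun a => ¬ B.ht a ≤ B.ht c
    have hperm : ([b, c] ++ R).Perm ((c :: lo) ++ (b :: hi)) := by
      have h₁ : (lo ++ hi).Perm R := by
        have := List.filter_append_perm (fun a => decide (B.ht a ≤ B.ht c)) R
        simpa only [lo, hi, decide_not] using this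
      calc [b, c] ++ R = b :: c :: R := rfl
        _ |>.Perm (b :: c :: (lo ++ hi)) := (h₁.symm.cons _).cons _
        _ |>.Perm (b :: ((c :: lo) ++ hi)) := List.Perm.refl _
        _ |>.Perm ((c :: lo) ++ (b :: hi)) := List.perm_middle.symm
    obtain ⟨u, v, huv, e, hu, hv⟩ := (hR.perm hperm).exists_cut (by
      intro a ha a' ha'
      have h₁ : B.ht a ≤ B.ht c := by
        rcases List.mem_cons.1 ha with rfl | ha
        · exact le_rfl
        · simpa using (List.mem_filter.1 ha).2
      have h₂ : B.ht c ≤ B.ht a' := by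
        rcases List.mem_cons.1 ha' with rfl | ha'
        · exact hbc.le
        · simpa using le_of_lt (by simpa using (List.mem_filter.1 ha').2 : B.ht c < B.ht a')
      exact h₁.trans h₂)
    obtain ⟨x, rfl⟩ := H.exists_lift (Nat.le_succ i) hu
    obtain ⟨t, rfl⟩ := H.exists_lift (Nat.le_succ i) hv
    have hxt : Q.d 1 i x = Q.d (-1) i t := H.composable (Nat.le_succ i) huv
    have hx : B.SumAbove (i + 1) (F.val x) [c] := SumAbove.of_lower (l := [c]) hu hz.lt_dim
      fun a ha => hRdim a (List.mem_of_mem_filter ha)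
    have ht : B.SumAbove (i + 1) (F.val t) [b] := SumAbove.of_lower (l := [b]) hv hy.lt_dim
      fun a ha => hRdim a (List.mem_of_mem_filter ha)
    obtain ⟨h₁, h₂, h₃, e₁⟩ := exists_comp_eq_right_first (Nat.lt_succ_self i) x t hxt
    obtain ⟨k₁, k₂, k₃, e₂⟩ := exists_comp_eq_left_first (Nat.lt_succ_self i) x t hxt
    have hd : ∀ (α) (x : Q.carrier), B.SumAbove (i + 1) (F.val (Q.d α (i + 1) x)) [] := fun α x => by
      rw [F.val_d]; exact sumAbove_cellD le_rfl _ _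
    have hsy : B.SumAbove (i + 1) (F.val (Q.comp i (Q.d (-1) (i + 1) x) t h₁)) [b] := by
      rw [F.val_comp]; exact (hd _ _).comp ht (Nat.le_succ i) _
    have hsz : B.SumAbove (i + 1) (F.val (Q.comp i x (Q.d 1 (i + 1) t) h₂)) [c] := by
      rw [F.val_comp]; exact hx.comp (hd _ _) (Nat.le_succ i) _
    have hyz' := (F.val_comp hyz).symm.trans (e.trans (F.val_comp hxt).symm)
    rw [e₁, F.val_comp h₃] at hyz'
    obtain ⟨ey, ez⟩ := cellComp_cancel hyz'
      (fun α a ha => by rw [hy.coeff_eq α a ha, hsy.coeff_eq α a ha])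
    have ey := H [b] _ _ le_rfl hy ey
    have ez := H [c] _ _ le_rfl hz ez
    refine ⟨_, _, k₃, ?_, ?_, ?_⟩
    · rw [F.val_comp]; exact hx.comp (hd _ _) (Nat.le_succ i) _
    · rw [F.val_comp]; exact (hd _ _).comp ht (Nat.le_succ i) _
    · rw [← e₂, e₁]; exact Q.comp_congr hyz ey ez

theorem InjAbove.fac_orderedInsert {j : ℕ} (H : F.InjAbove j) {b : K.Face} {l : List K.Face}
    {x : Q.carrier} (h : F.Fac j (b :: l) x) :
    F.Fac j (l.orderedInsert (fun a a' => B.ht a ≤ B.ht a') b) x := by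
  induction l generalizing x with
  | nil => exact h
  | cons c l ih =>
    by_cases hbc : B.ht b ≤ B.ht c
    · rwa [List.orderedInsert_cons, if_pos hbc]
    · rw [List.orderedInsert_cons, if_neg hbc]
      cases h with
      | cons _ _ y z hyz hy hz =>
      cases hz with
      | cons _ _ t s hts ht hs =>
      have h₁ : Q.d 1 j y = Q.d (-1) j t := by rw [hyz, Q.src_comp]
      have h₂ : Q.d 1 j (Q.comp j y t h₁) = Q.d (-1) j s := by rw [Q.tgt_comp, hts]
      rw [← Q.assoc j y t s h₁ h₂ hts hyz]
      obtain ⟨t', y', h', ht', hy', e⟩ := H.swap h₁ hy ht (not_le.1 hbc)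
      rw [Q.comp_congr h₂ e rfl]
      have h₃ : Q.d 1 j y' = Q.d (-1) j s := by rw [← h₂, e, Q.tgt_comp]
      have h₄ : Q.d 1 j t' = Q.d (-1) j (Q.comp j y' s h₃) := by rw [Q.src_comp, h']
      rw [Q.assoc j t' y' s h' _ h₃ h₄]
      exact .cons c _ t' _ h₄ ht' (ih (.cons b l y' s h₃ hy' hs))

theorem InjAbove.fac_insertionSort {j : ℕ} (H : F.InjAbove j) {l : List K.Face} {x : Q.carrier}
    (h : F.Fac j l x) : F.Fac j (l.insertionSort fun a a' => B.ht a ≤ B.ht a') x := by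
  induction h with
  | nil x hx => exact .nil x hx
  | cons b l y z h hy _ ih =>
    rw [List.insertionSort_cons]
    exact H.fac_orderedInsert (.cons b _ y z h hy ih)

/-- Elements over the same cell with factorizations in the same order are equal. -/
theorem InjAbove.fac_unique {j : ℕ} (H : F.InjAbove j) {l : List K.Face} {x x' : Q.carrier}
    (h : F.Fac j l x) (h' : F.Fac j l x') (e : F.val x = F.val x') : x = x' := by
  induction h generalizing x' with
  | nil x hx => exact H [] _ _ (Nat.zero_le _) (F.sumAbove_of_dim_le hx) e
  | cons b l y z h hy _ ih =>
    cases h' with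
    | cons _ _ y' z' h' hy' hz' =>
    rw [F.val_comp, F.val_comp] at e
    obtain ⟨ey, ez⟩ := cellComp_cancel e
      (fun α a ha => by rw [hy.coeff_eq α a ha, hy'.coeff_eq α a ha])
    exact Q.comp_congr h (H [b] _ _ le_rfl hy ey) (ih hz' ez)

variable (F)

/-- For the induction step, sorted factorizations along dimension `j` of two elements over the same cell
have the same atoms in the same order. -/
theorem injAbove (j : ℕ) : F.InjAbove j := by
  induction j with
  | zero =>
    intro l x x' hl h e
    obtain ⟨b, hb⟩ := h.eq_atom hl
    exact (F.eq_gen hb).trans (F.eq_gen (e ▸ hb)).symm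
  | succ j H =>
    intro l x x' hl h e
    obtain ⟨m, hm⟩ := F.exists_fac hl h
    obtain ⟨m', hm'⟩ := F.exists_fac hl (e ▸ h)
    have hs := H.fac_insertionSort hm
    have hs' := H.fac_insertionSort hm'
    have hp := hs.sumAbove.perm_of_eq (e ▸ hs'.sumAbove)
    have : Std.Total fun a a' => B.ht a ≤ B.ht a' := ⟨fun a a' => le_total _ _⟩
    have : IsTrans K.Face fun a a' => B.ht a ≤ B.ht a' := ⟨fun _ _ _ => le_trans⟩
    have : Std.Antisymm fun a a' => B.ht a ≤ B.ht a' :=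
      ⟨fun _ _ h h' => B.ht_injective (le_antisymm h h')⟩
    rw [← hp.eq_of_pairwise' (List.pairwise_insertionSort _ _) (List.pairwise_insertionSort _ _)] at hs'
    exact H.fac_unique hs hs' e

/-- The ω-functor of a cover is injective: composites of atoms which are equal as cells are equal in
every cover. -/
theorem val_injective : Function.Injective F.val := fun x x' e =>
  F.injAbove (Finset.univ.sup K.dim) [] x x' (Nat.zero_le _)
    (sumAbove_nil_iff.2 fun _ a ha => absurd (Finset.le_sup (Finset.mem_univ a)) (not_le_of_gt ha)) e

end Cover

end FaceSystem.OrientedBasis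

/-! ### The bases of the cube and of the simplex -/

section CubeBasis

variable {n : ℕ}

theorem zerosBefore_congr {a b : Fin n → SignType} {j : Fin n} (h : ∀ k < j, a k = b k) :
    zerosBefore a j = zerosBefore b j := by
  unfold zerosBefore
  congr 1
  exact Finset.filter_congr fun k _ => and_congr_right fun hk => by rw [h k hk]

/-- The linear order on the faces of the cube: words are compared lexicographically, where the order
`- < 0 < +` of the letters is reversed after an odd number of zeros. -/
def cubeHt (a : Fin n → SignType) : Lex (Fin n → SignType) :=
  toLex fun j => if Even (zerosBefore a j) then a j else -a j

theorem exists_first_ne {a b : Fin n → SignType} (h : a ≠ b) :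
    ∃ j, a j ≠ b j ∧ ∀ k < j, a k = b k := by
  obtain ⟨j, hj, hmin⟩ := (Finset.univ.filter fun j => a j ≠ b j).exists_min_image id (by
    obtain ⟨j, hj⟩ := Function.ne_iff.1 h
    exact ⟨j, by simpa using hj⟩)
  refine ⟨j, (Finset.mem_filter.1 hj).2, fun k hk => ?_⟩
  by_contra hne
  exact absurd (hmin k (Finset.mem_filter.2 ⟨Finset.mem_univ _, hne⟩)) (not_le_of_gt hk)

theorem cubeHt_apply_congr {a b : Fin n → SignType} {j : Fin n} (h : ∀ k < j, a k = b k)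
    {k : Fin n} (hk : k < j) : cubeHt a k = cubeHt b k := by
  show (if Even (zerosBefore a k) then a k else -a k) = if Even (zerosBefore b k) then b k else -b k
  rw [zerosBefore_congr fun i hi => h i (hi.trans hk), h k hk]

theorem cubeHt_injective : Function.Injective (cubeHt (n := n)) := by
  intro a b h
  by_contra hne
  obtain ⟨j, hj, hlt⟩ := exists_first_ne hne
  have e : (if Even (zerosBefore a j) then a j else -a j) =
      if Even (zerosBefore b j) then b j else -b j := congrFun h j
  rw [zerosBefore_congr hlt] at e
  split_ifs at e
  · exact hj e
  · exact hj (neg_injective e)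

/-- A face of the part of sign `α` of the atom of `a`, compared with `a` at the first letter where they
differ, has the sign `α` there after the twist in `cubeHt`, whereas `a` has a zero. -/
theorem InCubeAtom.exists_first {α : ℤˣ} {a b : Fin n → SignType} (h : InCubeAtom α a b)
    (hne : b ≠ a) : ∃ j, (∀ k < j, cubeHt b k = cubeHt a k) ∧ cubeHt a j = 0 ∧
      (cubeHt b j : ℤ) = (α : ℤ) := by
  obtain ⟨j, hj, hlt⟩ := exists_first_ne hne
  have ha : a j = 0 := by
    by_contra h₀
    exact hj (h.1 j h₀)
  have hb := h.2 j ha (fun h₀ => hj (h₀.trans ha.symm))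
  refine ⟨j, fun k hk => cubeHt_apply_congr hlt hk, ?_, ?_⟩
  · show (if Even (zerosBefore a j) then a j else -a j) = 0
    rw [ha]; simp
  · show ((if Even (zerosBefore b j) then b j else -b j : SignType) : ℤ) = α
    split_ifs with he
    · rw [hb, he.neg_one_pow, mul_one]
    · rw [SignType.coe_neg, hb, (Nat.not_even_iff_odd.1 he).neg_one_pow]; simp

theorem InCubeAtom.ht_src {a b : Fin n → SignType} (h : InCubeAtom (-1) a b) :
    cubeHt b ≤ cubeHt a := by
  by_cases hne : b = a
  · rw [hne]
  · obtain ⟨j, h₁, h₂, h₃⟩ := h.exists_first hne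
    refine le_of_lt ⟨j, h₁, ?_⟩
    show cubeHt b j < cubeHt a j
    rw [h₂]
    revert h₃
    generalize cubeHt b j = s
    cases s <;> decide

theorem InCubeAtom.ht_tgt {a b : Fin n → SignType} (h : InCubeAtom 1 a b) :
    cubeHt a ≤ cubeHt b := by
  by_cases hne : b = a
  · rw [hne]
  · obtain ⟨j, h₁, h₂, h₃⟩ := h.exists_first hne
    refine le_of_lt ⟨j, fun k hk => (h₁ k hk).symm, ?_⟩
    show cubeHt a j < cubeHt b j
    rw [h₂]
    revert h₃
    generalize cubeHt b j = s
    cases s <;> decide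

theorem InCubeAtom.dim_lt {α : ℤˣ} {a b : Fin n → SignType} (h : InCubeAtom α a b) (hne : b ≠ a) :
    (cubeFaces n).dim b < (cubeFaces n).dim a := by
  show (Finset.univ.filter fun j => b j = 0).card < (Finset.univ.filter fun j => a j = 0).card
  refine Finset.card_lt_card ((Finset.ssubset_iff_of_subset fun j hj => ?_).2 ?_)
  · by_contra ha
    simp only [Finset.mem_filter, Finset.mem_univ, true_and] at hj ha
    exact ha ((h.1 j ha).symm.trans hj)
  · obtain ⟨j, hj⟩ := Function.ne_iff.1 hne
    have ha : a j = 0 := by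
      by_contra h₀
      exact hj (h.1 j h₀)
    exact ⟨j, by simpa using ha, by simpa using fun hb => hj (hb.trans ha.symm)⟩

theorem cubeAtom_coeff (α : ℤˣ) (a b : Fin n → SignType) :
    (cubeAtom a).coeff α b = if InCubeAtom α a b then 1 else 0 := rfl

theorem cubeAtom_coeff_ne_zero {α : ℤˣ} {a b : Fin n → SignType} :
    (cubeAtom a).coeff α b ≠ 0 ↔ InCubeAtom α a b := by
  rw [cubeAtom_coeff]; simp

/-- The atoms of the cube. -/
def cubeBasis (n : ℕ) : (cubeFaces n).OrientedBasis (Lex (Fin n → SignType)) where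
  atom := cubeAtom
  ht := cubeHt
  ht_injective := cubeHt_injective
  coeff_self α a := if_pos (inCubeAtom_self α a)
  dim_lt _ _ _ h := (cubeAtom_coeff_ne_zero.1 h).dim_lt
  ht_src _ _ h := (cubeAtom_coeff_ne_zero.1 h).ht_src
  ht_tgt _ _ h := (cubeAtom_coeff_ne_zero.1 h).ht_tgt

theorem faceMap_eq_zero {σ : (simplexFaces n).Face} {j : Fin (n + 1)} :
    faceMap n σ j = 0 ↔ j ∈ σ.1 := by
  unfold faceMap; split_ifs with h <;> simp [h]

theorem faceMap_of_notMem {σ : (simplexFaces n).Face} {j : Fin (n + 1)} (h : j ∉ σ.1) :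
    faceMap n σ j = -1 := if_neg h

theorem zerosBefore_faceMap (σ : (simplexFaces n).Face) (j : Fin (n + 1)) :
    zerosBefore (faceMap n σ) j = (σ.1.filter fun u => u < j).card := by
  unfold zerosBefore
  congr 1
  ext k
  simp [faceMap_eq_zero, and_comm]

theorem faceMap_injective : Function.Injective (faceMap n) := fun σ τ h =>
  Subtype.ext (Finset.ext fun j => by rw [← faceMap_eq_zero, h, faceMap_eq_zero])

theorem dim_faceMap (σ : (simplexFaces n).Face) :
    (cubeFaces (n + 1)).dim (faceMap n σ) = (simplexFaces n).dim σ + 1 := by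
  have h : Finset.univ.filter (fun j => faceMap n σ j = 0) = σ.1 := by
    ext j; simp [faceMap_eq_zero]
  have := σ.2.card_pos
  show (Finset.univ.filter (fun j => faceMap n σ j = 0)).card = σ.1.card - 1 + 1
  rw [h]
  omega

/-- The sign conventions of the cube and of the simplex agree. -/
theorem neg_one_eq_sign_iff (α : ℤˣ) (m : ℕ) :
    ((-1 : SignType) : ℤ) = ((α * (-1) ^ m : ℤˣ) : ℤ) ↔ (-1) ^ (m + 1) = α := by
  rw [pow_succ]
  rcases neg_one_pow_eq_or ℤˣ m with e | e <;> rw [e] <;>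
  rcases Int.units_eq_one_or α with rfl | rfl <;> decide

theorem inCubeAtom_faceMap (α : ℤˣ) (σ τ : (simplexFaces n).Face) :
    InCubeAtom α (faceMap n σ) (faceMap n τ) ↔ InSimplexAtom α σ.1 τ.1 := by
  unfold InCubeAtom InSimplexAtom simplexSign
  refine and_congr ⟨fun h j hj => ?_, fun h j hj => ?_⟩ ⟨fun h j hj => ?_, fun h j hj hj' => ?_⟩
  · by_contra hσ
    have := h j (fun h₀ => hσ (faceMap_eq_zero.1 h₀))
    rw [faceMap_eq_zero.2 hj, faceMap_of_notMem hσ] at this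
    exact absurd this (by decide)
  · have hσ : j ∉ σ.1 := fun h₀ => hj (faceMap_eq_zero.2 h₀)
    rw [faceMap_of_notMem hσ, faceMap_of_notMem fun hτ => hσ (h hτ)]
  · obtain ⟨hσ, hτ⟩ := Finset.mem_sdiff.1 hj
    have := h j (faceMap_eq_zero.2 hσ) (fun h₀ => hτ (faceMap_eq_zero.1 h₀))
    rw [faceMap_of_notMem hτ, zerosBefore_faceMap] at this
    exact (neg_one_eq_sign_iff _ _).1 this
  · have hτ : j ∉ τ.1 := fun h₀ => hj' (faceMap_eq_zero.2 h₀)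
    rw [faceMap_of_notMem hτ, zerosBefore_faceMap]
    exact (neg_one_eq_sign_iff _ _).2 (h j (Finset.mem_sdiff.2 ⟨faceMap_eq_zero.1 hj, hτ⟩))

/-- The atoms of the simplex are restrictions of atoms of the cube. -/
theorem simplexAtom_coeff (α : ℤˣ) (σ τ : (simplexFaces n).Face) :
    (simplexAtom σ).coeff α τ = (cubeAtom (faceMap n σ)).coeff α (faceMap n τ) :=
  if_congr (inCubeAtom_faceMap α σ τ).symm rfl rfl

/-- The atoms of the simplex; the linear order is the one of the cube. -/
def simplexBasis (n : ℕ) : (simplexFaces n).OrientedBasis (Lex (Fin (n + 1) → SignType)) where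
  atom := simplexAtom
  ht σ := cubeHt (faceMap n σ)
  ht_injective := cubeHt_injective.comp faceMap_injective
  coeff_self α σ := by rw [simplexAtom_coeff]; exact (cubeBasis (n + 1)).coeff_self α _
  dim_lt α σ τ h hne := by
    rw [simplexAtom_coeff] at h
    have := (cubeBasis (n + 1)).dim_lt α _ _ h (fun e => hne (faceMap_injective e))
    rw [dim_faceMap, dim_faceMap] at this
    omega
  ht_src σ τ h := (cubeBasis (n + 1)).ht_src _ _ (by rw [simplexAtom_coeff] at h; exact h)
  ht_tgt σ τ h := (cubeBasis (n + 1)).ht_tgt _ _ (by rw [simplexAtom_coeff] at h; exact h)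

end CubeBasis

namespace OmegaCat

/-! ### The universal property of the negative semi-path ω-category -/

theorem app_composable {C D : OmegaCat.{u}} (F : C ⟶ D) {n : ℕ} {x y : C.carrier}
    (h : C.d 1 n x = C.d (-1) n y) : D.d 1 n (app F x) = D.d (-1) n (app F y) := by
  rw [← app_d, ← app_d, h]

/-- The inclusion of a sub-ω-category. -/
def subIncl (C : OmegaCat.{u}) (S : Set C.carrier) (hd hc) : C.sub S hd hc ⟶ C :=
  OmegaFunctor.mk (C := C.sub S hd hc) (D := C) Subtype.val (fun _ _ _ => rfl)
    (fun _ _ _ _ _ => rfl)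

/-- The inclusion of a fibre. -/
def fibreIncl {C : OmegaCat.{u}} {S : Type u} (F : C ⟶ disc S) (a : S) : fibre F a ⟶ C :=
  OmegaFunctor.mk (C := fibre F a) (D := C) Subtype.val (fun _ _ _ => rfl) (fun _ _ _ _ _ => rfl)

/-- The corestriction of an ω-functor to a sub-ω-category. -/
def subLift {C D : OmegaCat.{u}} (F : D ⟶ C) (S : Set C.carrier) (hd hc)
    (hF : ∀ x, app F x ∈ S) : D ⟶ C.sub S hd hc :=
  OmegaFunctor.mk (C := D) (D := C.sub S hd hc) (fun x => ⟨app F x, hF x⟩)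
    (fun α n x => Subtype.ext (app_d F α n x))
    (fun n x y h h' => Subtype.ext (app_comp F n x y h (congrArg Subtype.val h')))

/-- Composites of elements of a set which is closed under sources and targets are closed under sources
and targets. -/
theorem Composite.d {C : OmegaCat.{u}} {S : Set C.carrier} (hS : ∀ α n x, x ∈ S → C.d α n x ∈ S)
    {x : C.carrier} (hx : C.Composite S x) (α : ℤˣ) (m : ℕ) : C.Composite S (C.d α m x) := by
  induction hx with
  | of x hx => exact .of _ (hS α m x hx)
  | comp n x y h _ _ ihx ihy =>
    by_cases hmn : m = n
    · subst hmn
      rcases Int.units_eq_one_or α with rfl | rfl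
      · rw [C.tgt_comp]; exact ihy
      · rw [C.src_comp]; exact ihx
    · obtain ⟨h', e⟩ := C.d_comp α m n x y h hmn
      rw [e]
      exact .comp n _ _ h' ihx ihy

variable (C : OmegaCat.{u}) (hC : C.NonContracting)

/-- The other leg of the pushout which defines `ℙ⁻C`. -/
noncomputable def freeToSemiPath : freeFunctor.obj (C.germGlob hC) ⟶ C.semiPath hC :=
  Limits.pushout.inl (freeFunctor.map (C.germMk hC)) (freeAdj.counit.app (C.path hC))

theorem semiPath_condition : freeFunctor.map (C.germMk hC) ≫ C.freeToSemiPath hC =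
    freeAdj.counit.app (C.path hC) ≫ C.toSemiPath hC := Limits.pushout.condition

/-- The ω-functor `h⁻` is constant on the classes of `R⁻`. -/
theorem toSemiPath_eq_of_germRel {x y : (C.path hC).carrier} (h : C.germRel hC x y) :
    app (C.toSemiPath hC) x = app (C.toSemiPath hC) y := by
  have e : C.germMk hC ≫ freeAdj.homEquiv _ _ (C.freeToSemiPath hC) =
      forgetGlob.map (C.toSemiPath hC) := by
    rw [← Adjunction.homEquiv_naturality_left, C.semiPath_condition hC]
    apply (freeAdj.homEquiv _ _).symm.injective
    rw [Equiv.symm_apply_apply, Adjunction.homEquiv_counit, Adjunction.counit_naturality]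
  set N := max ((C.path hC).dim x) ((C.path hC).dim y)
  have key : ∀ z : (forgetGlob.obj (C.path hC)).cells N, app (C.toSemiPath hC) z.1 =
      (GlobMap.toFun (freeAdj.homEquiv _ _ (C.freeToSemiPath hC)) N
        (GlobMap.toFun (C.germMk hC) N z)).1 := fun z =>
    congrArg (fun F : forgetGlob.obj (C.path hC) ⟶ forgetGlob.obj (C.semiPath hC) =>
      (GlobMap.toFun F N z).1) e.symm
  rw [key ⟨x, le_max_left _ _⟩, key ⟨y, le_max_right _ _⟩]
  have : GlobMap.toFun (C.germMk hC) N ⟨x, le_max_left _ _⟩ =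
      GlobMap.toFun (C.germMk hC) N ⟨y, le_max_right _ _⟩ := Quot.sound h
  rw [this]

variable {D : OmegaCat.{u}}

/-- The ω-functor on `ℙ⁻C` induced by an ω-functor on `ℙC` which is constant on the classes
of `R⁻`. -/
noncomputable def semiPathDesc (g : C.path hC ⟶ D)
    (hg : ∀ x y, C.germRel hC x y → app g x = app g y) : C.semiPath hC ⟶ D :=
  let γ : C.germGlob hC ⟶ forgetGlob.obj D :=
    GlobMap.mk (G := C.germGlob hC) (H := forgetGlob.obj D)
      (fun n => Quot.lift (GlobMap.toFun (forgetGlob.map g) n)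
        (fun x y h => Subtype.ext (hg x.1 y.1 h)))
      (fun α n x => by
        induction x using Quot.ind
        exact GlobMap.map_face (forgetGlob.map g) α n _)
  Limits.pushout.desc ((freeAdj.homEquiv _ _).symm γ) g (by
    rw [← Adjunction.homEquiv_naturality_left_symm]
    have h : C.germMk hC ≫ γ = forgetGlob.map g := rfl
    rw [h, Adjunction.homEquiv_counit, Adjunction.counit_naturality])

theorem toSemiPath_desc (g : C.path hC ⟶ D) (hg : ∀ x y, C.germRel hC x y → app g x = app g y) :
    C.toSemiPath hC ≫ C.semiPathDesc hC g hg = g := Limits.pushout.inr_desc _ _ _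

instance epi_germMk : Epi (C.germMk hC) where
  left_cancellation f g h := GlobMap.ext (funext fun n => funext fun x => by
    induction x using Quot.ind with
    | mk x => exact congrArg (fun F => GlobMap.toFun F n x) h)

theorem semiPath_hom_ext {F G : C.semiPath hC ⟶ D}
    (h : C.toSemiPath hC ≫ F = C.toSemiPath hC ≫ G) : F = G := by
  have : freeFunctor.{u}.PreservesEpimorphisms :=
    Functor.preservesEpimorphisms_of_adjunction freeAdj
  have e : C.freeToSemiPath hC ≫ F = C.freeToSemiPath hC ≫ G := by
    rw [← cancel_epi (freeFunctor.map (C.germMk hC)), ← Category.assoc, ← Category.assoc,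
      C.semiPath_condition hC, Category.assoc, Category.assoc, h]
  exact Limits.pushout.hom_ext e h

/-- The negative semi-path ω-category consists of the composites of elements in the image
of `h⁻`. -/
theorem semiPath_composite (x : (C.semiPath hC).carrier) :
    (C.semiPath hC).Composite (Set.range (app (C.toSemiPath hC))) x := by
  set S : Set (C.semiPath hC).carrier :=
    {x | (C.semiPath hC).Composite (Set.range (app (C.toSemiPath hC))) x}
  have hd : ∀ α n x, x ∈ S → (C.semiPath hC).d α n x ∈ S := fun α n x hx =>
    Composite.d (by rintro α n _ ⟨y, rfl⟩; exact ⟨_, app_d _ α n y⟩) hx α n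
  have hc : ∀ n x y h, x ∈ S → y ∈ S → (C.semiPath hC).comp n x y h ∈ S :=
    fun n x y h hx hy => .comp n x y h hx hy
  set i := subIncl (C.semiPath hC) S hd hc
  set g := subLift (C.toSemiPath hC) S hd hc fun y => .of _ ⟨y, rfl⟩
  have hg : g ≫ i = C.toSemiPath hC := rfl
  set k := C.semiPathDesc hC g (fun x y h => Subtype.ext (C.toSemiPath_eq_of_germRel hC h))
  have hk : C.toSemiPath hC ≫ k = g := C.toSemiPath_desc hC g _
  have e : k ≫ i = 𝟙 _ := by
    apply C.semiPath_hom_ext hC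
    rw [← Category.assoc, hk, hg, Category.comp_id]
  have e' : (app k x).1 = x := congrArg (fun F : C.semiPath hC ⟶ C.semiPath hC => app F x) e
  rw [← e']
  exact (app k x).2

end OmegaCat

namespace FaceSystem

/-! ### Coefficients of sources, targets and composites of cells -/

/-- A cell without coefficients above dimension `j` is equal to its `j`-source and `j`-target. -/
theorem cellD_eq_self {K : FaceSystem} {j : ℕ} {w : K.Cell}
    (h : ∀ α a, j < K.dim a → w.coeff α a = 0) (β : ℤˣ) : K.cellD β j w = w := by
  have key : K.cellD (-1) j w = w := by
    refine eq_of_src j (fun α a ha => ?_) (fun a ha => ?_) (fun α a ha => ?_)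
    · simp [cellD, ha]
    · simp [cellD, ha]
    · rw [h α a ha]; simp [cellD, not_lt_of_gt ha, ne_of_gt ha]
  rw [← key]
  exact K.cellCat.d_d_le β (-1) j j w le_rfl

theorem cellD_coeff_of_lt {K : FaceSystem} {n : ℕ} {a : K.Face} (ha : K.dim a < n) (α β : ℤˣ)
    (w : K.Cell) : (K.cellD β n w).coeff α a = w.coeff α a := if_pos ha

theorem cellD_coeff_of_eq {K : FaceSystem} {n : ℕ} {a : K.Face} (ha : K.dim a = n) (α β : ℤˣ)
    (w : K.Cell) : (K.cellD β n w).coeff α a = w.coeff β a :=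
  (if_neg (by omega)).trans (if_pos ha)

theorem cellD_coeff_of_gt {K : FaceSystem} {n : ℕ} {a : K.Face} (ha : n < K.dim a) (α β : ℤˣ)
    (w : K.Cell) : (K.cellD β n w).coeff α a = 0 :=
  (if_neg (by omega)).trans (if_neg (by omega))

theorem cellComp_coeff_of_eq {K : FaceSystem} {n : ℕ} {a : K.Face} (ha : K.dim a = n) (α : ℤˣ)
    {u v : K.Cell} (h : K.cellD 1 n u = K.cellD (-1) n v) :
    (K.cellComp n u v h).coeff α a = if α = -1 then u.coeff α a else v.coeff α a :=
  (if_neg (by omega)).trans (if_pos ha)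

theorem cellComp_coeff_of_lt {K : FaceSystem} {n : ℕ} {a : K.Face} (ha : K.dim a < n) (α : ℤˣ)
    {u v : K.Cell} (h : K.cellD 1 n u = K.cellD (-1) n v) :
    (K.cellComp n u v h).coeff α a = u.coeff α a := if_pos ha

/-- If a vertex occurs in the part `x_0^α` of a cell then this part is the atom of the vertex. -/
theorem OrientedBasis.cellD_zero_eq_atom {K : FaceSystem} {L : Type} [LinearOrder L]
    (B : K.OrientedBasis L) {w : K.Cell} {v : K.Face} (hv : K.dim v = 0) {α : ℤˣ}
    (h : w.coeff α v ≠ 0) : K.cellD α 0 w = B.atom v := by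
  have hs := sumAbove_cellD (B := B) (le_refl 0) α w
  obtain ⟨b, hb⟩ := hs.eq_atom (Nat.zero_le _)
  have hb₀ : K.dim b = 0 := by
    by_contra hne
    have := sumAbove_nil_iff.1 hs 1 b (by omega)
    rw [hb, B.coeff_self] at this
    exact one_ne_zero this
  have h' : (B.atom b).coeff 1 v ≠ 0 := by
    rwa [← hb, cellD_coeff_of_eq hv]
  rw [B.coeff_of_dim_le _ (by omega)] at h'
  rw [hb, of_not_not fun hne => h' (if_neg hne)]

end FaceSystem

section Restriction

variable {n : ℕ}

/-! ### Restricting cells of the cube to the faces in the image of the simplex -/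

/-- The initial vertex of the cube, as a face. -/
def initialFace (n : ℕ) : (cubeFaces n).Face := fun _ => -1

theorem dim_initialFace : (cubeFaces n).dim (initialFace n) = 0 :=
  (cube_dim_eq_zero _).2 fun _ => show (-1 : SignType) ≠ 0 by decide

theorem cube_sum_inc (b : (cubeFaces n).Face) (f : (cubeFaces n).Face → ℤ) :
    ∑ a : (cubeFaces n).Face, f a * (cubeFaces n).inc a b =
      ∑ j ∈ Finset.univ.filter (fun j => b j ≠ 0), f (Function.update b j 0) * (cubeSign b j : ℤ) := by
  refine (cubeFaces n).sum_inc b _ (fun j => Function.update b j 0) (cubeSign b)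
    (fun i hi j hj h => ?_) (fun β a => cube_mem_bd a b β) f
  by_contra hij
  have := congrFun h i
  rw [Function.update_self, Function.update_of_ne hij] at this
  exact (Finset.mem_filter.1 hi).2 this.symm

theorem simplex_sum_inc (τ : (simplexFaces n).Face) (f : (simplexFaces n).Face → ℤ) :
    ∑ σ : (simplexFaces n).Face, f σ * (simplexFaces n).inc σ τ =
      ∑ v ∈ τ.1ᶜ, f ⟨insert v τ.1, Finset.insert_nonempty v τ.1⟩ * (simplexSign τ.1 v : ℤ) := by
  refine (simplexFaces n).sum_inc τ _ (fun v => ⟨insert v τ.1, Finset.insert_nonempty v τ.1⟩)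
    (simplexSign τ.1) (fun v hv w hw h => ?_) (fun β σ => simplex_mem_bd σ τ β) f
  have h' : insert v τ.1 = insert w τ.1 := congrArg Subtype.val h
  have := h' ▸ Finset.mem_insert_self v τ.1
  exact (Finset.mem_insert.1 this).resolve_right (Finset.mem_compl.1 hv)

/-- A vertex of the simplex, as a face. -/
def vertexFace (v : Fin (n + 1)) : (simplexFaces n).Face := ⟨{v}, Finset.singleton_nonempty v⟩

theorem update_initialFace (v : Fin (n + 1)) :
    Function.update (initialFace (n + 1)) v 0 = faceMap n (vertexFace v) := by
  funext j
  by_cases h : j = v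
  · subst h; rw [Function.update_self]; exact (faceMap_eq_zero.2 (Finset.mem_singleton_self _)).symm
  · rw [Function.update_of_ne h, faceMap_of_notMem fun h' => h (Finset.mem_singleton.1 h')]; rfl

theorem update_faceMap (τ : (simplexFaces n).Face) (v : Fin (n + 1)) :
    Function.update (faceMap n τ) v 0 =
      faceMap n ⟨insert v τ.1, Finset.insert_nonempty v τ.1⟩ := by
  funext j
  by_cases h : j = v
  · subst h; rw [Function.update_self]; exact (faceMap_eq_zero.2 (Finset.mem_insert_self _ _)).symm
  · rw [Function.update_of_ne h]
    simp [faceMap, h]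

theorem cubeSign_faceMap {τ : (simplexFaces n).Face} {v : Fin (n + 1)} (hv : v ∉ τ.1) :
    cubeSign (faceMap n τ) v = simplexSign τ.1 v := by
  unfold cubeSign simplexSign
  rw [faceMap_of_notMem hv, zerosBefore_faceMap, if_neg (by decide), pow_succ']

/-- The edges at the initial vertex, counted in a cell of the cube. -/
theorem sum_coeff_vertexFace (w : (cubeFaces (n + 1)).Cell) (α : ℤˣ) :
    ∑ v : Fin (n + 1), (w.coeff α (faceMap n (vertexFace v)) : ℤ) =
      w.coeff (-1) (initialFace (n + 1)) - w.coeff 1 (initialFace (n + 1)) := by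
  have h := w.bdry α (initialFace (n + 1))
  have hu : Finset.univ.filter (fun j => initialFace (n + 1) j ≠ 0) = Finset.univ :=
    Finset.filter_true_of_mem fun j _ => show (-1 : SignType) ≠ 0 by decide
  rw [cube_sum_inc _ fun a => (w.coeff α a : ℤ), hu] at h
  have hs : ∀ v, (cubeSign (initialFace (n + 1)) v : ℤ) = -1 := fun v => by
    have hz : zerosBefore (initialFace (n + 1)) v = 0 := by
      simp [zerosBefore, initialFace]
    unfold cubeSign
    rw [hz, if_neg (show ¬ initialFace (n + 1) v = 1 from (by decide : ¬ (-1 : SignType) = 1))]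
    simp
  simp only [hs, update_initialFace, mul_neg, mul_one, Finset.sum_neg_distrib] at h
  omega

theorem cube_coeff_faceMap_bdry (w : (cubeFaces (n + 1)).Cell) (α : ℤˣ)
    (τ : (simplexFaces n).Face) :
    (w.coeff 1 (faceMap n τ) : ℤ) - w.coeff (-1) (faceMap n τ) =
      ∑ σ : (simplexFaces n).Face, (w.coeff α (faceMap n σ) : ℤ) * (simplexFaces n).inc σ τ := by
  rw [w.bdry α, cube_sum_inc _ fun a => (w.coeff α a : ℤ),
    simplex_sum_inc τ fun σ => (w.coeff α (faceMap n σ) : ℤ)]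
  refine Finset.sum_congr (Finset.ext fun v => ?_) fun v hv => ?_
  · simp [faceMap_eq_zero]
  · rw [update_faceMap, cubeSign_faceMap (Finset.mem_compl.1 hv)]

theorem sum_vertexFace (f : (simplexFaces n).Face → ℕ) :
    ∑ σ : (simplexFaces n).Face with (simplexFaces n).dim σ = 0, f σ =
      ∑ v : Fin (n + 1), f (vertexFace v) := by
  symm
  refine Finset.sum_bij (fun v _ => vertexFace v) (fun v _ => ?_) (fun v _ w _ h => ?_)
    (fun σ hσ => ?_) (fun _ _ => rfl)
  · refine Finset.mem_filter.2 ⟨Finset.mem_univ _, ?_⟩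
    show ({v} : Finset (Fin (n + 1))).card - 1 = 0
    simp
  · exact Finset.singleton_injective (congrArg Subtype.val h)
  · have h₁ : σ.1.card - 1 = 0 := (Finset.mem_filter.1 hσ).2
    have h₂ := σ.2.card_pos
    obtain ⟨w, hw⟩ := Finset.card_eq_one.1 (show σ.1.card = 1 by omega)
    exact ⟨w, Finset.mem_univ _, Subtype.ext hw.symm⟩

/-- A cell of the cube which does not begin at the initial vertex contains none of the faces in the
image of the simplex. -/
theorem coeff_faceMap_eq_zero (w : (cubeFaces (n + 1)).Cell)
    (h : w.coeff (-1) (initialFace (n + 1)) = 0) (α : ℤˣ) (σ : (simplexFaces n).Face) :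
    w.coeff α (faceMap n σ) = 0 := by
  revert h α σ
  refine FaceSystem.OrientedBasis.cell_induction (cubeBasis (n + 1))
    (P := fun w => w.coeff (-1) (initialFace (n + 1)) = 0 → ∀ α σ, w.coeff α (faceMap n σ) = 0)
    (fun a h α σ => ?_) (fun p u v huv ihu ihv h α σ => ?_) w
  · by_contra hne
    have hσ : InCubeAtom α a (faceMap n σ) := cubeAtom_coeff_ne_zero.1 hne
    refine cubeAtom_coeff_ne_zero.2 ⟨fun j hj => ?_, fun j hj _ => ?_⟩ h
    · rw [← hσ.1 j hj]
      exact (faceMap_of_notMem fun hj' => hj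
        ((hσ.1 j hj).symm.trans (faceMap_eq_zero.2 hj'))).symm
    · have hz : zerosBefore (initialFace (n + 1)) j = 0 := by simp [zerosBefore, initialFace]
      rw [hz]
      rfl
  · have hu : u.coeff (-1) (initialFace (n + 1)) = 0 := by
      rcases Nat.eq_zero_or_pos p with rfl | hp
      · rwa [FaceSystem.cellComp_coeff_of_eq dim_initialFace, if_pos rfl] at h
      · rwa [FaceSystem.cellComp_coeff_of_lt (by rw [dim_initialFace]; exact hp)] at h
    have hv : v.coeff (-1) (initialFace (n + 1)) = 0 := by
      rcases Nat.eq_zero_or_pos p with rfl | hp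
      · rw [← ((cubeFaces (n + 1)).cellD_eq huv 1 _).2 dim_initialFace]
        have := sum_coeff_vertexFace u 1
        rw [Finset.sum_eq_zero fun v _ => by rw [ihu hu 1 (vertexFace v), Nat.cast_zero], hu] at this
        omega
      · rwa [← ((cubeFaces (n + 1)).cellD_eq huv (-1) _).1 (by rw [dim_initialFace]; exact hp)]
    have hu' := ihu hu α σ
    have hv' := ihv hv α σ
    show (if _ then _ else if _ then if _ then _ else _ else _ + _) = 0
    rw [hu', hv']
    simp

/-- The restriction of a cell of the cube which starts at the initial vertex, but does not end
there, to the faces in the image of the simplex. -/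
def restrictCell (w : (cubeFaces (n + 1)).Cell) (h : w.coeff (-1) (initialFace (n + 1)) = 1)
    (h' : w.coeff 1 (initialFace (n + 1)) = 0) : (simplexFaces n).Cell where
  coeff α σ := w.coeff α (faceMap n σ)
  aug α := by
    rw [sum_vertexFace fun σ => w.coeff α (faceMap n σ)]
    have := sum_coeff_vertexFace w α
    rw [h, h', Nat.cast_one, Nat.cast_zero, sub_zero] at this
    exact_mod_cast this
  bdry α τ := cube_coeff_faceMap_bdry w α τ

theorem restrictCell_cellD {w : (cubeFaces (n + 1)).Cell} (h h') (α : ℤˣ) (m : ℕ) (k k') :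
    restrictCell ((cubeFaces (n + 1)).cellD α (m + 1) w) k k' =
      (simplexFaces n).cellD α m (restrictCell w h h') := by
  refine FaceSystem.cell_ext fun β σ => ?_
  show ((cubeFaces (n + 1)).cellD α (m + 1) w).coeff β (faceMap n σ) = _
  have hd := dim_faceMap σ
  rcases lt_trichotomy ((simplexFaces n).dim σ) m with hσ | hσ | hσ
  · rw [FaceSystem.cellD_coeff_of_lt (by omega), FaceSystem.cellD_coeff_of_lt hσ]; rfl
  · rw [FaceSystem.cellD_coeff_of_eq (by omega), FaceSystem.cellD_coeff_of_eq hσ]; rfl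
  · rw [FaceSystem.cellD_coeff_of_gt (by omega), FaceSystem.cellD_coeff_of_gt hσ]

theorem restrictCell_cellComp {u v : (cubeFaces (n + 1)).Cell} {m : ℕ} (huv) (hu hu' hv hv' huv' k k') :
    restrictCell ((cubeFaces (n + 1)).cellComp (m + 1) u v huv) k k' =
      (simplexFaces n).cellComp m (restrictCell u hu hu') (restrictCell v hv hv') huv' := by
  refine FaceSystem.cell_ext fun β σ => ?_
  show ((cubeFaces (n + 1)).cellComp (m + 1) u v huv).coeff β (faceMap n σ) = _
  have hd := dim_faceMap σ
  rcases lt_trichotomy ((simplexFaces n).dim σ) m with hσ | hσ | hσ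
  · rw [FaceSystem.cellComp_coeff_of_lt (by omega), FaceSystem.cellComp_coeff_of_lt hσ]; rfl
  · rw [FaceSystem.cellComp_coeff_of_eq (by omega), FaceSystem.cellComp_coeff_of_eq hσ]; rfl
  · rw [FaceSystem.OrientedBasis.cellComp_coeff _ _ (by omega),
      FaceSystem.OrientedBasis.cellComp_coeff _ _ hσ]; rfl

/-- A cell of positive dimension does not end where it begins. -/
theorem coeff_initialFace_eq_zero {x : (cubeCat (n + 1)).carrier} (hx : 1 ≤ (cubeCat (n + 1)).dim x)
    (h : x.1.coeff (-1) (initialFace (n + 1)) = 1) : x.1.coeff 1 (initialFace (n + 1)) = 0 := by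
  by_contra hne
  have e : (cubeFaces (n + 1)).cellD 1 0 x.1 = (cubeFaces (n + 1)).cellD (-1) 0 x.1 :=
    ((cubeBasis (n + 1)).cellD_zero_eq_atom dim_initialFace hne).trans
      ((cubeBasis (n + 1)).cellD_zero_eq_atom dim_initialFace (by rw [h]; exact one_ne_zero)).symm
  refine ((cubeCat (n + 1)).one_le_dim_iff x 1).1 hx (Subtype.ext (FaceSystem.cellD_eq_self
    (fun α a ha => (cubeFaces (n + 1)).vanish_of_functional cubeHeight cubeHeight_bd x.1
      (fun b hb => ?_) ((cubeFaces (n + 1)).dim a - 1) a (by omega) α) 1))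
  have e' : ((cubeFaces (n + 1)).cellD 1 0 x.1).coeff 1 b =
      ((cubeFaces (n + 1)).cellD (-1) 0 x.1).coeff 1 b := by rw [e]
  exact ((FaceSystem.cellD_coeff_of_eq hb 1 1 x.1).symm.trans e').trans
    (FaceSystem.cellD_coeff_of_eq hb 1 (-1) x.1)

/-- A vertex of the simplex, as an element of the ω-category of cells. -/
def vertexCell (v : Fin (n + 1)) : (simplexFaces n).cellCat.carrier := simplexAtom (vertexFace v)

theorem dim_vertexCell (v : Fin (n + 1)) : (simplexFaces n).cellCat.dim (vertexCell v) = 0 := by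
  rw [← Nat.le_zero, (simplexFaces n).cellCat.dim_le_iff _ _ 1]
  refine FaceSystem.cellD_eq_self (fun α a ha => ?_) 1
  have hd : (simplexFaces n).dim (vertexFace v) = 0 := by
    show ({v} : Finset (Fin (n + 1))).card - 1 = 0
    simp
  refine ((simplexBasis n).coeff_of_dim_le α (by omega)).trans (if_neg ?_)
  rintro rfl
  omega

/-- The path ω-category of the cube of dimension `n + 1`. -/
abbrev cubePath (n : ℕ) : OmegaCat.{0} := (cubeCat (n + 1)).path (cubeCat_nonContracting (n + 1))

open Classical in
/-- The restriction of an element of the path ω-category of the cube to the faces in the image of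
the simplex. For an element which does not start at the initial vertex the value is an arbitrary
vertex of the simplex. -/
noncomputable def pathRestrict
    (x : (cubePath n).carrier) :
    (simplexFaces n).cellCat.carrier :=
  if h : x.1.1.coeff (-1) (initialFace (n + 1)) = 1 then
    restrictCell x.1.1 h (coeff_initialFace_eq_zero x.2 h) else vertexCell 0

section

variable {x : (cubePath n).carrier}

theorem pathRestrict_of (h : x.1.1.coeff (-1) (initialFace (n + 1)) = 1) :
    pathRestrict x = restrictCell x.1.1 h (coeff_initialFace_eq_zero x.2 h) := dif_pos h

theorem pathRestrict_of_not (h : ¬ x.1.1.coeff (-1) (initialFace (n + 1)) = 1) :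
    pathRestrict x = vertexCell 0 := dif_neg h

end

/-- The restriction to the faces in the image of the simplex, as an ω-functor. -/
noncomputable def pathToSimplex (n : ℕ) :
    cubePath n ⟶ (simplexFaces n).cellCat :=
  OmegaFunctor.mk (C := cubePath n)
    (D := (simplexFaces n).cellCat) pathRestrict
    (fun α m x => by
      have e : ((cubePath n).d α m x).1.1.coeff (-1)
          (initialFace (n + 1)) = x.1.1.coeff (-1) (initialFace (n + 1)) :=
        FaceSystem.cellD_coeff_of_lt (by rw [dim_initialFace]; omega) _ _ _
      by_cases h : x.1.1.coeff (-1) (initialFace (n + 1)) = 1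
      · rw [pathRestrict_of h, pathRestrict_of (e.trans h)]
        exact restrictCell_cellD _ _ α m _ _
      · rw [pathRestrict_of_not h, pathRestrict_of_not fun h' => h (e.symm.trans h')]
        exact (OmegaCat.d_of_dim_le _ ((dim_vertexCell 0).trans_le (Nat.zero_le m)) α).symm)
    (fun m x y hxy hxy' => by
      have hxy₀ : (cubeFaces (n + 1)).cellD 1 (m + 1) x.1.1 =
        (cubeFaces (n + 1)).cellD (-1) (m + 1) y.1.1 := congrArg (fun z => z.1.1) hxy
      have e : ((cubePath n).comp m x y
          hxy).1.1.coeff (-1) (initialFace (n + 1)) = x.1.1.coeff (-1) (initialFace (n + 1)) :=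
        FaceSystem.cellComp_coeff_of_lt (by rw [dim_initialFace]; omega) _ hxy₀
      have e' : x.1.1.coeff (-1) (initialFace (n + 1)) = y.1.1.coeff (-1) (initialFace (n + 1)) :=
        ((cubeFaces (n + 1)).cellD_eq hxy₀ _ _).1 (by rw [dim_initialFace]; omega)
      by_cases h : x.1.1.coeff (-1) (initialFace (n + 1)) = 1
      · rw [(simplexFaces n).cellCat.comp_congr hxy' (pathRestrict_of h)
          (pathRestrict_of (e'.symm.trans h)), pathRestrict_of (e.trans h)]
        exact restrictCell_cellComp hxy₀ h _ (e'.symm.trans h) _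
          (by rwa [pathRestrict_of h, pathRestrict_of (e'.symm.trans h)] at hxy') _ _
      · rw [(simplexFaces n).cellCat.comp_congr hxy' (pathRestrict_of_not h)
          (pathRestrict_of_not fun h' => h (e'.trans h')),
          pathRestrict_of_not fun h' => h (e.symm.trans h')]
        exact (OmegaCat.comp_of_dim_right _ (by rw [dim_vertexCell]; exact Nat.zero_le m)).symm)

theorem pathToSimplex_apply (x : (cubePath n).carrier) :
    OmegaCat.app (pathToSimplex n) x = pathRestrict x := rfl

/-- The second factor of a composite along a vertex contributes nothing to the restriction, as it does
not start at the initial vertex. -/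
theorem pathToSimplex_germ {x y : (cubePath n).carrier}
    (h : (cubeCat (n + 1)).germRel (cubeCat_nonContracting (n + 1)) x y) :
    OmegaCat.app (pathToSimplex n) x = OmegaCat.app (pathToSimplex n) y := by
  induction h with
  | rel x z h =>
    obtain ⟨y, hxy, e⟩ := h
    have hxy₀ : (cubeFaces (n + 1)).cellD 1 0 x.1.1 = (cubeFaces (n + 1)).cellD (-1) 0 y.1.1 :=
      congrArg Subtype.val hxy
    have e₀ : z.1.1 = (cubeFaces (n + 1)).cellComp 0 x.1.1 y.1.1 hxy₀ := congrArg Subtype.val e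
    have e₁ : z.1.1.coeff (-1) (initialFace (n + 1)) = x.1.1.coeff (-1) (initialFace (n + 1)) := by
      rw [e₀]
      exact (FaceSystem.cellComp_coeff_of_eq dim_initialFace (-1) hxy₀).trans (if_pos rfl)
    rw [pathToSimplex_apply, pathToSimplex_apply]
    by_cases h : x.1.1.coeff (-1) (initialFace (n + 1)) = 1
    · rw [pathRestrict_of h, pathRestrict_of (e₁.trans h)]
      refine FaceSystem.cell_ext fun α σ => ?_
      have hy : y.1.1.coeff (-1) (initialFace (n + 1)) = 0 := by
        rw [← ((cubeFaces (n + 1)).cellD_eq hxy₀ 1 _).2 dim_initialFace]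
        exact coeff_initialFace_eq_zero x.2 h
      show x.1.1.coeff α (faceMap n σ) = z.1.1.coeff α (faceMap n σ)
      rw [e₀, FaceSystem.OrientedBasis.cellComp_coeff hxy₀ α (by rw [dim_faceMap]; omega),
        coeff_faceMap_eq_zero _ hy, add_zero]
    · rw [pathRestrict_of_not h, pathRestrict_of_not fun h' => h (e₁.symm.trans h')]
  | refl x => rfl
  | symm x y _ ih => exact ih.symm
  | trans x y z _ _ ih₁ ih₂ => exact ih₁.trans ih₂

end Restriction

namespace OmegaCat

/-! ### Isomorphisms of ω-categories -/

/-- A bijective ω-functor, as an isomorphism. -/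
noncomputable def isoOfBijective {C D : OmegaCat.{u}} (F : C ⟶ D) (h : Function.Bijective (app F)) :
    C ≅ D where
  hom := F
  inv := OmegaFunctor.mk (C := D) (D := C) (Equiv.ofBijective _ h).symm
    (fun α n x => (Equiv.symm_apply_eq _).2 <| by
      rw [Equiv.ofBijective_apply, app_d]
      exact congrArg (D.d α n) ((Equiv.ofBijective _ h).apply_symm_apply x).symm)
    (fun n x y hxy hxy' => (Equiv.symm_apply_eq _).2 <| by
      rw [Equiv.ofBijective_apply, app_comp F n _ _ hxy' (app_composable F hxy')]
      exact D.comp_congr hxy ((Equiv.ofBijective _ h).apply_symm_apply x).symm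
        ((Equiv.ofBijective _ h).apply_symm_apply y).symm)
  hom_inv_id := hom_ext fun x => (Equiv.ofBijective _ h).symm_apply_apply x
  inv_hom_id := hom_ext fun x => (Equiv.ofBijective _ h).apply_symm_apply x

/-- An ω-functor on a generated ω-category is determined by its values on the generators. -/
theorem generate_hom_ext {C D : OmegaCat.{u}} {S : Set C.carrier} {F G : C.generate S ⟶ D}
    (h : ∀ x (hx : x ∈ S), app F ⟨x, .of x hx⟩ = app G ⟨x, .of x hx⟩) : F = G := by
  refine hom_ext fun x => ?_
  obtain ⟨x, hx⟩ := x
  induction hx with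
  | of x hx => exact h x hx
  | d α n x hx ih =>
    exact (app_d F α n ⟨x, hx⟩).trans ((congrArg _ ih).trans (app_d G α n ⟨x, hx⟩).symm)
  | comp n x y hxy hx hy ihx ihy =>
    have e : (C.generate S).d 1 n ⟨x, hx⟩ = (C.generate S).d (-1) n ⟨y, hy⟩ := Subtype.ext hxy
    exact (app_comp F n _ _ e (app_composable F e)).trans
      ((D.comp_congr (app_composable F e) ihx ihy).trans
        (app_comp G n _ _ e (app_composable G e)).symm)

end OmegaCat

/-! ### Covers and the ω-category generated by the atoms -/

open OmegaCat

namespace FaceSystem.OrientedBasis.Cover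

variable {K : FaceSystem} {L : Type} [LinearOrder L] {B : K.OrientedBasis L} {Q : OmegaCat.{0}}
  (F : B.Cover Q)

/-- The ω-functor of a cover takes values in the ω-category generated by the atoms. -/
theorem generated_val (x : Q.carrier) : K.cellCat.Generated (Set.range B.atom) (F.val x) := by
  induction F.composite x with
  | of x hx =>
    obtain ⟨a, rfl⟩ := hx
    exact .of _ ⟨a, (F.map_gen a).symm⟩
  | comp n x y h _ _ ihx ihy =>
    rw [F.val_comp h]
    exact .comp (C := K.cellCat) n _ _ (F.val_composable h) ihx ihy

/-- The ω-functor of a cover is onto the ω-category generated by the atoms. By injectivity, elements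
over composable cells are composable. -/
theorem exists_val_eq {w : K.cellCat.carrier} (hw : K.cellCat.Generated (Set.range B.atom) w) :
    ∃ x, F.val x = w := by
  induction hw with
  | of w hw =>
    obtain ⟨a, rfl⟩ := hw
    exact ⟨F.gen a, F.map_gen a⟩
  | d α n w _ ih =>
    obtain ⟨x, rfl⟩ := ih
    exact ⟨Q.d α n x, F.val_d α n x⟩
  | comp n w w' h _ _ ih ih' =>
    obtain ⟨x, rfl⟩ := ih
    obtain ⟨y, rfl⟩ := ih'
    have hxy : Q.d 1 n x = Q.d (-1) n y := F.val_injective (by rw [val_d, val_d]; exact h)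
    exact ⟨Q.comp n x y hxy, F.val_comp hxy⟩

/-- A cover as an isomorphism onto the ω-category generated by the atoms. -/
noncomputable def iso : Q ≅ K.cellCat.generate (Set.range B.atom) :=
  isoOfBijective (subLift F.map {x | K.cellCat.Generated (Set.range B.atom) x} _ _ F.generated_val)
    ⟨fun _ _ h => F.val_injective (congrArg Subtype.val h),
      fun w => (F.exists_val_eq w.2).imp fun _ h => Subtype.ext h⟩

theorem iso_inv_atom (a : K.Face) : app F.iso.inv ⟨B.atom a, .of _ ⟨a, rfl⟩⟩ = F.gen a := by
  have h : app F.iso.hom (F.gen a) = ⟨B.atom a, .of _ ⟨a, rfl⟩⟩ := Subtype.ext (F.map_gen a)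
  rw [← h]
  exact congrArg (fun G : Q ⟶ Q => app G (F.gen a)) F.iso.hom_inv_id

end FaceSystem.OrientedBasis.Cover

section SemiPathFibre

variable {n : ℕ}

/-! ### The fibre of the negative semi-path ω-category over the initial vertex -/

theorem vertexSrc_eq_cubeInitial_iff {x : (cubeCat n).carrier} :
    (cubeCat n).vertexSrc x = cubeInitial n ↔ x.1.coeff (-1) (initialFace n) = 1 := by
  constructor
  · intro h
    have e : (cubeFaces n).cellD (-1) 0 x.1 = cubeAtom (initialFace n) :=
      congrArg (fun y : (cubeCat n).Vertex => y.1.1) h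
    refine (FaceSystem.cellD_coeff_of_eq dim_initialFace 1 (-1) x.1).symm.trans ?_
    rw [e]
    exact (cubeBasis n).coeff_self 1 _
  · intro h
    exact Subtype.ext (Subtype.ext ((cubeBasis n).cellD_zero_eq_atom dim_initialFace
      (by rw [h]; exact one_ne_zero)))

theorem inCubeAtom_initialFace_iff {a : (cubeFaces (n + 1)).Face} :
    InCubeAtom (-1) a (initialFace (n + 1)) ↔ ∀ j, a j ≠ 0 → a j = -1 := by
  refine ⟨fun h j hj => (h.1 j hj).symm, fun h => ⟨fun j hj => (h j hj).symm, fun j _ _ => ?_⟩⟩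
  have hz : zerosBefore (initialFace (n + 1)) j = 0 := by simp [zerosBefore, initialFace]
  rw [hz]
  rfl

theorem coeff_facePath (σ : (simplexFaces n).Face) :
    (facePath n σ).1.1.coeff (-1) (initialFace (n + 1)) = 1 := by
  refine if_pos (inCubeAtom_initialFace_iff.2 fun j hj => faceMap_of_notMem fun h => hj ?_)
  exact faceMap_eq_zero.2 h

/-- The atoms which start at the initial vertex are those of the faces in the image of
the simplex. -/
theorem exists_faceMap_eq {a : (cubeFaces (n + 1)).Face} (ha : ∃ j, a j = 0)
    (h : InCubeAtom (-1) a (initialFace (n + 1))) : ∃ σ, faceMap n σ = a := by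
  obtain ⟨j, hj⟩ := ha
  refine ⟨⟨Finset.univ.filter fun j => a j = 0, j, by simp [hj]⟩, funext fun i => ?_⟩
  by_cases hi : a i = 0
  · rw [hi]; exact faceMap_eq_zero.2 (by simp [hi])
  · rw [inCubeAtom_initialFace_iff.1 h i hi]; exact faceMap_of_notMem (by simp [hi])

/-- The negative semi-path ω-category of the cube of dimension `n + 1`. -/
noncomputable abbrev cubeSemiPath (n : ℕ) : OmegaCat.{0} :=
  (cubeCat (n + 1)).semiPath (cubeCat_nonContracting (n + 1))

/-- The ω-functor `h⁻` for the cube of dimension `n + 1`. -/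
noncomputable abbrev cubeToSemiPath (n : ℕ) : cubePath n ⟶ cubeSemiPath n :=
  (cubeCat (n + 1)).toSemiPath (cubeCat_nonContracting (n + 1))

/-- The grading of the negative semi-path ω-category of the cube of dimension `n + 1`. -/
noncomputable abbrev cubeGrading (n : ℕ) : cubeSemiPath n ⟶ disc (cubeCat (n + 1)).Vertex :=
  (cubeCat (n + 1)).semiPathGrading (cubeCat_nonContracting (n + 1))

/-- The fibre of the negative semi-path ω-category of the cube of dimension `n + 1` over the initial
vertex. -/
noncomputable abbrev cubeFibre (n : ℕ) : OmegaCat.{0} :=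
  (cubeCat (n + 1)).semiPathFibre (cubeCat_nonContracting (n + 1)) (cubeInitial (n + 1))

/-- The images in `ℙ⁻` of the atoms in the image of the simplex. -/
noncomputable def semiPathGen (n : ℕ) (σ : (simplexFaces n).Face) :
    (cubeSemiPath n).carrier :=
  app (cubeToSemiPath n) (facePath n σ)

theorem grade_semiPathGen (σ : (simplexFaces n).Face) :
    app (cubeGrading n) (semiPathGen n σ) =
      cubeInitial (n + 1) :=
  ((cubeCat (n + 1)).semiPathGrading_toSemiPath _ _).trans
    (vertexSrc_eq_cubeInitial_iff.2 (coeff_facePath σ))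

/-- An element of the path ω-category which starts at the initial vertex is, up to `R⁻`, a composite
of atoms in the image of the simplex: a composite along a vertex is equivalent to its
first factor. -/
theorem composite_toSemiPath (x : (cubePath n).carrier)
    (hx : x.1.1.coeff (-1) (initialFace (n + 1)) = 1) :
    (cubeSemiPath n).Composite
      (Set.range (semiPathGen n))
      (app (cubeToSemiPath n) x) := by
  have key : ∀ w : (cubeFaces (n + 1)).Cell,
      ∃ hw : (cubeFaces (n + 1)).cellCat.Generated (Set.range cubeAtom) w,
        ∀ hd : 1 ≤ (cubeCat (n + 1)).dim ⟨w, hw⟩, w.coeff (-1) (initialFace (n + 1)) = 1 →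
          (cubeSemiPath n).Composite (Set.range (semiPathGen n))
            (app (cubeToSemiPath n) ⟨⟨w, hw⟩, hd⟩) := by
    refine (cubeBasis (n + 1)).cell_induction (fun a => ?_) (fun p u v huv ihu ihv => ?_)
    · refine ⟨.of _ ⟨a, rfl⟩, fun hd hg => ?_⟩
      have ha : ∃ j, a j = 0 := by
        by_contra! hne
        have h₀ := dim_cubeFace_eq_zero a hne
        have h₁ : 1 ≤ (cubeCat (n + 1)).dim (cubeFace a) := hd
        omega
      obtain ⟨σ, rfl⟩ := exists_faceMap_eq ha
        (cubeAtom_coeff_ne_zero.1 (by rw [show (cubeAtom a).coeff (-1) _ = 1 from hg]; exact one_ne_zero))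
      exact .of _ ⟨σ, rfl⟩
    · obtain ⟨hu, ihu⟩ := ihu
      obtain ⟨hv, ihv⟩ := ihv
      have hw : (cubeFaces (n + 1)).cellCat.Generated (Set.range cubeAtom)
        ((cubeFaces (n + 1)).cellComp p u v huv) :=
          .comp (C := (cubeFaces (n + 1)).cellCat) p u v huv hu hv
      refine ⟨hw, fun hd hg => ?_⟩
      have huv' : (cubeCat (n + 1)).d 1 p ⟨u, hu⟩ = (cubeCat (n + 1)).d (-1) p ⟨v, hv⟩ :=
        Subtype.ext huv
      have e : (⟨_, hw⟩ : (cubeCat (n + 1)).carrier) =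
        (cubeCat (n + 1)).comp p ⟨u, hu⟩ ⟨v, hv⟩ huv' := rfl
      -- a factor of dimension `0` does not belong to the path ω-category, but is an identity
      rcases Nat.eq_zero_or_pos ((cubeCat (n + 1)).dim ⟨u, hu⟩) with hdu | hdu
      · have e' := e.trans (comp_of_dim_left huv' (hdu.trans_le (Nat.zero_le p)))
        have e₁ : (cubeFaces (n + 1)).cellComp p u v huv = v := congrArg Subtype.val e'
        have hd' : 1 ≤ (cubeCat (n + 1)).dim ⟨v, hv⟩ := e' ▸ hd
        have := ihv hd' (by rw [← e₁]; exact hg)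
        rwa [show (⟨⟨v, hv⟩, hd'⟩ : (cubePath n).carrier) = ⟨_, hd⟩ from Subtype.ext e'.symm] at this
      rcases Nat.eq_zero_or_pos ((cubeCat (n + 1)).dim ⟨v, hv⟩) with hdv | hdv
      · have e' := e.trans (comp_of_dim_right huv' (hdv.trans_le (Nat.zero_le p)))
        have e₁ : (cubeFaces (n + 1)).cellComp p u v huv = u := congrArg Subtype.val e'
        have := ihu hdu (by rw [← e₁]; exact hg)
        rwa [show (⟨⟨u, hu⟩, hdu⟩ : (cubePath n).carrier) = ⟨_, hd⟩ from Subtype.ext e'.symm] at this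
      rcases p with _ | q
      · have hu₁ : u.coeff (-1) (initialFace (n + 1)) = 1 := by
          refine Eq.trans ?_ hg
          exact ((FaceSystem.cellComp_coeff_of_eq dim_initialFace (-1) huv).trans (if_pos rfl)).symm
        have h₀ := toSemiPath_eq_of_germRel (cubeCat (n + 1)) (cubeCat_nonContracting (n + 1))
          (.rel ⟨⟨u, hu⟩, hdu⟩ ⟨_, hd⟩ ⟨⟨⟨v, hv⟩, hdv⟩, huv', e⟩)
        exact h₀ ▸ ihu hdu hu₁
      · have hu₁ : u.coeff (-1) (initialFace (n + 1)) = 1 := by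
          refine Eq.trans ?_ hg
          exact (FaceSystem.cellComp_coeff_of_lt (by rw [dim_initialFace]; omega) (-1) huv).symm
        have hv₁ : v.coeff (-1) (initialFace (n + 1)) = 1 :=
          (((cubeFaces (n + 1)).cellD_eq huv (-1) _).1
            (by rw [dim_initialFace]; omega)).symm.trans hu₁
        have h₀ : (cubePath n).d 1 q ⟨⟨u, hu⟩, hdu⟩ = (cubePath n).d (-1) q ⟨⟨v, hv⟩, hdv⟩ :=
          Subtype.ext huv'
        have h₁ := app_comp (cubeToSemiPath n) q _ _ h₀ (app_composable _ h₀)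
        exact h₁ ▸ .comp q _ _ (app_composable _ h₀) (ihu hdu hu₁) (ihv hdv hv₁)
  exact (key x.1.1).2 x.2 hx

/-- The elements of grade `v` are composites of the images of atoms which start at `v`, since all factors
of a composite have the same grade. -/
theorem composite_of_grade (x : (cubeSemiPath n).carrier)
    (hx : app (cubeGrading n) x =
      cubeInitial (n + 1)) :
    (cubeSemiPath n).Composite
      (Set.range (semiPathGen n)) x := by
  induction (cubeCat (n + 1)).semiPath_composite (cubeCat_nonContracting (n + 1)) x with
  | of x h =>
    obtain ⟨y, rfl⟩ := h
    refine composite_toSemiPath y (vertexSrc_eq_cubeInitial_iff.1 ?_)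
    rw [← hx]
    exact ((cubeCat (n + 1)).semiPathGrading_toSemiPath _ y).symm
  | comp m x y h _ _ ihx ihy =>
    have h' := app_composable (cubeGrading n) h
    rw [app_comp _ m x y h h'] at hx
    exact .comp m x y h (ihx hx) (ihy (h'.symm.trans hx))

/-- The generators of the fibre. -/
noncomputable def fibreGen (n : ℕ) (σ : (simplexFaces n).Face) :
    (cubeFibre n).carrier :=
  ⟨semiPathGen n σ, grade_semiPathGen σ⟩

theorem fibre_composite_of_composite {x : (cubeSemiPath n).carrier}
    (h : (cubeSemiPath n).Composite (Set.range (semiPathGen n)) x) :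
    ∃ hx : app (cubeGrading n) x = cubeInitial (n + 1),
      (cubeFibre n).Composite (Set.range (fibreGen n)) ⟨x, hx⟩ := by
  induction h with
  | of x h =>
    obtain ⟨σ, rfl⟩ := h
    exact ⟨grade_semiPathGen σ, .of _ ⟨σ, rfl⟩⟩
  | comp m x y h _ _ ihx ihy =>
    obtain ⟨hx, ihx⟩ := ihx
    obtain ⟨hy, ihy⟩ := ihy
    exact ⟨_, Composite.comp (C := cubeFibre n) m ⟨x, hx⟩ ⟨y, hy⟩ (Subtype.ext h) ihx ihy⟩

theorem fibre_composite (x : (cubeFibre n).carrier) :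
    (cubeFibre n).Composite (Set.range (fibreGen n)) x :=
  (fibre_composite_of_composite (composite_of_grade x.1 x.2)).2

/-- The restriction ω-functor on the fibre. -/
noncomputable def fibreToSimplex (n : ℕ) :
    cubeFibre n ⟶
      (simplexFaces n).cellCat :=
  fibreIncl (cubeGrading n) (cubeInitial (n + 1)) ≫
    (cubeCat (n + 1)).semiPathDesc (cubeCat_nonContracting (n + 1))
    (pathToSimplex n) fun _ _ => pathToSimplex_germ

theorem fibreToSimplex_gen (σ : (simplexFaces n).Face) :
    app (fibreToSimplex n) (fibreGen n σ) = simplexAtom σ := by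
  have e : app (fibreToSimplex n) (fibreGen n σ) = app (pathToSimplex n) (facePath n σ) :=
    congrArg (fun F => app F (facePath n σ))
      ((cubeCat (n + 1)).toSemiPath_desc (cubeCat_nonContracting (n + 1)) (pathToSimplex n)
        fun _ _ => pathToSimplex_germ)
  rw [e, pathToSimplex_apply, pathRestrict_of (coeff_facePath σ)]
  exact FaceSystem.cell_ext fun α τ => (simplexAtom_coeff α σ τ).symm

theorem dim_fibreGen_le (σ : (simplexFaces n).Face) :
    (cubeFibre n).dim (fibreGen n σ) ≤ (simplexFaces n).dim σ := by
  rw [dim_le_iff _ _ _ 1]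
  refine Subtype.ext ((app_d _ 1 _ (facePath n σ)).symm.trans (congrArg _ ?_))
  refine Subtype.ext (Subtype.ext (FaceSystem.cellD_eq_self (fun α a ha => ?_) 1))
  rw [← dim_faceMap σ] at ha
  exact ((cubeBasis (n + 1)).coeff_of_dim_le α ha.le).trans
    (if_neg (by rintro rfl; exact lt_irrefl _ ha))

/-- The fibre over the initial vertex, as a cover of the cells of the simplex. -/
noncomputable def fibreCover (n : ℕ) : (simplexBasis n).Cover
    (cubeFibre n) where
  map := fibreToSimplex n
  gen := fibreGen n
  map_gen := fibreToSimplex_gen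
  dim_gen := dim_fibreGen_le
  composite := fibre_composite

end SemiPathFibre

theorem theorem4 (n : ℕ) :
    ∃! e : simplexCat n ≅ (cubeCat (n + 1)).semiPathFibre (cubeCat_nonContracting (n + 1))
        (cubeInitial (n + 1)),
      ∀ σ : (simplexFaces n).Face,
        (OmegaCat.app e.hom (simplexFace σ)).1 =
          OmegaCat.app ((cubeCat (n + 1)).toSemiPath (cubeCat_nonContracting (n + 1)))
            (facePath n σ) := by
  have h : ∀ σ, (app (fibreCover n).iso.symm.hom (simplexFace σ)).1 = semiPathGen n σ :=
    fun σ => congrArg Subtype.val ((fibreCover n).iso_inv_atom σ)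
  refine ⟨(fibreCover n).iso.symm, h, fun e he => Iso.ext (generate_hom_ext ?_)⟩
  rintro _ ⟨σ, rfl⟩
  exact Subtype.ext ((he σ).trans (h σ).symm)
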